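/- **Setting.** Let $q,\upsilon$ be positive integers and $M\ge 0$. Let $\Omega$ be a standard Borel space with a $\sigma$-finite diffuse (atomless: $B_0(\{\omega\})=0$ for all $\omega$) measure $B_0$, and let $\rho_q(d\mathbf s\mid\omega)$ be a kernel from $\Omega$ to $\mathbb R_+^q=[0,\infty)^q$ with, for every $\omega$, $\rho_q(\{\mathbf 0\}\mid\omega)=0$ and $\int\min(s_1+\dots+s_q,1)\,\rho_q(d\mathbf s\mid\omega)<\infty$. Let $G_{A_0}(\cdot\mid\mathbf s)$, $\mathbf s\in\mathbb R_+^q$, be a probability kernel to $\mathbb R^\upsilon$, put $\pi_{A_0}(\mathbf s)=G_{A_0}(\mathbb R^\upsilon\setminus\{\mathbf 0\}\mid\mathbf s)$, and assume $1-\pi_{A_0}(\mathbf s)=G_{A_0}(\{\mathbf 0\}\mid\mathbf s)>0$ for all $\mathbf s$ and $\int_\Omega\int\pi_{A_0}(\mathbf s)\,\rho_q(d\mathbf s\mid\omega)B_0(d\omega)<\infty$ (each process below exhibits finitely many features). For a measure $\nu$ on $\mathbb R_+^q\times\Omega$, a random measure $N$ is $\mathrm{PRM}(\nu)$ if it is a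 Poisson random measure with mean measure $\nu$; then $\mu_0=(\mu_1,\dots,\mu_q)$, $\mu_j(d\omega)=\int s_jN(d\mathbf s,d\omega)$, is a multivariate $\mathrm{CRM}(\nu)$. Let $N=\sum_k\delta_{(\mathbf s_k,\tilde\omega_k)}$ (finitely or infinitely many points) be $\mathrm{PRM}(\rho_qB_0)$, where $\rho_qB_0=\rho_q(d\mathbf s\mid\omega)B_0(d\omega)$, with associated $\mu_0$. The processes $Z^{(1)}_0,\dots,Z^{(M)}_0$ are iid $\mathrm{IBP}(G_{A_0}\mid\mu_0)$ given $\mu_0$: $Z^{(i)}_0=(Z^{(i)}_1,\dots,Z^{(i)}_\upsilon)$, $Z^{(i)}_j=\sum_kA^{(i)}_{j,k}\delta_{\tilde\omega_k}$, where, given the points, the vectors $A^{(i)}_{0,k}=(A^{(i)}_{1,k},\dots,A^{(i)}_{\upsilon,k})$ are independent over $(i,k)$ with laws $G_{A_0}(\cdot\mid\mathbf s_k)$. When the points form a $\mathrm{PRM}(\nu)$, the marginal law of one such process is called $\mathrm{IBP}(A_0,\nu)$. Let $\omega_1,\dots,\omega_K$ be the distinct $\omega$ with $Z^{(i)}_0(\{\omega\})\neq\mathbf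 0$ for some $i\le M$ (almost surely $K<\infty$), and $\mathbf a^{(i)}_{0,\ell}=Z^{(i)}_0(\{\omega_\ell\})$. Set $$\rho_{q,M}(d\mathbf s\mid\omega)=[1-\pi_{A_0}(\mathbf s)]^M\rho_q(d\mathbf s\mid\omega),\qquad h(d\mathbf a\mid\mathbf s)=\Big[\tfrac{G_{A_0}(d\mathbf a\mid\mathbf s)}{1-\pi_{A_0}(\mathbf s)}\Big]^{\mathbb I\{\mathbf a\ne\mathbf 0\}}$$ (unit mass at $\mathbf a=\mathbf 0$, and $G_{A_0}(d\mathbf a\mid\mathbf s)/(1-\pi_{A_0}(\mathbf s))$ on $\mathbf a\neq\mathbf 0$). **The jumps.** Let $\kappa(d\mathbf s\mid\omega,\mathbf a^{(1)},\dots,\mathbf a^{(M)})$ be a probability kernel that is the normalization in $\mathbf s$ of $$[1-\pi_{A_0}(\mathbf s)]^M\rho_q(d\mathbf s\mid\omega)\prod_{i=1}^Mh(d\mathbf a^{(i)}\mid\mathbf s),$$ i.e. the measure $[1-\pi_{A_0}(\mathbf s)]^M\rho_q(d\mathbf s\mid\omega)B_0(d\omega)\prod_ih(d\mathbf a^{(i)}\mid\mathbf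 s)$, restricted to $(\mathbf a^{(1)},\dots,\mathbf a^{(M)})\neq\mathbf 0$, equals its marginal in $(\omega,\mathbf a)$ times $\kappa$. Given $Z^{(1)}_0,\dots,Z^{(M)}_0$, let $\mathbf J_{q,\ell}=(J_{1,\ell},\dots,J_{q,\ell})$, $\ell=1,\dots,K$, be independent with laws $\kappa(\cdot\mid\omega_\ell,\mathbf a^{(1)}_{0,\ell},\dots,\mathbf a^{(M)}_{0,\ell})$. **Proposition.** Such a kernel $\kappa$, a $\mathrm{PRM}(\rho_{q,M}B_0)$ and the law $\mathrm{IBP}(A_0,\rho_{q,M}B_0)$ exist, and for each such $\kappa$: 1. The posterior (regular conditional) distribution of $N$ given $(Z^{(1)}_0,\dots,Z^{(M)}_0)$ is the distribution of $N_M+\sum_{\ell=1}^K\delta_{(\mathbf J_{q,\ell},\omega_\ell)}$, where $N_M$ is $\mathrm{PRM}(\rho_{q,M}B_0)$, independent of $(\mathbf J_{q,\ell})$. If $G_{A_0}(d\mathbf a\mid\mathbf s)=g(\mathbf a\mid\mathbf s)\lambda(d\mathbf a)$ on $\mathbf a\ne\mathbf 0$, for some $\sigma$-finite $\lambda$ and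 jointly measurable $g\ge 0$, then almost surely, for every $\ell$, the law of $\mathbf J_{q,\ell}$ is $$\frac{[1-\pi_{A_0}(\mathbf s)]^M\prod_{i=1}^Mh_{i,\ell}(\mathbf s)\,\rho_q(d\mathbf s\mid\omega_\ell)}{\int[1-\pi_{A_0}(\mathbf t)]^M\prod_{i=1}^Mh_{i,\ell}(\mathbf t)\,\rho_q(d\mathbf t\mid\omega_\ell)},\qquad h_{i,\ell}(\mathbf s)=\Big[\tfrac{g(\mathbf a^{(i)}_{0,\ell}\mid\mathbf s)}{1-\pi_{A_0}(\mathbf s)}\Big]^{\mathbb I\{\mathbf a^{(i)}_{0,\ell}\neq\mathbf 0\}}.$$ 2. The posterior distribution of $\mu_0$ given $(Z^{(1)}_0,\dots,Z^{(M)}_0)$ is that of the multivariate process with components $\mu_{j,M}+\sum_{\ell=1}^KJ_{j,\ell}\delta_{\omega_\ell}$, $j=1,\dots,q$, where $(\mu_{1,M},\dots,\mu_{q,M})$ is a multivariate $\mathrm{CRM}(\rho_{q,M}B_0)$ independent of $(\mathbf J_{q,\ell})$. 3. If $Z^{(M+1)}_0$ is a further process such that $Z^{(1)}_0,\dots,Z^{(M+1)}_0$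 are iid $\mathrm{IBP}(G_{A_0}\mid\mu_0)$ given $\mu_0$, then the conditional distribution of $Z^{(M+1)}_0$ given $(Z^{(1)}_0,\dots,Z^{(M)}_0)$ is that of the vector with components $\tilde Z^{(M+1)}_j+\sum_{\ell=1}^KA^{(\ell)}_j\delta_{\omega_\ell}$, $j=1,\dots,\upsilon$, where $\tilde Z^{(M+1)}_0$ has law $\mathrm{IBP}(A_0,\rho_{q,M}B_0)$ and is independent of the independent vectors $A^{(\ell)}_0$, with $A^{(\ell)}_0\mid\mathbf J_{q,\ell}=\mathbf s$ having law $G_{A_0}(\cdot\mid\mathbf s)$. -/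

import Mathlib

open MeasureTheory ProbabilityTheory
open scoped NNReal ENNReal

noncomputable section

/-- `Q` is the law, on the space of measures on `S`, of a Poisson random measure `N` with mean
measure `ν`: `N(E)` is Poisson with mean `ν(E)` when `ν(E) < ∞`, and the values of `N` on disjoint
sets are independent. -/
structure IsPRMLaw {S : Type*} [MeasurableSpace S] (ν : Measure S) (Q : Measure (Measure S)) :
    Prop where
  isProb : IsProbabilityMeasure Q
  poisson : ∀ E : Set S, MeasurableSet E → ν E ≠ ∞ →
    Q.map (fun N => N E) = (poissonMeasure (ν E).toNNReal).map (fun n : ℕ => (n : ℝ≥0∞))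
  indep : ∀ (n : ℕ) (E : Fin n → Set S), (∀ i, MeasurableSet (E i)) →
    Pairwise (fun i j => Disjoint (E i) (E j)) →
    iIndepFun (fun (i : Fin n) (N : Measure S) => N (E i)) Q

/-- The σ-algebra on signed measures generated by the evaluations `z ↦ z B`, `B` measurable. -/
instance signedMeasureMeasurableSpace {Ω : Type*} [MeasurableSpace Ω] :
    MeasurableSpace (SignedMeasure Ω) :=
  ⨆ (B : Set Ω) (_ : MeasurableSet B),
    MeasurableSpace.comap (fun z : SignedMeasure Ω => z B) inferInstance

/-- `Λ` is a (regular) conditional law of `X` given `Y`: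
`P(X ∈ C | σ(Y)) = Λ(Y, C)` almost surely, for every measurable `C`. -/
def IsCondLaw {Ξ 𝒳 𝒴 : Type*} [MeasurableSpace Ξ] [MeasurableSpace 𝒳] [MeasurableSpace 𝒴]
    (P : Measure Ξ) (Y : Ξ → 𝒴) (X : Ξ → 𝒳) (Λ : 𝒴 → Measure 𝒳) : Prop :=
  Measurable Y ∧ Measurable X ∧ ∀ C : Set 𝒳, MeasurableSet C →
    P[(X ⁻¹' C).indicator (fun _ => (1 : ℝ)) | MeasurableSpace.comap Y inferInstance]
      =ᵐ[P] fun ξ => (Λ (Y ξ)).real C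

section IBP

variable {Ω : Type*} [MeasurableSpace Ω] {q υ M : ℕ}

/-- A point `(ω, s)` consists of a feature `ω` and its vector of jumps `s ∈ ℝ₊^q`. A
configuration is a countable list of points, in which the Boolean flag of the `k`-th entry tells
whether the entry is really present (so that there may be finitely or infinitely many points). -/
abbrev Config (Ω : Type*) (q : ℕ) : Type _ := ℕ → Bool × (Ω × (Fin q → ℝ≥0))

/-- The point measure `N = ∑ₖ δ_(ω̃ₖ, sₖ)` of a configuration (sum over the points present). -/
def pointMeasure (c : Config Ω q) : Measure (Ω × (Fin q → ℝ≥0)) :=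
  Measure.sum fun k => if (c k).1 then Measure.dirac (c k).2 else 0

/-- The multivariate random measure `μ₀ = (μ₁, …, μ_q)`, `μⱼ(dω) = ∫ sⱼ N(dω, ds)`, determined by
`N`. If `N` is `PRM(ν)` then `μ₀` is `CRM(ν)`. -/
def crm (N : Measure (Ω × (Fin q → ℝ≥0))) : Fin q → Measure Ω := fun j =>
  (N.withDensity fun x => (x.2 j : ℝ≥0∞)).map Prod.fst

/-- The vector-valued process `Z₀ = (Z₁, …, Z_υ)`, `Zⱼ = ∑ₖ aⱼₖ δ_ω̃ₖ` (sum over the points present;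
in the situation considered almost surely all but finitely many terms vanish). -/
def featureProcess (c : Config Ω q) (a : ℕ → Fin υ → ℝ) : Fin υ → SignedMeasure Ω := fun j =>
  ∑ᶠ k, (if (c k).1 then a k j else 0) • (Measure.dirac (c k).2.1).toSignedMeasure

/-- The model for processes `Z⁽ⁱ⁾ = ∑ₖ A⁽ⁱ⁾ₖ δ_ω̃ₖ`, `i ∈ ι`, that are i.i.d. `IBP(G | μ₀)` given
`μ₀`: the points `c` form a Poisson random measure with mean measure `ν` and, conditionally on the
points, the marks `A⁽ⁱ⁾ₖ` are independent over all `(i, k)` with law `G(· | sₖ)`. -/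
structure IsIBPModel {Ξ ι : Type*} [MeasurableSpace Ξ] (P : Measure Ξ)
    (ν : Measure (Ω × (Fin q → ℝ≥0))) (G : Kernel (Fin q → ℝ≥0) (Fin υ → ℝ))
    (c : Ξ → Config Ω q) (A : ι → Ξ → ℕ → Fin υ → ℝ) : Prop where
  measurable_points : Measurable c
  measurable_marks : ∀ i, Measurable (A i)
  prm : IsPRMLaw ν (P.map fun ξ => pointMeasure (c ξ))
  marks : ∀ (D : Set (Config Ω q)), MeasurableSet D → ∀ (F : Finset (ι × ℕ))
    (B : ι × ℕ → Set (Fin υ → ℝ)), (∀ p, MeasurableSet (B p)) →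
    P {ξ | c ξ ∈ D ∧ ∀ p ∈ F, A p.1 ξ p.2 ∈ B p}
      = ∫⁻ ξ in c ⁻¹' D, ∏ p ∈ F, G (c ξ p.2).2.2 (B p) ∂P

/-- `R` is the marginal law `IBP(A₀, ν)` of a single process: the law of `∑ₖ Aₖ δ_ω̃ₖ`, where the
points form a `PRM(ν)` and the marks are conditionally independent with laws `G(· | sₖ)`. -/
def IsIBPLaw (ν : Measure (Ω × (Fin q → ℝ≥0))) (G : Kernel (Fin q → ℝ≥0) (Fin υ → ℝ))
    (R : Measure (Fin υ → SignedMeasure Ω)) : Prop :=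
  ∃ W : Measure (Config Ω q × (ℕ → Fin υ → ℝ)), IsProbabilityMeasure W ∧
    IsIBPModel W ν G Prod.fst (fun (_ : Unit) p => p.2) ∧
    R = W.map fun p => featureProcess p.1 p.2

/-- `1 - π(s) = P(A₀ = 0 | s)`. -/
def zeroMass (G : Kernel (Fin q → ℝ≥0) (Fin υ → ℝ)) (s : Fin q → ℝ≥0) : ℝ≥0∞ := G s {0}

/-- The mean measure `(1 - π(s))^M ρ(ds | ω) B₀(dω)`, that is `ρ_{q,M} B₀`. -/
def updatedIntensity (B₀ : Measure Ω) (ρ : Kernel Ω (Fin q → ℝ≥0))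
    (G : Kernel (Fin q → ℝ≥0) (Fin υ → ℝ)) (M : ℕ) : Measure (Ω × (Fin q → ℝ≥0)) :=
  (B₀ ⊗ₘ ρ).withDensity fun x => zeroMass G x.2 ^ M

/-- The set `{ω₁, …, ω_K}` of features exhibited by `z⁽¹⁾, …, z⁽ᴹ⁾` (when it is finite). -/
def features (z : Fin M → Fin υ → SignedMeasure Ω) : Finset Ω :=
  open Classical in
  if h : {ω : Ω | ∃ i j, z i j {ω} ≠ 0}.Finite then h.toFinset else ∅

/-- The values `(a⁽¹⁾, …, a⁽ᴹ⁾)` which `z⁽¹⁾, …, z⁽ᴹ⁾` give to the feature `ω`. -/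
def featureValues (z : Fin M → Fin υ → SignedMeasure Ω) (ω : Ω) : Fin M → Fin υ → ℝ :=
  fun i j => z i j {ω}

/-- The measure `h(da | s) = [G(da | s) / (1 - π(s))]^{1(a ≠ 0)}`: unit mass at `a = 0`, and
`G(da | s) / (1 - π(s))` on `a ≠ 0`. -/
def hMeasure (G : Kernel (Fin q → ℝ≥0) (Fin υ → ℝ)) (s : Fin q → ℝ≥0) : Measure (Fin υ → ℝ) :=
  Measure.dirac 0 + (zeroMass G s)⁻¹ • (G s).restrict {0}ᶜ

/-- `κ(ds | ω, a)` is the normalization, as a measure in `s`, of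
`(1 - π(s))^M ρ(ds | ω) ∏ᵢ h(daᵢ | s)`, for almost all `(ω, a)` with `a ≠ 0`. In other words
`B₀(dω) (1 - π(s))^M ρ(ds | ω) ∏ᵢ h(daᵢ | s)`, on `a ≠ 0`, is its own marginal in `(ω, a)` times
`κ(ds | ω, a)`. -/
def IsJumpLaw (B₀ : Measure Ω) (ρ : Kernel Ω (Fin q → ℝ≥0))
    (G : Kernel (Fin q → ℝ≥0) (Fin υ → ℝ))
    (κ : Kernel (Ω × (Fin M → Fin υ → ℝ)) (Fin q → ℝ≥0)) : Prop :=
  ∀ (D : Set (Ω × (Fin M → Fin υ → ℝ))) (C : Set (Fin q → ℝ≥0)),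
    MeasurableSet D → MeasurableSet C →
    ∫⁻ ω, ∫⁻ s in C, zeroMass G s ^ M *
        (Measure.pi fun _ : Fin M => hMeasure G s) {a | a ≠ 0 ∧ (ω, a) ∈ D} ∂(ρ ω) ∂B₀
      = ∫⁻ ω, ∫⁻ s, zeroMass G s ^ M *
        ∫⁻ a in {a | a ≠ 0 ∧ (ω, a) ∈ D}, κ (ω, a) C ∂(Measure.pi fun _ : Fin M => hMeasure G s)
          ∂(ρ ω) ∂B₀

/-- `(1 - π(s))^M ∏ᵢ hᵢ(s)` with `hᵢ(s) = [g(aᵢ | s) / (1 - π(s))]^{1(aᵢ ≠ 0)}`, when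
`G(da | s) = g(a | s) lam(da)` on `a ≠ 0`. -/
def jumpDensity (G : Kernel (Fin q → ℝ≥0) (Fin υ → ℝ))
    (g : (Fin q → ℝ≥0) → (Fin υ → ℝ) → ℝ≥0∞) (a : Fin M → Fin υ → ℝ) (s : Fin q → ℝ≥0) : ℝ≥0∞ :=
  open Classical in
  zeroMass G s ^ M * ∏ i, if a i = 0 then 1 else g s (a i) / zeroMass G s

/-- The law of `(J_ω)_ω`, `ω` running through the observed features: independent, with laws
`κ(· | ω, a(ω))`. -/
def jumpsLaw (κ : Kernel (Ω × (Fin M → Fin υ → ℝ)) (Fin q → ℝ≥0))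
    (z : Fin M → Fin υ → SignedMeasure Ω) : Measure (features z → Fin q → ℝ≥0) :=
  Measure.pi fun ω : features z => κ (ω, featureValues z ω)

/-- The law of `N_M + ∑_ℓ δ_(ω_ℓ, J_ℓ)`, with `N_M ∼ Q` independent of `(J_ℓ)`. -/
def posteriorPoints (Q : Measure (Measure (Ω × (Fin q → ℝ≥0))))
    (κ : Kernel (Ω × (Fin M → Fin υ → ℝ)) (Fin q → ℝ≥0))
    (z : Fin M → Fin υ → SignedMeasure Ω) : Measure (Measure (Ω × (Fin q → ℝ≥0))) :=
  (Q.prod (jumpsLaw κ z)).map fun p =>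
    p.1 + ∑ ω : features z, Measure.dirac ((ω : Ω), p.2 ω)

/-- The law of the random vector of measures with components `μ_{j,M} + ∑_ℓ J_{j,ℓ} δ_ω_ℓ`, with
`(μ_{1,M}, …, μ_{q,M})` determined by `N_M ∼ Q` and independent of `(J_ℓ)`. -/
def posteriorCRM (Q : Measure (Measure (Ω × (Fin q → ℝ≥0))))
    (κ : Kernel (Ω × (Fin M → Fin υ → ℝ)) (Fin q → ℝ≥0))
    (z : Fin M → Fin υ → SignedMeasure Ω) : Measure (Fin q → Measure Ω) :=
  ((Q.map crm).prod (jumpsLaw κ z)).map fun p j =>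
    p.1 j + ∑ ω : features z, p.2 ω j • Measure.dirac (ω : Ω)

/-- The law of the random vector with components `Z̃ⱼ + ∑_ℓ A^{(ℓ)}ⱼ δ_ω_ℓ`, with `Z̃ ∼ R`
independent of the independent vectors `A^{(ℓ)}`, where `A^{(ℓ)}` has law `G(· | s)` given
`J_ℓ = s`. -/
def predictiveLaw (R : Measure (Fin υ → SignedMeasure Ω)) (G : Kernel (Fin q → ℝ≥0) (Fin υ → ℝ))
    (κ : Kernel (Ω × (Fin M → Fin υ → ℝ)) (Fin q → ℝ≥0))
    (z : Fin M → Fin υ → SignedMeasure Ω) : Measure (Fin υ → SignedMeasure Ω) :=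
  (R.prod (Measure.pi fun ω : features z => (κ (ω, featureValues z ω)).bind G)).map fun p j =>
    p.1 j + ∑ ω : features z, p.2 ω j • (Measure.dirac (ω : Ω)).toSignedMeasure

end IBP

end

/-! Attach to every point `(ω, s)` of the Poisson random measure `N` its vector `a` of `M` marks. By
the marking theorem the points `((ω, a), s)` again form a Poisson random measure. Its mean measure
(`jointIntensity`) splits according to `a = 0` or `a ≠ 0`. Since `a = 0` has probability `(1 -
π(s))^M`, the first part is `updatedIntensity`. The second part is finite by a union bound over the
marks and the assumption of finitely many features, so it disintegrates as `m ⊗ₘ κ`, with `m` its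
marginal in `(ω, a)`; the defining property of the jump kernel says exactly this (`isJumpLaw_iff`).

The same Poisson law is therefore produced by an explicit model (`modelPoints`): an unseen Poisson
random measure `N₀`, independent of a Poisson number of iid points `(ω_k, a_k)`, to each of which a
jump with law `κ(· | ω_k, a_k)` is attached. In the model the observed processes are a function of
the points `(ω_k, a_k)` alone. As `B₀` is diffuse, the locations are almost surely distinct, so that
features and values can be read off from the processes. Given the sample `(ω_k, a_k)`, the law of
`N` is visibly that of `N₀ + ∑ δ_(ω_k, J_k)`, and it depends on the sample only through the
processes (`posteriorLaw_finiteProcess`). Fubini's theorem then gives the conditional law in the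
model.

To return to the given probability space, Poisson laws are characterized by their Laplace functional
(`HasPoissonLaplace.unique`), and everything needed is expressed as a measurable function of the
point measure: the processes (`processOf`), the points (`dropValue`) and the distinctness of the
locations (`codeSimple`). The posterior law must also be measurable in the processes; this is a
Souslin-type argument (`exists_measurable_posteriorLaw_eq`).

The abstract result, `isCondLaw_posteriorLaw`, allows any standard Borel space of jumps. With `T =
ℝ₊^q` it gives the posterior of `N`, whose image under `crm` is the posterior of `μ₀`. With `T` the
space of pairs (jump, further mark) and the kernel `κ ⊗ₖ G` it gives the predictive law. The density
of the jumps is Bayes' formula, obtained by computing the disintegration against a product reference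
measure. -/

noncomputable section

open Filter Topology

/-! ### The exponential on `[0, ∞]` and the Poisson generating function. -/

/-- The decreasing exponential `x ↦ exp (-x)` on `[0, ∞]`. -/
def negexp (x : ℝ≥0∞) : ℝ≥0∞ := (EReal.exp (x : EReal))⁻¹

theorem one_le_exp_coe (x : ℝ≥0∞) : 1 ≤ EReal.exp (x : EReal) := by
  rw [EReal.one_le_exp_iff]; exact EReal.coe_ennreal_nonneg x

@[simp] theorem negexp_zero : negexp 0 = 1 := by simp [negexp]

theorem negexp_le_one (x : ℝ≥0∞) : negexp x ≤ 1 := by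
  simpa [negexp] using one_le_exp_coe x

theorem negexp_ne_top (x : ℝ≥0∞) : negexp x ≠ ∞ := ne_top_of_le_ne_top (by simp) (negexp_le_one x)

theorem negexp_add (x y : ℝ≥0∞) : negexp (x + y) = negexp x * negexp y := by
  have hx := (one_pos.trans_le (one_le_exp_coe x)).ne'
  have hy := (one_pos.trans_le (one_le_exp_coe y)).ne'
  rw [negexp, EReal.coe_ennreal_add, EReal.exp_add, ENNReal.mul_inv (Or.inl hx) (Or.inr hy)]
  rfl

theorem negexp_sum {ι : Type*} (s : Finset ι) (f : ι → ℝ≥0∞) :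
    negexp (∑ i ∈ s, f i) = ∏ i ∈ s, negexp (f i) := by
  classical
  induction s using Finset.induction_on with
  | empty => simp
  | insert a s ha ih => rw [Finset.sum_insert ha, Finset.prod_insert ha, negexp_add, ih]

theorem negexp_nat_mul (n : ℕ) (x : ℝ≥0∞) : negexp (n * x) = negexp x ^ n := by
  have := negexp_sum (Finset.range n) fun _ => x
  simpa using this

theorem continuous_negexp : Continuous negexp :=
  continuous_inv.comp (ENNReal.continuous_exp.comp continuous_coe_ennreal_ereal)

@[fun_prop]
theorem measurable_negexp : Measurable negexp := continuous_negexp.measurable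

theorem negexp_antitone : Antitone negexp := fun x y h => by
  unfold negexp
  rw [ENNReal.inv_le_inv]
  exact EReal.exp_monotone (by exact_mod_cast h)

theorem negexp_coe (x : ℝ≥0) : negexp x = ENNReal.ofReal (Real.exp (-x)) := by
  rw [Real.exp_neg, ENNReal.ofReal_inv_of_pos (Real.exp_pos _)]
  rfl

theorem negexp_injective : Function.Injective negexp := fun x y h => by
  have := EReal.exp_strictMono.injective (inv_injective h)
  exact_mod_cast this

theorem negexp_eq_one_iff {x : ℝ≥0∞} : negexp x = 1 ↔ x = 0 := by
  rw [← negexp_zero, negexp_injective.eq_iff]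

/-- The inverse of `negexp` on `[0, 1]`. -/
def neglog (p : ℝ≥0∞) : ℝ≥0∞ := (-ENNReal.log p).toENNReal

theorem negexp_neglog {p : ℝ≥0∞} (hp : p ≤ 1) : negexp (neglog p) = p := by
  unfold negexp neglog
  rw [EReal.coe_toENNReal (by simpa using hp), EReal.exp_neg, ENNReal.exp_log, inv_inv]

theorem neglog_negexp (x : ℝ≥0∞) : neglog (negexp x) = x :=
  negexp_injective (negexp_neglog (negexp_le_one x))

@[simp] theorem neglog_one : neglog 1 = 0 := by simp [neglog]

@[fun_prop]
theorem measurable_neglog : Measurable neglog := by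
  unfold neglog
  exact measurable_ereal_toENNReal.comp (measurable_id.ennreal_log.neg)

/-- The exponential series at `r p`, times `exp (-r)`. The bound `p ≤ 1` makes the truncated
subtraction a genuine one. -/
theorem lintegral_pow_poissonMeasure (r : ℝ≥0) {p : ℝ≥0∞} (hp : p ≤ 1) :
    ∫⁻ n, p ^ n ∂(poissonMeasure r) = negexp (r * (1 - p)) := by
  lift p to ℝ≥0 using ne_top_of_le_ne_top (by simp) hp
  have hp' : p ≤ 1 := by exact_mod_cast hp
  have h1 : (r : ℝ≥0∞) * (1 - p) = ((r * (1 - p) : ℝ≥0) : ℝ≥0∞) := by push_cast; rfl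
  rw [h1, negexp_coe, poissonMeasure, lintegral_sum_measure]
  have hs : HasSum (fun n : ℕ => Real.exp (-r) * ((r * p : ℝ) ^ n / (n.factorial : ℝ)))
      (Real.exp (-r) * Real.exp (r * p)) := by
    have := (NormedSpace.expSeries_div_hasSum_exp ((r : ℝ) * p)).mul_left (Real.exp (-r))
    rwa [← Real.exp_eq_exp_ℝ] at this
  have h2 : Real.exp (-((r * (1 - p) : ℝ≥0) : ℝ)) = Real.exp (-r) * Real.exp (r * p) := by
    rw [← Real.exp_add, NNReal.coe_mul, NNReal.coe_sub hp']
    congr 1; push_cast; ring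
  rw [h2, ← hs.tsum_eq, ENNReal.ofReal_tsum_of_nonneg (fun n => by positivity) hs.summable]
  refine tsum_congr fun n => ?_
  rw [lintegral_smul_measure, lintegral_dirac, smul_eq_mul, ← ENNReal.coe_pow,
    ← ENNReal.ofReal_coe_nnreal, ← ENNReal.ofReal_mul (by positivity)]
  congr 1
  push_cast
  rw [mul_pow]; ring

theorem lintegral_negexp_mul_poissonMeasure (r : ℝ≥0) (c : ℝ≥0∞) :
    ∫⁻ x, negexp (c * x) ∂((poissonMeasure r).map (fun n : ℕ => (n : ℝ≥0∞)))
      = negexp (r * (1 - negexp c)) := by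
  rw [lintegral_map (by fun_prop) .of_discrete,
    ← lintegral_pow_poissonMeasure r (negexp_le_one c)]
  refine lintegral_congr fun n => ?_
  rw [mul_comm, negexp_nat_mul]

/-! ### Laplace transforms determine laws of random measures. -/

section Uniqueness

open scoped BoundedContinuousFunction

/-- Finite measures on a cube are determined by their moments. -/
theorem Measure.ext_of_moments {ι : Type*} [Fintype ι] {μ ν : Measure (ι → unitInterval)}
    [IsFiniteMeasure μ] [IsFiniteMeasure ν]
    (h : ∀ c : ι → ℕ, ∫ x, ∏ i, (x i : ℝ) ^ c i ∂μ = ∫ x, ∏ i, (x i : ℝ) ^ c i ∂ν) : μ = ν := by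
  classical
  let co : ι → ((ι → unitInterval) →ᵇ ℝ) := fun i =>
    BoundedContinuousFunction.mkOfCompact ⟨fun x => (x i : ℝ), by fun_prop⟩
  let A := StarAlgebra.adjoin ℝ (Set.range co)
  refine ext_of_forall_mem_subalgebra_integral_eq_of_polish (𝕜 := ℝ) (A := A) ?_ ?_
  · intro x y hxy
    obtain ⟨i, hi⟩ := Function.ne_iff.1 hxy
    refine ⟨fun z => (z i : ℝ), ⟨co i, ⟨co i, ?_, rfl⟩, rfl⟩, ?_⟩
    · exact StarAlgebra.subset_adjoin ℝ _ ⟨i, rfl⟩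
    · simpa [Subtype.ext_iff] using hi
  · intro g hg
    have hg' : g ∈ (StarAlgebra.adjoin ℝ (Set.range co)).toSubalgebra := hg
    rw [StarAlgebra.adjoin_toSubalgebra] at hg'
    -- The coordinates are real-valued, so the generated star algebra is the linear span of the
    -- monomials.
    have hstar : star (Set.range co) = Set.range co := by
      ext f; rw [Set.mem_star]
      have : star f = f := by ext x; simp
      rw [this]
    rw [hstar, Set.union_self, ← Subalgebra.mem_toSubmodule, Algebra.adjoin_eq_span] at hg'
    clear hg
    induction hg' using Submodule.span_induction with
    | mem f hf =>
      have : ∃ c : ι → ℕ, ∀ x, f x = ∏ i, (x i : ℝ) ^ c i := by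
        induction hf using Submonoid.closure_induction with
        | mem f hf =>
          obtain ⟨i, rfl⟩ := hf
          refine ⟨Pi.single i 1, fun x => ?_⟩
          rw [Finset.prod_eq_single i]
          · simp [co]
          · intro j _ hj; simp [hj]
          · simp
        | one => exact ⟨0, fun x => by simp⟩
        | mul f g _ _ hf hg =>
          obtain ⟨c, hc⟩ := hf
          obtain ⟨d, hd⟩ := hg
          exact ⟨c + d, fun x => by simp [hc, hd, pow_add, Finset.prod_mul_distrib]⟩
      obtain ⟨c, hc⟩ := this
      simp_rw [hc]
      exact h c
    | zero => simp
    | add f g _ _ hf hg =>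
      simp only [BoundedContinuousFunction.coe_add, Pi.add_apply]
      rw [integral_add (f.integrable μ) (g.integrable μ),
        integral_add (f.integrable ν) (g.integrable ν), hf, hg]
    | smul a f _ hf =>
      simp only [BoundedContinuousFunction.coe_smul, smul_eq_mul, integral_const_mul]
      rw [hf]

/-- Probability measures on `[0, ∞]^ι` are determined by their Laplace transforms. -/
theorem Measure.ext_of_laplace {ι : Type*} [Fintype ι] {μ ν : Measure (ι → ℝ≥0∞)}
    [IsProbabilityMeasure μ] [IsProbabilityMeasure ν]
    (h : ∀ c : ι → ℕ, ∫⁻ x, negexp (∑ i, c i * x i) ∂μ = ∫⁻ x, negexp (∑ i, c i * x i) ∂ν) :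
    μ = ν := by
  let F : (ι → ℝ≥0∞) → (ι → unitInterval) := fun x i =>
    ⟨(negexp (x i)).toReal, ENNReal.toReal_nonneg,
      ENNReal.toReal_le_of_le_ofReal zero_le_one (by simpa using negexp_le_one _)⟩
  have hF : Measurable F := by
    refine measurable_pi_lambda _ fun i => Measurable.subtype_mk ?_
    fun_prop
  have hinj : Function.Injective F := fun x y hxy => by
    ext1 i
    have := congrArg Subtype.val (congrFun hxy i)
    exact negexp_injective ((ENNReal.toReal_eq_toReal_iff' (negexp_ne_top _)
      (negexp_ne_top _)).1 this)
  -- An injective Borel map between standard Borel spaces is an embedding, so nothing is lost by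
  -- moving to the cube, where moments of `exp (-xᵢ)` are Laplace transforms at integer points.
  have hemb : MeasurableEmbedding F := hF.measurableEmbedding hinj
  have key : μ.map F = ν.map F := by
    have := Measure.isProbabilityMeasure_map (μ := μ) hF.aemeasurable
    have := Measure.isProbabilityMeasure_map (μ := ν) hF.aemeasurable
    refine Measure.ext_of_moments fun c => ?_
    have hm : Continuous fun x : ι → unitInterval => ∏ i, (x i : ℝ) ^ c i := by fun_prop
    rw [integral_map hF.aemeasurable hm.measurable.aestronglyMeasurable,
      integral_map hF.aemeasurable hm.measurable.aestronglyMeasurable]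
    have e : ∀ x, ∏ i, (F x i : ℝ) ^ c i = (negexp (∑ i, c i * x i)).toReal := fun x => by
      simp_rw [negexp_sum, negexp_nat_mul, ENNReal.toReal_prod, ENNReal.toReal_pow]
      rfl
    simp_rw [e]
    have hl : Measurable fun x : ι → ℝ≥0∞ => negexp (∑ i, c i * x i) := by fun_prop
    rw [integral_toReal hl.aemeasurable (ae_of_all _ fun x => (negexp_ne_top _).lt_top),
      integral_toReal hl.aemeasurable (ae_of_all _ fun x => (negexp_ne_top _).lt_top), h c]
  rw [← hemb.comap_map μ, key, hemb.comap_map]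

variable {X : Type*} [MeasurableSpace X]

/-- A law on the space of measures is determined by its Laplace functional. -/
theorem Measure.ext_of_laplace_functional {Q Q' : Measure (Measure X)}
    [IsProbabilityMeasure Q] [IsProbabilityMeasure Q']
    (h : ∀ f : X → ℝ≥0∞, Measurable f →
      ∫⁻ N, negexp (∫⁻ x, f x ∂N) ∂Q = ∫⁻ N, negexp (∫⁻ x, f x ∂N) ∂Q') : Q = Q' := by
  let Φ : Measure X → ({E : Set X // MeasurableSet E} → ℝ≥0∞) := fun N E => N E
  have hΦ : Measurable Φ := measurable_pi_lambda _ fun E => Measure.measurable_coe E.2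
  have key : Q.map Φ = Q'.map Φ := by
    have := Measure.isProbabilityMeasure_map (μ := Q) hΦ.aemeasurable
    have := Measure.isProbabilityMeasure_map (μ := Q') hΦ.aemeasurable
    -- A law on the product over all measurable sets is determined by its finite-dimensional
    -- marginals; a linear combination of the values `N E` is the integral of a step function, which
    -- brings in the Laplace functional.
    refine IsProjectiveLimit.unique (P := fun I => (Q'.map Φ).map I.restrict) ?_ fun I => rfl
    intro I
    have hI := Finset.measurable_restrict (X := fun _ : {E : Set X // MeasurableSet E} => ℝ≥0∞) I
    have := Measure.isProbabilityMeasure_map (μ := Q.map Φ) hI.aemeasurable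
    have := Measure.isProbabilityMeasure_map (μ := Q'.map Φ) hI.aemeasurable
    refine Measure.ext_of_laplace fun c => ?_
    rw [lintegral_map (by fun_prop) hI, lintegral_map (by fun_prop) hI,
      lintegral_map (by fun_prop) hΦ, lintegral_map (by fun_prop) hΦ]
    have e : ∀ N : Measure X, ∑ i : I, (c i : ℝ≥0∞) * I.restrict (Φ N) i
        = ∫⁻ x, ∑ i : I, (c i : ℝ≥0∞) * (i : {E // MeasurableSet E}).1.indicator 1 x ∂N := by
      intro N
      rw [lintegral_finsetSum]
      · refine Finset.sum_congr rfl fun i _ => ?_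
        rw [lintegral_const_mul _ (measurable_one.indicator i.1.2), lintegral_indicator_one i.1.2]
        rfl
      · exact fun i _ => (measurable_one.indicator i.1.2).const_mul _
    simp_rw [e]
    exact h _ (Finset.measurable_sum _ fun i _ => (measurable_one.indicator i.1.2).const_mul _)
  have hcomap : ∀ C : Set (Measure X), MeasurableSet C →
      MeasurableSet[MeasurableSpace.comap Φ inferInstance] C := by
    have : (Measure.instMeasurableSpace : MeasurableSpace (Measure X))
        ≤ MeasurableSpace.comap Φ inferInstance := by
      refine iSup₂_le fun E hE => ?_
      rintro _ ⟨B, hB, rfl⟩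
      exact ⟨(fun y => y ⟨E, hE⟩) ⁻¹' B, measurable_pi_apply _ hB, rfl⟩
    exact fun C hC => this C hC
  ext C hC
  obtain ⟨D, hD, rfl⟩ := hcomap C hC
  rw [← Measure.map_apply hΦ hD, key, Measure.map_apply hΦ hD]

end Uniqueness

/-! ### The Laplace functional of a Poisson random measure. -/

section PoissonLaplace

variable {X Y : Type*} [MeasurableSpace X] [MeasurableSpace Y]

/-- `Q` is a probability law on measures with the Laplace functional of a Poisson random measure
with mean measure `ν`. -/
structure HasPoissonLaplace (ν : Measure X) (Q : Measure (Measure X)) : Prop where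
  isProb : IsProbabilityMeasure Q
  laplace : ∀ f : X → ℝ≥0∞, Measurable f →
    ∫⁻ N, negexp (∫⁻ x, f x ∂N) ∂Q = negexp (∫⁻ x, (1 - negexp (f x)) ∂ν)

@[fun_prop]
theorem measurable_negexp_lintegral {f : X → ℝ≥0∞} (hf : Measurable f) :
    Measurable fun N : Measure X => negexp (∫⁻ x, f x ∂N) :=
  measurable_negexp.comp (Measure.measurable_lintegral hf)

theorem lintegral_prod_infinitePi {ι : Type*} {U : ι → Type*} [∀ i, MeasurableSpace (U i)]
    (τ : ∀ i, Measure (U i)) [∀ i, IsProbabilityMeasure (τ i)] (s : Finset ι)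
    (g : ∀ i, U i → ℝ≥0∞) (hg : ∀ i, Measurable (g i)) :
    ∫⁻ u, ∏ i ∈ s, g i (u i) ∂(Measure.infinitePi τ) = ∏ i ∈ s, ∫⁻ x, g i x ∂(τ i) := by
  have h : iIndepFun (fun i (u : ∀ i, U i) => g i (u i)) (Measure.infinitePi τ) :=
    iIndepFun_infinitePi fun i => hg i
  rw [lintegral_prod_eq_prod_lintegral_of_indepFun s _ h fun i => by fun_prop]
  refine Finset.prod_congr rfl fun i _ => ?_
  rw [← lintegral_map (hg i) (measurable_pi_apply i), Measure.infinitePi_map_eval]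

/-- By independence the left side is an infinite product of numbers in `[0, 1]`. Writing it as
`negexp` of a sum of values of `neglog` avoids infinite products; partial sums pass to the limit by
domination by `1`. -/
theorem lintegral_negexp_tsum_infinitePi {U : ℕ → Type*} [∀ i, MeasurableSpace (U i)]
    (τ : ∀ i, Measure (U i)) [∀ i, IsProbabilityMeasure (τ i)]
    (g : ∀ i, U i → ℝ≥0∞) (hg : ∀ i, Measurable (g i)) :
    ∫⁻ u, negexp (∑' i, g i (u i)) ∂(Measure.infinitePi τ)
      = negexp (∑' i, neglog (∫⁻ x, negexp (g i x) ∂(τ i))) := by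
  have hle : ∀ i, ∫⁻ x, negexp (g i x) ∂(τ i) ≤ 1 := fun i =>
    (lintegral_mono fun x => negexp_le_one _).trans (by simp)
  have hm : ∀ i, Measurable fun x => negexp (g i x) := fun i => measurable_negexp.comp (hg i)
  have h1 : Tendsto (fun n => ∫⁻ u, negexp (∑ i ∈ Finset.range n, g i (u i))
      ∂(Measure.infinitePi τ)) atTop
      (𝓝 (∫⁻ u, negexp (∑' i, g i (u i)) ∂(Measure.infinitePi τ))) := by
    refine tendsto_lintegral_of_dominated_convergence (fun _ => 1) (fun n => ?_)
      (fun n => ae_of_all _ fun u => negexp_le_one _) (by simp) (ae_of_all _ fun u => ?_)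
    · exact measurable_negexp.comp
        (Finset.measurable_sum _ fun i _ => (hg i).comp (measurable_pi_apply i))
    · exact (continuous_negexp.tendsto _).comp (ENNReal.summable.hasSum.tendsto_sum_nat)
  have h2 : Tendsto (fun n => negexp (∑ i ∈ Finset.range n,
      neglog (∫⁻ x, negexp (g i x) ∂(τ i)))) atTop
      (𝓝 (negexp (∑' i, neglog (∫⁻ x, negexp (g i x) ∂(τ i))))) :=
    (continuous_negexp.tendsto _).comp (ENNReal.summable.hasSum.tendsto_sum_nat)
  refine tendsto_nhds_unique h1 (h2.congr fun n => ?_)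
  simp_rw [negexp_sum]
  rw [lintegral_prod_infinitePi τ _ (fun i x => negexp (g i x)) hm]
  exact Finset.prod_congr rfl fun i _ => negexp_neglog (hle i)

namespace IsPRMLaw

variable {ν : Measure X} {Q : Measure (Measure X)}

theorem laplace_set (hQ : IsPRMLaw ν Q) {E : Set X} (hE : MeasurableSet E) (hν : ν E ≠ ∞)
    (c : ℝ≥0∞) : ∫⁻ N, negexp (c * N E) ∂Q = negexp ((1 - negexp c) * ν E) := by
  have := lintegral_negexp_mul_poissonMeasure (ν E).toNNReal c
  rw [← hQ.poisson E hE hν, lintegral_map (by fun_prop) (Measure.measurable_coe hE),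
    ENNReal.coe_toNNReal hν] at this
  rw [this, mul_comm]

/-- The level sets of the nonzero values are disjoint and of finite mean measure, so their counts
are independent Poisson variables and the functional factorizes. -/
theorem laplace_simpleFunc (hQ : IsPRMLaw ν Q) (g : SimpleFunc X ℝ≥0∞)
    (hg : ν (g ⁻¹' {0})ᶜ ≠ ∞) :
    ∫⁻ N, negexp (∫⁻ x, g x ∂N) ∂Q = negexp (∫⁻ x, (1 - negexp (g x)) ∂ν) := by
  classical
  let s := g.range.filter (· ≠ 0)
  let e := s.equivFin
  let y : Fin s.card → ℝ≥0∞ := fun i => (e.symm i : ℝ≥0∞)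
  have hy : ∀ i, y i ≠ 0 := fun i => (Finset.mem_filter.1 (e.symm i).2).2
  have hyinj : Function.Injective y := Subtype.val_injective.comp e.symm.injective
  have hmeas : ∀ i, MeasurableSet (g ⁻¹' {y i}) := fun i => g.measurableSet_preimage _
  have hfin : ∀ i, ν (g ⁻¹' {y i}) ≠ ∞ := fun i => by
    refine ne_top_of_le_ne_top hg (measure_mono ?_)
    intro x hx h0
    exact hy i (hx.symm.trans h0)
  -- The level set of the value `0` may have infinite measure; both sums ignore it.
  have hsum : ∀ (F : ℝ≥0∞ → ℝ≥0∞), F 0 = 0 → ∑ c ∈ g.range, F c = ∑ i, F (y i) := by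
    intro F hF
    rw [← Finset.sum_filter_of_ne (p := (· ≠ 0)) (fun x _ hx h0 => hx (h0 ▸ hF)),
      ← Finset.sum_coe_sort, ← Equiv.sum_comp e.symm]
  have h1 : ∀ N : Measure X, ∫⁻ x, g x ∂N = ∑ i, y i * N (g ⁻¹' {y i}) := fun N => by
    rw [SimpleFunc.lintegral_eq_lintegral, SimpleFunc.lintegral,
      hsum (fun c => c * N (g ⁻¹' {c})) (by simp)]
  have h2 : ∫⁻ x, (1 - negexp (g x)) ∂ν = ∑ i, (1 - negexp (y i)) * ν (g ⁻¹' {y i}) := by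
    rw [← hsum (fun c => (1 - negexp c) * ν (g ⁻¹' {c})) (by simp), ← SimpleFunc.map_lintegral,
      ← SimpleFunc.lintegral_eq_lintegral]
    rfl
  have hi := hQ.indep s.card (fun i => g ⁻¹' {y i}) hmeas fun i j hij =>
    Set.disjoint_left.2 fun x hx hx' => hij (hyinj (hx.symm.trans hx'))
  simp_rw [h1, h2, negexp_sum]
  have hi' := hi.comp (fun i x => negexp (y i * x)) fun i => by fun_prop
  have := lintegral_prod_eq_prod_lintegral_of_indepFun Finset.univ _ hi' fun i =>
    (measurable_negexp.comp (measurable_const_mul _)).comp (Measure.measurable_coe (hmeas i))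
  refine this.trans (Finset.prod_congr rfl fun i _ => ?_)
  exact hQ.laplace_set (hmeas i) (hfin i) (y i)

/-- The definition constrains the counts only on sets of finite mean measure. By σ-finiteness `f` is
an increasing limit of simple functions supported on such sets; the left side converges by
domination, the right side by monotonicity. -/
theorem hasPoissonLaplace [SigmaFinite ν] (hQ : IsPRMLaw ν Q) : HasPoissonLaplace ν Q := by
  have hprob := hQ.isProb
  refine ⟨hQ.isProb, fun f hf => ?_⟩
  let g : ℕ → SimpleFunc X ℝ≥0∞ := fun n =>
    (SimpleFunc.eapprox f n).restrict (spanningSets ν n)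
  have hgx : ∀ n x, g n x = (spanningSets ν n).indicator (SimpleFunc.eapprox f n) x := fun n x => by
    rw [SimpleFunc.coe_restrict _ (measurableSet_spanningSets ν n)]
  have hmono : ∀ x, Monotone fun n => g n x := fun x n m hnm => by
    simp only [hgx]
    exact (Set.indicator_le_indicator (SimpleFunc.monotone_eapprox f hnm x)).trans
      (Set.indicator_le_indicator_of_subset (monotone_spanningSets ν hnm) (by simp) x)
  have hlim : ∀ x, Tendsto (fun n => g n x) atTop (𝓝 (f x)) := fun x => by
    have h := tendsto_atTop_iSup (f := fun n => SimpleFunc.eapprox f n x)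
      fun n m hnm => SimpleFunc.monotone_eapprox f hnm x
    rw [SimpleFunc.iSup_eapprox_apply hf] at h
    refine h.congr' ?_
    obtain ⟨n₀, hn₀⟩ : ∃ n, x ∈ spanningSets ν n :=
      ⟨_, mem_spanningSetsIndex ν x⟩
    filter_upwards [eventually_ge_atTop n₀] with n hn
    rw [hgx, Set.indicator_of_mem (monotone_spanningSets ν hn hn₀)]
  have hN : ∀ N : Measure X, Tendsto (fun n => ∫⁻ x, g n x ∂N) atTop (𝓝 (∫⁻ x, f x ∂N)) :=
    fun N => lintegral_tendsto_of_tendsto_of_monotone (fun n => (g n).measurable.aemeasurable)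
      (ae_of_all _ hmono) (ae_of_all _ hlim)
  have h1 : Tendsto (fun n => ∫⁻ N, negexp (∫⁻ x, g n x ∂N) ∂Q) atTop
      (𝓝 (∫⁻ N, negexp (∫⁻ x, f x ∂N) ∂Q)) :=
    tendsto_lintegral_of_dominated_convergence (fun _ => 1)
      (fun n => measurable_negexp_lintegral (g n).measurable)
      (fun n => ae_of_all _ fun u => negexp_le_one _) (by simp)
      (ae_of_all _ fun N => (continuous_negexp.tendsto _).comp (hN N))
  have h2 : Tendsto (fun n => ∫⁻ x, (1 - negexp (g n x)) ∂ν) atTop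
      (𝓝 (∫⁻ x, (1 - negexp (f x)) ∂ν)) := by
    refine lintegral_tendsto_of_tendsto_of_monotone
      (fun n => (measurable_const.sub (measurable_negexp.comp (g n).measurable)).aemeasurable)
      (ae_of_all _ fun x n m hnm => ?_) (ae_of_all _ fun x => ?_)
    · exact tsub_le_tsub_left (negexp_antitone (hmono x hnm)) 1
    · exact ENNReal.Tendsto.sub tendsto_const_nhds ((continuous_negexp.tendsto _).comp (hlim x))
        (Or.inl (by simp))
  refine tendsto_nhds_unique h1 (((continuous_negexp.tendsto _).comp h2).congr fun n => ?_)
  refine (hQ.laplace_simpleFunc (g n) ?_).symm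
  refine ne_top_of_le_ne_top (measure_spanningSets_lt_top ν n).ne (measure_mono fun x hx => ?_)
  by_contra h
  exact hx (by simp [hgx, h])

end IsPRMLaw

namespace HasPoissonLaplace

variable {ν ν' : Measure X} {Q Q' : Measure (Measure X)}

theorem unique (h : HasPoissonLaplace ν Q) (h' : HasPoissonLaplace ν Q') : Q = Q' := by
  have := h.isProb
  have := h'.isProb
  exact Measure.ext_of_laplace_functional fun f hf => by rw [h.laplace f hf, h'.laplace f hf]

theorem map (h : HasPoissonLaplace ν Q) {g : X → Y} (hg : Measurable g) :
    HasPoissonLaplace (ν.map g) (Q.map fun N => N.map g) := by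
  have := h.isProb
  have hm : Measurable fun N : Measure X => N.map g := Measure.measurable_map g hg
  refine ⟨Measure.isProbabilityMeasure_map hm.aemeasurable, fun f hf => ?_⟩
  rw [lintegral_map (by fun_prop) hm, lintegral_map (by fun_prop) hg]
  refine (lintegral_congr fun N => ?_).trans (h.laplace _ (hf.comp hg))
  rw [lintegral_map hf hg]

theorem laplace_set (h : HasPoissonLaplace ν Q) {E : Set X} (hE : MeasurableSet E) (c : ℝ≥0∞) :
    ∫⁻ N, negexp (c * N E) ∂Q = negexp ((1 - negexp c) * ν E) := by
  have := h.laplace (E.indicator fun _ => c) (measurable_const.indicator hE)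
  simp_rw [lintegral_indicator_const hE] at this
  rw [this, ← lintegral_indicator_const hE]
  congr 2 with x
  by_cases hx : x ∈ E <;> simp [hx]

/-- The one-dimensional case of `Measure.ext_of_laplace`, whence the detour through functions on
`Unit`. -/
theorem poisson (h : HasPoissonLaplace ν Q) {E : Set X} (hE : MeasurableSet E) (hν : ν E ≠ ∞) :
    Q.map (fun N => N E) = (poissonMeasure (ν E).toNNReal).map (fun n : ℕ => (n : ℝ≥0∞)) := by
  have := h.isProb
  have hm : Measurable fun (x : ℝ≥0∞) (_ : Unit) => x := by fun_prop
  have hEm : Measurable fun N : Measure X => N E := Measure.measurable_coe hE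
  have := Measure.isProbabilityMeasure_map (μ := Q) hEm.aemeasurable
  have := Measure.isProbabilityMeasure_map (μ := Q.map fun N => N E) hm.aemeasurable
  have := Measure.isProbabilityMeasure_map (μ := (poissonMeasure (ν E).toNNReal).map
    (fun n : ℕ => (n : ℝ≥0∞))) hm.aemeasurable
  have key : (Q.map (fun N => N E)).map (fun (x : ℝ≥0∞) (_ : Unit) => x)
      = ((poissonMeasure (ν E).toNNReal).map (fun n : ℕ => (n : ℝ≥0∞))).map
        (fun (x : ℝ≥0∞) (_ : Unit) => x) := by
    refine Measure.ext_of_laplace fun c => ?_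
    rw [lintegral_map (by fun_prop) hm, lintegral_map (by fun_prop) hm]
    simp only [Finset.univ_unique, Finset.sum_singleton]
    rw [lintegral_negexp_mul_poissonMeasure, lintegral_map (by fun_prop) hEm,
      h.laplace_set hE, ENNReal.coe_toNNReal hν, mul_comm]
  have key' := congrArg (Measure.map fun y : Unit → ℝ≥0∞ => y ()) key
  rw [Measure.map_map (by fun_prop) hm, Measure.map_map (by fun_prop) hm] at key'
  simpa [Function.comp_def] using key'

theorem ae_lt_top (h : HasPoissonLaplace ν Q) {E : Set X} (hE : MeasurableSet E) (hν : ν E ≠ ∞) :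
    ∀ᵐ N ∂Q, N E < ∞ := by
  have hEm : Measurable fun N : Measure X => N E := Measure.measurable_coe hE
  have : ∀ᵐ x ∂(Q.map fun N => N E), x < ∞ := by
    rw [h.poisson hE hν, ae_map_iff .of_discrete measurableSet_Iio]
    exact ae_of_all _ fun n => by simp
  exact ae_of_ae_map hEm.aemeasurable this

/-- The variable `exp (-N E)` is at most `1` and has mean `1`, hence equals `1` almost surely. -/
theorem ae_eq_zero (h : HasPoissonLaplace ν Q) {E : Set X} (hE : MeasurableSet E) (hν : ν E = 0) :
    ∀ᵐ N ∂Q, N E = 0 := by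
  have := h.isProb
  have hEm : Measurable fun N : Measure X => N E := Measure.measurable_coe hE
  have hn : Measurable fun N : Measure X => negexp (1 * N E) :=
    measurable_negexp.comp (hEm.const_mul 1)
  have h1 := h.laplace_set hE 1
  rw [hν, mul_zero, negexp_zero] at h1
  have h2 : ∫⁻ N, (1 - negexp (1 * N E)) ∂Q = 0 := by
    rw [lintegral_sub hn (by rw [h1]; exact ENNReal.one_ne_top)
      (ae_of_all _ fun N => negexp_le_one _), h1, lintegral_one, measure_univ, tsub_self]
  have hn' : Measurable fun N : Measure X => 1 - negexp (1 * N E) := measurable_const.sub hn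
  rw [lintegral_eq_zero_iff hn'] at h2
  filter_upwards [h2] with N hN
  have : negexp (1 * N E) = 1 := le_antisymm (negexp_le_one _) (tsub_eq_zero_iff_le.1 hN)
  simpa using negexp_eq_one_iff.1 this

/-- Independence is a comparison of the joint Laplace transform with the product one. It needs no
finiteness: on disjoint sets at most one indicator is nonzero at each point, so `1 - negexp` of
their sum is additive. -/
theorem isPRMLaw (h : HasPoissonLaplace ν Q) : IsPRMLaw ν Q := by
  have := h.isProb
  refine ⟨h.isProb, fun E hE hν => h.poisson hE hν, fun n E hE hdisj => ?_⟩
  have hEm : ∀ i, Measurable fun N : Measure X => N (E i) := fun i => Measure.measurable_coe (hE i)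
  have hEm' : Measurable fun (N : Measure X) (i : Fin n) => N (E i) := measurable_pi_lambda _ hEm
  have : ∀ i, IsProbabilityMeasure (Q.map fun N : Measure X => N (E i)) :=
    fun i => Measure.isProbabilityMeasure_map (hEm i).aemeasurable
  rw [iIndepFun_iff_map_fun_eq_infinitePi_map hEm, Measure.infinitePi_eq_pi]
  have := Measure.isProbabilityMeasure_map (μ := Q) hEm'.aemeasurable
  refine Measure.ext_of_laplace fun c => ?_
  have hR : ∫⁻ x, negexp (∑ i, (c i : ℝ≥0∞) * x i)
      ∂(Measure.pi fun i => Q.map fun N : Measure X => N (E i))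
      = ∏ i, negexp ((1 - negexp (c i)) * ν (E i)) := by
    simp_rw [negexp_sum]
    rw [← Measure.infinitePi_eq_pi, lintegral_prod_infinitePi _ _
      (fun i x => negexp (c i * x)) fun i => by fun_prop]
    refine Finset.prod_congr rfl fun i _ => ?_
    rw [lintegral_map (by fun_prop) (hEm i), h.laplace_set (hE i)]
  have hf : Measurable fun x => ∑ i, (E i).indicator (fun _ => (c i : ℝ≥0∞)) x :=
    Finset.measurable_sum _ fun i _ => measurable_const.indicator (hE i)
  have hL := h.laplace _ hf
  have e1 : ∀ N : Measure X, ∫⁻ x, ∑ i, (E i).indicator (fun _ => (c i : ℝ≥0∞)) x ∂N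
      = ∑ i, (c i : ℝ≥0∞) * N (E i) := fun N => by
    rw [lintegral_finsetSum _ fun i _ => measurable_const.indicator (hE i)]
    simp_rw [lintegral_indicator_const (hE _)]
  have e2 : ∫⁻ x, (1 - negexp (∑ i, (E i).indicator (fun _ => (c i : ℝ≥0∞)) x)) ∂ν
      = ∑ i, (1 - negexp (c i)) * ν (E i) := by
    simp_rw [← lintegral_indicator_const (hE _)]
    rw [← lintegral_finsetSum _ fun i _ => measurable_const.indicator (hE i)]
    refine lintegral_congr fun x => ?_
    by_cases hx : ∃ j, x ∈ E j
    · obtain ⟨j, hj⟩ := hx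
      have hne : ∀ i, i ≠ j → x ∉ E i := fun i hi hxi => (hdisj hi).le_bot ⟨hxi, hj⟩
      rw [Finset.sum_eq_single j (fun i _ hi => by simp [hne i hi]) (by simp),
        Finset.sum_eq_single j (fun i _ hi => by simp [hne i hi]) (by simp)]
      simp [hj]
    · push Not at hx
      simp [hx]
  rw [lintegral_map (by fun_prop) hEm', hR, ← negexp_sum, ← e2, ← hL]
  simp_rw [e1]

end HasPoissonLaplace

end PoissonLaplace

/-! ### Point measures of flagged sequences. -/

section Sequences

variable {X Y V : Type*} [MeasurableSpace X] [MeasurableSpace Y] [MeasurableSpace V]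

theorem Measurable.negexp_lintegral {g : X → Measure Y} (hg : Measurable g) {f : Y → ℝ≥0∞}
    (hf : Measurable f) : Measurable fun x => negexp (∫⁻ y, f y ∂(g x)) :=
  (measurable_negexp_lintegral hf).comp hg

/-- The point measure of the entries of a sequence that are flagged as present. -/
def seqMeasure (x : ℕ → Bool × Y) : Measure Y :=
  Measure.sum fun k => if (x k).1 then Measure.dirac (x k).2 else 0

theorem lintegral_seqMeasure (x : ℕ → Bool × Y) {f : Y → ℝ≥0∞} (hf : Measurable f) :
    ∫⁻ y, f y ∂(seqMeasure x) = ∑' k, if (x k).1 then f (x k).2 else 0 := by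
  rw [seqMeasure, lintegral_sum_measure]
  refine tsum_congr fun k => ?_
  split_ifs
  · exact lintegral_dirac' _ hf
  · simp

theorem seqMeasure_apply (x : ℕ → Bool × Y) {s : Set Y} (hs : MeasurableSet s) :
    seqMeasure x s = ∑' k, if (x k).1 then s.indicator 1 (x k).2 else 0 := by
  rw [← lintegral_indicator_one hs, lintegral_seqMeasure x (measurable_one.indicator hs)]

theorem measurable_flagged {f : Y → ℝ≥0∞} (hf : Measurable f) :
    Measurable fun p : Bool × Y => if p.1 then f p.2 else 0 :=
  Measurable.ite (measurable_fst (measurableSet_singleton true)) (hf.comp measurable_snd)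
    measurable_const

@[fun_prop]
theorem measurable_seqMeasure : Measurable (seqMeasure : (ℕ → Bool × Y) → Measure Y) :=
  Measure.measurable_of_measurable_coe _ fun s hs => by
    simp_rw [seqMeasure_apply _ hs]
    exact Measurable.tsum fun k =>
      (measurable_flagged (measurable_one.indicator hs)).comp (measurable_pi_apply k)

theorem map_seqMeasure (x : ℕ → Bool × Y) {g : Y → X} (hg : Measurable g) :
    (seqMeasure x).map g = seqMeasure fun k => ((x k).1, g (x k).2) := by
  ext s hs
  rw [Measure.map_apply hg hs, seqMeasure_apply _ (hg hs), seqMeasure_apply _ hs]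
  rfl

/-! ### The marking theorem. -/

section Marking

variable {𝒰 : Type*} [MeasurableSpace 𝒰]

/-- The sequence of points `(yₖ, φ (yₖ, uₖ))`. -/
def markedSeq (φ : Y → 𝒰 → V) (x : ℕ → Bool × Y) (u : ℕ → 𝒰) : ℕ → Bool × (Y × V) :=
  fun k => ((x k).1, ((x k).2, φ (x k).2 (u k)))

theorem measurable_markedSeq {φ : Y → 𝒰 → V} (hφ : Measurable (Function.uncurry φ)) :
    Measurable fun p : (ℕ → Bool × Y) × (ℕ → 𝒰) => markedSeq φ p.1 p.2 := by
  refine measurable_pi_lambda _ fun k => ?_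
  unfold markedSeq
  have h1 : Measurable fun p : (ℕ → Bool × Y) × (ℕ → 𝒰) => (p.1 k).2 := by fun_prop
  have h2 : Measurable fun p : (ℕ → Bool × Y) × (ℕ → 𝒰) => ((p.1 k).2, p.2 k) := by fun_prop
  exact Measurable.prodMk (by fun_prop) (h1.prodMk (hφ.comp h2))

/-- The marking theorem for Poisson random measures. -/
theorem HasPoissonLaplace.marking {ν : Measure Y} [SFinite ν] {μ : Measure (ℕ → Bool × Y)}
    [SFinite μ] (hμ : HasPoissonLaplace ν (μ.map seqMeasure)) (H : Kernel Y V) [IsMarkovKernel H]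
    (τ : Measure 𝒰) [IsProbabilityMeasure τ] (φ : Y → 𝒰 → V)
    (hφ : Measurable (Function.uncurry φ)) (hH : ∀ y, τ.map (φ y) = H y) :
    HasPoissonLaplace (ν ⊗ₘ H)
      ((μ.prod (Measure.infinitePi fun _ => τ)).map fun p => seqMeasure (markedSeq φ p.1 p.2)) := by
  have hm : Measurable fun p : (ℕ → Bool × Y) × (ℕ → 𝒰) => seqMeasure (markedSeq φ p.1 p.2) :=
    measurable_seqMeasure.comp (measurable_markedSeq hφ)
  have hprob : IsProbabilityMeasure μ := by
    have := hμ.isProb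
    refine ⟨?_⟩
    rw [← measure_univ (μ := μ.map seqMeasure), Measure.map_apply (by fun_prop) .univ,
      Set.preimage_univ]
  refine ⟨Measure.isProbabilityMeasure_map hm.aemeasurable, fun f hf => ?_⟩
  have hle : ∀ y, ∫⁻ v, negexp (f (y, v)) ∂(H y) ≤ 1 := fun y =>
    (lintegral_mono fun v => negexp_le_one _).trans (by simp)
  have hnf : Measurable fun p => negexp (f p) := measurable_negexp.comp hf
  have hmeas : Measurable fun y => ∫⁻ v, negexp (f (y, v)) ∂(H y) :=
    Measurable.lintegral_kernel_prod_right' hnf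
  rw [lintegral_map (by fun_prop) hm,
    lintegral_prod _ (hm.negexp_lintegral hf).aemeasurable]
  -- For a fixed sequence the marks are independent, so averaging over them replaces `f` by `-log ∫
  -- exp (-f (y, v)) H(y, dv)`, a function of the unmarked points alone.
  have inner : ∀ x : ℕ → Bool × Y,
      ∫⁻ u, negexp (∫⁻ z, f z ∂(seqMeasure (markedSeq φ x u))) ∂(Measure.infinitePi fun _ => τ)
      = negexp (∫⁻ y, neglog (∫⁻ v, negexp (f (y, v)) ∂(H y)) ∂(seqMeasure x)) := by
    intro x
    rw [lintegral_seqMeasure x (by fun_prop)]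
    have e : ∀ u, ∫⁻ z, f z ∂(seqMeasure (markedSeq φ x u))
        = ∑' k, if (x k).1 then f ((x k).2, φ (x k).2 (u k)) else 0 :=
      fun u => lintegral_seqMeasure _ hf
    simp_rw [e]
    have hfk : ∀ k, Measurable fun u => f ((x k).2, φ (x k).2 u) := fun k =>
      hf.comp (measurable_const.prodMk (hφ.comp (measurable_const.prodMk measurable_id)))
    rw [lintegral_negexp_tsum_infinitePi (fun _ => τ)
      (fun k u => if (x k).1 then f ((x k).2, φ (x k).2 u) else 0)
      fun k => by split_ifs <;> [exact hfk k; exact measurable_const]]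
    congr 1
    refine tsum_congr fun k => ?_
    split_ifs
    · have hφk : Measurable (φ (x k).2) := hφ.comp (measurable_const.prodMk measurable_id)
      rw [← hH, lintegral_map (by fun_prop) hφk]
    · simp
  simp_rw [inner]
  rw [← lintegral_map (f := fun N : Measure Y =>
      negexp (∫⁻ y, neglog (∫⁻ v, negexp (f (y, v)) ∂(H y)) ∂N)) (by fun_prop)
      measurable_seqMeasure, hμ.laplace _ (by fun_prop), Measure.lintegral_compProd (by fun_prop)]
  congr 1
  refine lintegral_congr fun y => ?_
  rw [negexp_neglog (hle y), lintegral_sub (by fun_prop) (ne_top_of_le_ne_top (by simp) (hle y))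
    (ae_of_all _ fun v => negexp_le_one _)]
  simp

/-- If, given `c`, the marks `A i k` are independent with laws `H (c k)`, then `(c, A)` has the
same law as the sequence `c` marked by means of independent randomizations. -/
theorem map_marks_eq {Ξ ι E : Type*} [MeasurableSpace Ξ] [MeasurableSpace E] {P : Measure Ξ}
    [IsProbabilityMeasure P] {c : Ξ → ℕ → Bool × Y} (hc : Measurable c)
    {A : ι → Ξ → ℕ → E} (hA : ∀ i, Measurable (A i)) (H : Kernel Y E)
    (hmarks : ∀ D : Set (ℕ → Bool × Y), MeasurableSet D → ∀ (F : Finset (ι × ℕ))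
      (B : ι × ℕ → Set E), (∀ p, MeasurableSet (B p)) →
      P {ξ | c ξ ∈ D ∧ ∀ p ∈ F, A p.1 ξ p.2 ∈ B p}
        = ∫⁻ ξ in c ⁻¹' D, ∏ p ∈ F, H (c ξ p.2).2 (B p) ∂P)
    (τ : Measure 𝒰) [IsProbabilityMeasure τ] (φ : Y → 𝒰 → E)
    (hφ : Measurable (Function.uncurry φ)) (hH : ∀ y, τ.map (φ y) = H y) :
    P.map (fun ξ => (c ξ, fun k i => A i ξ k))
      = ((P.map c).prod (Measure.infinitePi fun _ : ℕ => Measure.infinitePi fun _ : ι => τ)).map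
        fun p => (p.1, fun k i => φ (p.1 k).2 (p.2 k i)) := by
  have hPc : IsProbabilityMeasure (P.map c) := Measure.isProbabilityMeasure_map hc.aemeasurable
  have hAm : Measurable fun ξ (p : ℕ × ι) => A p.2 ξ p.1 :=
    measurable_pi_lambda _ fun p => (measurable_pi_apply p.1).comp (hA p.2)
  have hφm : ∀ y, Measurable (φ y) := fun y => hφ.comp (measurable_const.prodMk measurable_id)
  let T : (ℕ → Bool × Y) × (ℕ × ι → 𝒰) → (ℕ × ι → E) := fun p k => φ (p.1 k.1).2 (p.2 k)
  have hT : Measurable T := measurable_pi_lambda _ fun k => by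
    have : Measurable fun p : (ℕ → Bool × Y) × (ℕ × ι → 𝒰) => ((p.1 k.1).2, p.2 k) := by fun_prop
    exact hφ.comp this
  let U : Measure (ℕ × ι → 𝒰) := Measure.infinitePi fun _ => τ
  have key : P.map (fun ξ => (c ξ, fun p : ℕ × ι => A p.2 ξ p.1))
      = ((P.map c).prod U).map fun p => (p.1, T p) := by
    have h1 : Measurable fun ξ => (c ξ, fun p : ℕ × ι => A p.2 ξ p.1) := hc.prodMk hAm
    have h2 : Measurable fun p : (ℕ → Bool × Y) × (ℕ × ι → 𝒰) => (p.1, T p) :=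
      measurable_fst.prodMk hT
    have := Measure.isProbabilityMeasure_map (μ := P) h1.aemeasurable
    refine Measure.ext_prod fun {D t} hD ht => ?_
    have cyl : ∀ (s : Finset (ℕ × ι)) (B : ℕ × ι → Set E), (∀ p, MeasurableSet (B p)) →
        ((P.restrict (c ⁻¹' D)).map fun ξ (p : ℕ × ι) => A p.2 ξ p.1) ((s : Set (ℕ × ι)).pi B)
        = ((((P.map c).restrict D).prod U).map T) ((s : Set (ℕ × ι)).pi B) := by
      intro s B hB
      have hs : MeasurableSet ((s : Set (ℕ × ι)).pi B) :=
        .pi s.countable_toSet fun p _ => hB p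
      rw [Measure.map_apply hAm hs, Measure.map_apply hT hs, Measure.prod_apply (hT hs),
        Measure.restrict_apply (hAm hs)]
      have e := hmarks D hD (s.map (Equiv.prodComm ℕ ι).toEmbedding) (fun p => B p.swap)
        fun p => hB _
      simp only [Finset.prod_map] at e
      rw [setLIntegral_map hD _ hc]
      · calc
          _ = P {ξ | c ξ ∈ D ∧ ∀ p ∈ s.map (Equiv.prodComm ℕ ι).toEmbedding,
              A p.1 ξ p.2 ∈ B p.swap} := by
            congr 1
            ext ξ
            simp only [Set.mem_inter_iff, Set.mem_preimage, Set.mem_pi, Finset.mem_coe,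
              Set.mem_ofPred_eq, Finset.forall_mem_map]
            exact and_comm
          _ = _ := by
            rw [e]
            refine lintegral_congr fun ξ => ?_
            have : (Prod.mk (c ξ) ⁻¹' (T ⁻¹' ((s : Set (ℕ × ι)).pi B)))
                = (s : Set (ℕ × ι)).pi fun k => φ (c ξ k.1).2 ⁻¹' (B k) := by
              ext u; simp [T]
            rw [this, Measure.infinitePi_pi _ fun k _ => hφm _ (hB k)]
            refine Finset.prod_congr rfl fun k _ => ?_
            rw [← Measure.map_apply (hφm _) (hB k), hH]
            rfl
      · exact measurable_measure_prodMk_left (hT hs)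
    -- With `D` fixed, both sides are finite measures on the marks that agree on the π-system of
    -- cylinders; the empty cylinder gives equal total mass.
    have main : ((P.restrict (c ⁻¹' D)).map fun ξ (p : ℕ × ι) => A p.2 ξ p.1)
        = (((P.map c).restrict D).prod U).map T := by
      refine ext_of_generate_finite _ (generateFrom_squareCylinders (α := fun _ : ℕ × ι => E)).symm
        (isPiSystem_squareCylinders (fun _ => MeasurableSpace.isPiSystem_measurableSet)
          (by simp)) ?_ ?_
      · rintro _ ⟨s, B, hB, rfl⟩
        exact cyl s B fun p => hB p (Set.mem_univ p)
      · simpa using cyl ∅ (fun _ => Set.univ) (by simp)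
    have h3 := congrArg (fun m : Measure (ℕ × ι → E) => m t) main
    simp only [Measure.map_apply hAm ht, Measure.map_apply hT ht] at h3
    rw [Measure.map_apply h1 (hD.prod ht), Measure.map_apply h2 (hD.prod ht)]
    rw [Measure.restrict_apply (hAm ht)] at h3
    have h4 : ((P.map c).restrict D).prod U = ((P.map c).prod U).restrict (D ×ˢ Set.univ) := by
      rw [← Measure.prod_restrict, Measure.restrict_univ]
    rw [h4, Measure.restrict_apply (hT ht)] at h3
    rw [Set.mk_preimage_prod, Set.inter_comm, h3]
    congr 1
    ext p
    simp [and_comm]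
  -- One family of randomizations indexed by pairs is the same as a sequence of independent
  -- families.
  have hcur : (U.map fun u k i => u (k, i))
      = Measure.infinitePi fun _ : ℕ => Measure.infinitePi fun _ : ι => τ :=
    Measure.infinitePi_map_curry fun _ _ => τ
  have hcm : Measurable fun (u : ℕ × ι → 𝒰) (k : ℕ) (i : ι) => u (k, i) := by fun_prop
  have hcE : Measurable fun p : (ℕ → Bool × Y) × (ℕ × ι → E) =>
    (p.1, fun (k : ℕ) (i : ι) => p.2 (k, i)) := by fun_prop
  have := congrArg (Measure.map fun p : (ℕ → Bool × Y) × (ℕ × ι → E) =>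
    (p.1, fun (k : ℕ) (i : ι) => p.2 (k, i))) key
  rw [Measure.map_map hcE (hc.prodMk hAm), Measure.map_map hcE (measurable_fst.prodMk hT)] at this
  refine this.trans ?_
  have hm3 : Measurable fun p : (ℕ → Bool × Y) × (ℕ → ι → 𝒰) =>
      (p.1, fun (k : ℕ) (i : ι) => φ (p.1 k).2 (p.2 k i)) := by
    refine measurable_fst.prodMk (measurable_pi_lambda _ fun k => measurable_pi_lambda _ fun i => ?_)
    have : Measurable fun p : (ℕ → Bool × Y) × (ℕ → ι → 𝒰) => ((p.1 k).2, p.2 k i) := by fun_prop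
    exact hφ.comp this
  have hprod := Measure.map_prod_map (P.map c) U measurable_id hcm
  rw [← hcur, ← Measure.map_id (μ := P.map c), hprod, Measure.map_id,
    Measure.map_map hm3 (measurable_id.prodMap hcm)]
  rfl

end Marking

/-! ### Existence of Poisson random measures. -/

section Construction

/-- The sequence `y`, of which only the first `n` entries are present. -/
def truncSeq (n : ℕ) (y : ℕ → Y) : ℕ → Bool × Y := fun k => (decide (k < n), y k)

@[fun_prop]
theorem measurable_truncSeq : Measurable fun p : ℕ × (ℕ → Y) => truncSeq p.1 p.2 := by
  refine measurable_from_prod_countable_right fun n => measurable_pi_lambda _ fun k => ?_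
  exact (measurable_const (a := decide (k < n))).prodMk (measurable_pi_apply k)

theorem seqMeasure_truncSeq (n : ℕ) (y : ℕ → Y) :
    seqMeasure (truncSeq n y) = ∑ k ∈ Finset.range n, Measure.dirac (y k) := by
  ext s hs
  rw [seqMeasure_apply _ hs, Measure.finsetSum_apply, tsum_eq_sum (s := Finset.range n)]
  · refine Finset.sum_congr rfl fun k hk => ?_
    simp [truncSeq, Finset.mem_range.1 hk, Measure.dirac_apply' _ hs]
  · intro k hk
    simp [truncSeq, Finset.mem_range.not.1 hk]

/-- A Poisson number of independent points with law `m`. -/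
def poissonSample (r : ℝ≥0) (m : Measure Y) : Measure (ℕ × (ℕ → Y)) :=
  (poissonMeasure r).prod (Measure.infinitePi fun _ => m)

instance (r : ℝ≥0) (m : Measure Y) [IsProbabilityMeasure m] :
    IsProbabilityMeasure (poissonSample r m) := by unfold poissonSample; infer_instance

/-- Given that there are `n` points, the functional is the `n`-th power of `∫ exp (-f) dm`;
averaging over `n` is the Poisson generating function. -/
theorem hasPoissonLaplace_poissonSample (r : ℝ≥0) (m : Measure Y) [IsProbabilityMeasure m] :
    HasPoissonLaplace (r • m)
      (((poissonSample r m).map fun p => truncSeq p.1 p.2).map seqMeasure) := by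
  rw [Measure.map_map measurable_seqMeasure measurable_truncSeq]
  have hm : Measurable (seqMeasure ∘ fun p : ℕ × (ℕ → Y) => truncSeq p.1 p.2) :=
    measurable_seqMeasure.comp measurable_truncSeq
  refine ⟨Measure.isProbabilityMeasure_map hm.aemeasurable, fun f hf => ?_⟩
  have hle : ∫⁻ y, negexp (f y) ∂m ≤ 1 := (lintegral_mono fun v => negexp_le_one _).trans (by simp)
  rw [lintegral_map (by fun_prop) hm, poissonSample, lintegral_prod _ (by fun_prop)]
  have inner : ∀ n : ℕ, ∫⁻ y, negexp (∫⁻ z, f z ∂(seqMeasure (truncSeq n y)))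
      ∂(Measure.infinitePi fun _ => m) = (∫⁻ y, negexp (f y) ∂m) ^ n := fun n => by
    simp_rw [seqMeasure_truncSeq, lintegral_finsetSum_measure, lintegral_dirac' _ hf, negexp_sum]
    rw [lintegral_prod_infinitePi (fun _ => m) _ (fun _ y => negexp (f y)) fun _ => by fun_prop]
    simp
  refine (lintegral_congr inner).trans ?_
  rw [lintegral_pow_poissonMeasure r hle]
  have : r • m = (r : ℝ≥0∞) • m := rfl
  rw [this, lintegral_smul_measure, lintegral_sub (by fun_prop) (ne_top_of_le_ne_top (by simp) hle)
    (ae_of_all _ fun v => negexp_le_one _)]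
  simp

theorem exists_eq_smul_isProbabilityMeasure [Nonempty Y] (m : Measure Y) [IsFiniteMeasure m] :
    ∃ (r : ℝ≥0) (m' : Measure Y), IsProbabilityMeasure m' ∧ m = r • m' := by
  by_cases hm : m = 0
  · exact ⟨0, Measure.dirac (Classical.arbitrary Y), inferInstance, by simp [hm]⟩
  · have : NeZero m := ⟨hm⟩
    refine ⟨(m Set.univ).toNNReal, (m Set.univ)⁻¹ • m, inferInstance, ?_⟩
    have h : ∀ μ : Measure Y, (m Set.univ).toNNReal • μ = (m Set.univ) • μ := fun μ => by
      conv_rhs => rw [← ENNReal.coe_toNNReal (measure_ne_top m Set.univ)]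
      rfl
    rw [h, smul_smul, ENNReal.mul_inv_cancel (by simpa using hm) (measure_ne_top _ _), one_smul]

/-- Poisson random measures exist, as point measures of random sequences. -/
theorem exists_hasPoissonLaplace_seqMeasure [Nonempty Y] (ν : Measure Y) [SFinite ν] :
    ∃ μ : Measure (ℕ → Bool × Y), IsProbabilityMeasure μ ∧
      HasPoissonLaplace ν (μ.map seqMeasure) := by
  choose r m hm hrm using fun n =>
    exists_eq_smul_isProbabilityMeasure (sfiniteSeq ν n)
  let W : Measure (ℕ → ℕ × (ℕ → Y)) := Measure.infinitePi fun n => poissonSample (r n) (m n)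
  -- An s-finite measure is a countable sum of finite ones; the corresponding independent Poisson
  -- samples are interleaved into one sequence by the pairing of `ℕ × ℕ` with `ℕ`.
  let C : (ℕ → ℕ × (ℕ → Y)) → ℕ → Bool × Y := fun w k =>
    truncSeq (w k.unpair.1).1 (w k.unpair.1).2 k.unpair.2
  have hC : Measurable C := measurable_pi_lambda _ fun k =>
    (measurable_pi_apply k.unpair.2).comp
      (measurable_truncSeq.comp (measurable_pi_apply k.unpair.1))
  have hprob : IsProbabilityMeasure (W.map C) := Measure.isProbabilityMeasure_map hC.aemeasurable
  refine ⟨W.map C, hprob, Measure.isProbabilityMeasure_map (by fun_prop), fun f hf => ?_⟩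
  rw [lintegral_map (by fun_prop) measurable_seqMeasure, lintegral_map
    (measurable_seqMeasure.negexp_lintegral hf) hC]
  have e : ∀ w, ∫⁻ y, f y ∂(seqMeasure (C w))
      = ∑' n, ∫⁻ y, f y ∂(seqMeasure (truncSeq (w n).1 (w n).2)) := fun w => by
    simp_rw [lintegral_seqMeasure _ hf]
    rw [← ENNReal.tsum_prod, ← Nat.pairEquiv.symm.tsum_eq]
    rfl
  simp_rw [e]
  rw [lintegral_negexp_tsum_infinitePi (fun n => poissonSample (r n) (m n))
    (fun n p => ∫⁻ y, f y ∂(seqMeasure (truncSeq p.1 p.2)))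
    fun n => (Measure.measurable_lintegral hf).comp
      (measurable_seqMeasure.comp measurable_truncSeq)]
  have hn : ∀ n, neglog (∫⁻ p, negexp (∫⁻ y, f y ∂(seqMeasure (truncSeq p.1 p.2)))
      ∂(poissonSample (r n) (m n))) = ∫⁻ y, (1 - negexp (f y)) ∂(sfiniteSeq ν n) := fun n => by
    have := (hasPoissonLaplace_poissonSample (r n) (m n)).laplace f hf
    rw [lintegral_map (by fun_prop) measurable_seqMeasure, lintegral_map
      (measurable_seqMeasure.negexp_lintegral hf) measurable_truncSeq] at this
    rw [this, neglog_negexp, hrm n]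
  simp_rw [hn]
  rw [← lintegral_sum_measure, sum_sfiniteSeq]

end Construction

end Sequences

/-! ### Measurability of signed measures built from points. -/

section SignedMeasures

variable {Ω X Y : Type*} [MeasurableSpace Ω] [MeasurableSpace X] [MeasurableSpace Y]

theorem SignedMeasure.measurable_eval {B : Set Ω} (hB : MeasurableSet B) :
    Measurable fun z : SignedMeasure Ω => z B := by
  intro s hs
  refine MeasurableSpace.measurableSet_iSup.2 ?_
  refine MeasurableSpace.measurableSet_generateFrom ⟨B, ?_⟩
  rw [iSup_pos hB]
  exact ⟨s, hs, rfl⟩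

theorem SignedMeasure.measurable_of_eval {f : X → SignedMeasure Ω}
    (hf : ∀ B, MeasurableSet B → Measurable fun x => f x B) : Measurable f := by
  rw [measurable_iff_comap_le]
  simp only [signedMeasureMeasurableSpace, MeasurableSpace.comap_iSup, MeasurableSpace.comap_comp]
  refine iSup₂_le fun B hB => ?_
  exact (measurable_iff_comap_le.1 (hf B hB))

theorem countablySeparated_of_injective [MeasurableSpace.CountablySeparated Y] {f : X → Y}
    (hf : Measurable f) (hinj : Function.Injective f) : MeasurableSpace.CountablySeparated X := by
  obtain ⟨S, hS, hSm, hsep⟩ := (MeasurableSpace.countablySeparated_def (α := Y)).1 inferInstance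
  refine MeasurableSpace.countablySeparated_def.2
    ⟨(fun s => f ⁻¹' s) '' S, hS.image _, ?_, fun x _ y _ h => ?_⟩
  · rintro _ ⟨s, hs, rfl⟩
    exact hf (hSm s hs)
  · exact hinj (hsep _ (Set.mem_univ _) _ (Set.mem_univ _) fun s hs => h _ ⟨s, hs, rfl⟩)

/-- Vectors of signed measures on a countably generated space are separated by countably many
evaluations. -/
theorem countablySeparated_pi_signedMeasure [MeasurableSpace.CountablyGenerated Ω]
    {ι ι' : Type*} [Countable ι] [Countable ι'] :
    MeasurableSpace.CountablySeparated (ι → ι' → SignedMeasure Ω) := by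
  -- A countable algebra generating the σ-algebra: signed measures that agree on it, the whole space
  -- included, coincide.
  let 𝒮 := generateSetAlgebra (MeasurableSpace.countableGeneratingSet Ω)
  have hcount : 𝒮.Countable :=
    countable_generateSetAlgebra (MeasurableSpace.countable_countableGeneratingSet)
  have : Countable 𝒮 := hcount
  have hgen : ‹MeasurableSpace Ω› = MeasurableSpace.generateFrom 𝒮 := by
    rw [generateFrom_generateSetAlgebra_eq, MeasurableSpace.generateFrom_countableGeneratingSet]
  have halg : IsSetAlgebra 𝒮 := isSetAlgebra_generateSetAlgebra
  have hm : ∀ s ∈ 𝒮, MeasurableSet s := fun s hs => by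
    rw [hgen]; exact MeasurableSpace.measurableSet_generateFrom hs
  let F : (ι → ι' → SignedMeasure Ω) → (ι → ι' → 𝒮 → ℝ) := fun z i j s => z i j s
  have hF : Measurable F := by
    refine measurable_pi_lambda _ fun i => measurable_pi_lambda _ fun j =>
      measurable_pi_lambda _ fun s => ?_
    exact (SignedMeasure.measurable_eval (hm s s.2)).comp
      ((measurable_pi_apply j).comp (measurable_pi_apply i))
  refine countablySeparated_of_injective hF fun z z' h => ?_
  ext1 i; ext1 j
  refine VectorMeasure.ext_of_generateFrom 𝒮 (fun s hs => ?_) hgen ?_ ?_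
  · exact congrFun (congrFun (congrFun h i) j) ⟨s, hs⟩
  · exact fun s hs t ht _ => halg.inter_mem hs ht
  · exact congrFun (congrFun (congrFun h i) j) ⟨Set.univ, halg.univ_mem⟩

theorem signedMeasure_finsetSum_apply {ι : Type*} (s : Finset ι) (z : ι → SignedMeasure Ω)
    (B : Set Ω) : (∑ i ∈ s, z i) B = ∑ i ∈ s, z i B := by
  classical
  induction s using Finset.induction_on with
  | empty => simp
  | insert i s hi ih => rw [Finset.sum_insert hi, Finset.sum_insert hi, _root_.add_apply, ih]

/-- The signed measure `∫ a(y) δ_g(y) N(dy)`. -/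
def signedOf (g : Y → Ω) (a : Y → ℝ) (N : Measure Y) : SignedMeasure Ω := (N.withDensityᵥ a).map g

theorem signedOf_apply {g : Y → Ω} (hg : Measurable g) {a : Y → ℝ} {N : Measure Y}
    (ha : Integrable a N) {B : Set Ω} (hB : MeasurableSet B) :
    signedOf g a N B = ∫ y in g ⁻¹' B, a y ∂N := by
  rw [signedOf, VectorMeasure.map_apply _ hg hB, withDensityᵥ_apply ha (hg hB)]

theorem signedOf_of_not_integrable {g : Y → Ω} {a : Y → ℝ} {N : Measure Y}
    (ha : ¬ Integrable a N) : signedOf g a N = 0 := by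
  rw [signedOf, Measure.withDensityᵥ, dif_neg ha, VectorMeasure.map_zero]

theorem measurableSet_setOf_integrable {a : Y → ℝ} (ha : Measurable a) :
    MeasurableSet {N : Measure Y | Integrable a N} := by
  have : {N : Measure Y | Integrable a N} = {N | ∫⁻ y, ‖a y‖ₑ ∂N < ∞} := by
    ext N
    exact ⟨fun h => h.2, fun h => ⟨ha.aestronglyMeasurable, h⟩⟩
  rw [this]
  exact measurableSet_lt (Measure.measurable_lintegral ha.enorm) measurable_const

/-- Integrability is a measurable event in `N`. On it, evaluations are differences of two integrals
of nonnegative functions; off it, `signedOf` has the default value `0`. -/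
theorem measurable_signedOf {g : Y → Ω} (hg : Measurable g) {a : Y → ℝ} (ha : Measurable a) :
    Measurable (signedOf g a) := by
  classical
  refine SignedMeasure.measurable_of_eval fun B hB => ?_
  have e : (fun N => signedOf g a N B) = fun N => if N ∈ {N : Measure Y | Integrable a N} then
      (∫⁻ y, (g ⁻¹' B).indicator (fun y => ENNReal.ofReal (a y)) y ∂N).toReal
        - (∫⁻ y, (g ⁻¹' B).indicator (fun y => ENNReal.ofReal (-a y)) y ∂N).toReal else 0 := by
    ext N
    split_ifs with h
    · have h' : Integrable a N := h
      rw [signedOf_apply hg h hB,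
        integral_eq_lintegral_pos_part_sub_lintegral_neg_part h'.integrableOn,
        lintegral_indicator (hg hB), lintegral_indicator (hg hB)]
    · have h' : ¬ Integrable a N := h
      rw [signedOf_of_not_integrable h']; rfl
  rw [e]
  refine Measurable.ite (measurableSet_setOf_integrable ha) ?_ measurable_const
  exact (Measure.measurable_lintegral (ha.ennreal_ofReal.indicator (hg hB))).ennreal_toReal.sub
    (Measure.measurable_lintegral (ha.neg.ennreal_ofReal.indicator (hg hB))).ennreal_toReal

theorem signedOf_add {g : Y → Ω} (hg : Measurable g) {a : Y → ℝ} {N N' : Measure Y}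
    (h : Integrable a N) (h' : Integrable a N') :
    signedOf g a (N + N') = signedOf g a N + signedOf g a N' := by
  ext B hB
  rw [_root_.add_apply, signedOf_apply hg (h.add_measure h') hB, signedOf_apply hg h hB,
    signedOf_apply hg h' hB, Measure.restrict_add, integral_add_measure h.integrableOn
    h'.integrableOn]

theorem integrable_dirac_of_measurable {a : Y → ℝ} (ha : Measurable a) (y : Y) :
    Integrable a (Measure.dirac y) :=
  ⟨ha.aestronglyMeasurable, by
    rw [hasFiniteIntegral_iff_enorm, lintegral_dirac' _ ha.enorm]; exact enorm_lt_top⟩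

theorem setIntegral_dirac_of_measurable {a : Y → ℝ} (ha : Measurable a) (y : Y) {s : Set Y}
    (hs : MeasurableSet s) :
    ∫ x in s, a x ∂(Measure.dirac y) = a y * (Measure.dirac y).real s := by
  classical
  rw [← integral_indicator hs, integral_dirac' _ _ (ha.indicator hs).stronglyMeasurable,
    measureReal_def, Measure.dirac_apply' _ hs]
  by_cases h : y ∈ s <;> simp [h]

theorem dirac_real_preimage {g : Y → Ω} (hg : Measurable g) (y : Y) {B : Set Ω}
    (hB : MeasurableSet B) :
    (Measure.dirac y).real (g ⁻¹' B) = (Measure.dirac (g y)).real B := by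
  rw [measureReal_def, measureReal_def, Measure.dirac_apply' _ hB, Measure.dirac_apply' _ (hg hB)]
  rfl

theorem signedOf_dirac {g : Y → Ω} (hg : Measurable g) {a : Y → ℝ} (ha : Measurable a) (y : Y) :
    signedOf g a (Measure.dirac y) = a y • (Measure.dirac (g y)).toSignedMeasure := by
  ext B hB
  rw [signedOf_apply hg (integrable_dirac_of_measurable ha y) hB,
    setIntegral_dirac_of_measurable ha y (hg hB), dirac_real_preimage hg y hB,
    _root_.smul_apply, Measure.toSignedMeasure_apply_measurable hB, smul_eq_mul]

theorem integrable_finsetSum_dirac {ι : Type*} {a : Y → ℝ} (ha : Measurable a) (s : Finset ι)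
    (y : ι → Y) : Integrable a (∑ i ∈ s, Measure.dirac (y i)) :=
  integrable_finsetSum_measure.2 fun i _ => integrable_dirac_of_measurable ha (y i)

theorem signedOf_zero (g : Y → Ω) (a : Y → ℝ) : signedOf g a (0 : Measure Y) = 0 := by
  ext B hB
  by_cases hg : Measurable g
  · rw [signedOf_apply hg integrable_zero_measure hB]; simp
  · simp [signedOf, VectorMeasure.map, hg]

theorem signedOf_finsetSum_dirac {ι : Type*} {g : Y → Ω} (hg : Measurable g) {a : Y → ℝ}
    (ha : Measurable a) (s : Finset ι) (y : ι → Y) :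
    signedOf g a (∑ i ∈ s, Measure.dirac (y i))
      = ∑ i ∈ s, a (y i) • (Measure.dirac (g (y i))).toSignedMeasure := by
  classical
  induction s using Finset.induction_on with
  | empty => simpa using signedOf_zero g a
  | insert i s hi ih =>
    rw [Finset.sum_insert hi, Finset.sum_insert hi, signedOf_add hg
      (integrable_dirac_of_measurable ha _) (integrable_finsetSum_dirac ha s y), ih,
      signedOf_dirac hg ha]

/-- The signed measure `∑ a(yₖ) δ_g(yₖ)`, summed over the flagged entries of a sequence. -/
def signedSeq (g : Y → Ω) (a : Y → ℝ) (x : ℕ → Bool × Y) : SignedMeasure Ω :=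
  ∑ᶠ k, (if (x k).1 then a (x k).2 else 0) • (Measure.dirac (g (x k).2)).toSignedMeasure

omit [MeasurableSpace Y] in
theorem signedSeq_eq_sum {g : Y → Ω} {a : Y → ℝ} {x : ℕ → Bool × Y} {s : Finset ℕ}
    (hs : ∀ k, (x k).1 = true → a (x k).2 ≠ 0 → k ∈ s) (hs' : ∀ k ∈ s, (x k).1 = true) :
    signedSeq g a x = ∑ k ∈ s, a (x k).2 • (Measure.dirac (g (x k).2)).toSignedMeasure := by
  rw [signedSeq, finsum_eq_sum_of_support_subset (s := s)]
  · exact Finset.sum_congr rfl fun k hk => by rw [if_pos (hs' k hk)]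
  · intro k hk
    by_contra h
    refine hk ?_
    by_cases hf : (x k).1 = true
    · have : a (x k).2 = 0 := by
        by_contra h0
        exact h (hs k hf h0)
      simp [this]
    · simp [hf]

theorem integrable_seqMeasure {a : Y → ℝ} (ha : Measurable a) {x : ℕ → Bool × Y}
    (hx : {k | (x k).1 = true ∧ a (x k).2 ≠ 0}.Finite) : Integrable a (seqMeasure x) := by
  refine ⟨ha.aestronglyMeasurable, ?_⟩
  rw [hasFiniteIntegral_iff_enorm, lintegral_seqMeasure x ha.enorm, tsum_eq_sum (s := hx.toFinset)]
  · refine ENNReal.sum_lt_top.2 fun k _ => ?_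
    split_ifs <;> simp
  · intro k hk
    simp only [Set.Finite.mem_toFinset, Set.mem_ofPred_eq, not_and, not_not] at hk
    split_ifs with h
    · simp [hk h]
    · rfl

/-- When only finitely many terms are active, the process depends on the sequence through its point
measure alone, hence its law through the Laplace functional. -/
theorem signedOf_seqMeasure {g : Y → Ω} (hg : Measurable g) {a : Y → ℝ} (ha : Measurable a)
    {x : ℕ → Bool × Y} (hx : {k | (x k).1 = true ∧ a (x k).2 ≠ 0}.Finite) :
    signedOf g a (seqMeasure x) = signedSeq g a x := by
  have hint := integrable_seqMeasure ha hx
  rw [signedSeq_eq_sum (s := hx.toFinset) (fun k h h' => by simp [h, h'])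
    (fun k hk => (by simpa using hk : (x k).1 = true ∧ a (x k).2 ≠ 0).1)]
  ext B hB
  rw [signedOf_apply hg hint hB, ← integral_indicator (hg hB), seqMeasure,
    integral_sum_measure (hint.indicator (hg hB)), tsum_eq_sum (s := hx.toFinset)]
  · rw [signedMeasure_finsetSum_apply]
    refine Finset.sum_congr rfl fun k hk => ?_
    have hk : (x k).1 = true ∧ a (x k).2 ≠ 0 := by simpa using hk
    rw [if_pos hk.1, integral_indicator (hg hB), setIntegral_dirac_of_measurable ha _ (hg hB),
      dirac_real_preimage hg _ hB, _root_.smul_apply,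
      Measure.toSignedMeasure_apply_measurable hB, smul_eq_mul]
  · intro k hk
    simp only [Set.Finite.mem_toFinset, Set.mem_ofPred_eq, not_and, not_not] at hk
    split_ifs with h
    · rw [integral_indicator (hg hB), setIntegral_dirac_of_measurable ha _ (hg hB), hk h, zero_mul]
    · simp

omit [MeasurableSpace Y] in
theorem signedSeq_of_infinite {g : Y → Ω} {a : Y → ℝ} {x : ℕ → Bool × Y}
    (hx : ¬ {k | (x k).1 = true ∧ a (x k).2 ≠ 0}.Finite) : signedSeq g a x = 0 := by
  -- `finsum` is `0` on infinite support. A term with nonzero coefficient is a nonzero signed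
  -- measure, as its total mass shows.
  refine finsum_of_infinite_support fun h => hx (h.subset fun k hk => ?_)
  simp only [Function.mem_support, if_pos hk.1]
  intro h0
  have := congrArg (fun z : SignedMeasure Ω => z Set.univ) h0
  simp at this
  exact hk.2 this

/-- Whether finitely many terms are active is a measurable event, finiteness meaning boundedness of
the indices. Off this event the `finsum` is constantly `0`. -/
theorem measurable_signedSeq {g : Y → Ω} (hg : Measurable g) {a : Y → ℝ} (ha : Measurable a) :
    Measurable (signedSeq g a) := by
  classical
  have hset : MeasurableSet {x : ℕ → Bool × Y | {k | (x k).1 = true ∧ a (x k).2 ≠ 0}.Finite} := by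
    have : {x : ℕ → Bool × Y | {k | (x k).1 = true ∧ a (x k).2 ≠ 0}.Finite}
        = ⋃ n : ℕ, ⋂ k : ℕ, {x | k ≤ n ∨ ¬ ((x k).1 = true ∧ a (x k).2 ≠ 0)} := by
      ext x
      simp only [Set.mem_ofPred_eq, Set.mem_iUnion, Set.mem_iInter]
      constructor
      · intro h
        obtain ⟨n, hn⟩ := h.bddAbove
        exact ⟨n, fun k => or_iff_not_imp_right.2 fun hk => hn (not_not.1 hk)⟩
      · rintro ⟨n, hn⟩
        exact (Set.finite_Iic n).subset fun k hk => (hn k).resolve_right (not_not.2 hk)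
    rw [this]
    refine .iUnion fun n => .iInter fun k => ?_
    refine MeasurableSet.union (.const _) (MeasurableSet.compl ?_)
    have h1 : Measurable fun x : ℕ → Bool × Y => (x k).1 := by fun_prop
    have h2 : Measurable fun x : ℕ → Bool × Y => a (x k).2 := by fun_prop
    exact (h1 (measurableSet_singleton true)).inter (h2 (measurableSet_singleton 0)).compl
  have e : signedSeq g a = fun x => if x ∈ {x : ℕ → Bool × Y |
      {k | (x k).1 = true ∧ a (x k).2 ≠ 0}.Finite} then signedOf g a (seqMeasure x) else 0 := by
    ext1 x
    split_ifs with h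
    · exact (signedOf_seqMeasure hg ha h).symm
    · exact signedSeq_of_infinite h
  rw [e]
  exact Measurable.ite hset ((measurable_signedOf hg ha).comp measurable_seqMeasure)
    measurable_const

theorem finite_of_seqMeasure_lt_top {x : ℕ → Bool × Y} {E : Set Y} (hE : MeasurableSet E)
    (h : seqMeasure x E < ∞) : {k | (x k).1 = true ∧ (x k).2 ∈ E}.Finite := by
  rw [seqMeasure_apply x hE] at h
  refine (ENNReal.finite_const_le_of_tsum_ne_top h.ne one_ne_zero).subset fun k hk => ?_
  simp [hk.1, hk.2]

end SignedMeasures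

/-! ### Recovering the points from the processes. -/

section Atoms

variable {Ω : Type*} [MeasurableSpace Ω] {M υ : ℕ}

/-- The processes `∑ₖ aₖ δ_ωₖ` given by finitely many points `(ωₖ, aₖ)`. -/
def finiteProcess (p : ℕ × (ℕ → Ω × (Fin M → Fin υ → ℝ))) : Fin M → Fin υ → SignedMeasure Ω :=
  fun i j => ∑ k ∈ Finset.range p.1,
    (p.2 k).2 i j • (Measure.dirac (p.2 k).1).toSignedMeasure

/-- Finitely many points `(ωₖ, aₖ)` with distinct locations `ωₖ` and values `aₖ ≠ 0`. -/
def IsProper (p : ℕ × (ℕ → Ω × (Fin M → Fin υ → ℝ))) : Prop :=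
  (∀ k < p.1, ∀ l < p.1, k ≠ l → (p.2 k).1 ≠ (p.2 l).1) ∧ ∀ k < p.1, (p.2 k).2 ≠ 0

theorem measurable_finiteProcess :
    Measurable (finiteProcess : ℕ × (ℕ → Ω × (Fin M → Fin υ → ℝ)) → _) := by
  refine measurable_from_prod_countable_right fun n => ?_
  refine measurable_pi_lambda _ fun i => measurable_pi_lambda _ fun j => ?_
  refine SignedMeasure.measurable_of_eval fun B hB => ?_
  have : (fun y : ℕ → Ω × (Fin M → Fin υ → ℝ) => finiteProcess (n, y) i j B) = fun y =>
      ∑ k ∈ Finset.range n, (y k).2 i j * B.indicator 1 (y k).1 := by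
    ext y
    rw [finiteProcess, signedMeasure_finsetSum_apply]
    refine Finset.sum_congr rfl fun k _ => ?_
    rw [_root_.smul_apply, Measure.toSignedMeasure_apply_measurable hB, measureReal_def,
      Measure.dirac_apply' _ hB, smul_eq_mul]
    by_cases h : (y k).1 ∈ B <;> simp [h]
  rw [this]
  refine Finset.measurable_sum _ fun k _ => ?_
  have h1 : Measurable fun y : ℕ → Ω × (Fin M → Fin υ → ℝ) => (y k).2 i j := by fun_prop
  have h2 : Measurable fun y : ℕ → Ω × (Fin M → Fin υ → ℝ) => (y k).1 := by fun_prop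
  exact h1.mul ((measurable_one.indicator hB).comp h2)

theorem measurableSet_isProper [StandardBorelSpace Ω] :
    MeasurableSet {p : ℕ × (ℕ → Ω × (Fin M → Fin υ → ℝ)) | IsProper p} := by
  have : {p : ℕ × (ℕ → Ω × (Fin M → Fin υ → ℝ)) | IsProper p}
      = (⋂ k : ℕ, ⋂ l : ℕ, ({p | k < p.1}ᶜ ∪ ({p | l < p.1}ᶜ ∪ ({p | k ≠ l}ᶜ
        ∪ {p | (p.2 k).1 = (p.2 l).1}ᶜ)))) ∩ ⋂ k : ℕ, ({p | k < p.1}ᶜ ∪ {p | (p.2 k).2 = 0}ᶜ) := by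
    ext p
    simp only [IsProper, Set.mem_ofPred_eq, Set.mem_inter_iff, Set.mem_iInter, Set.mem_union,
      Set.mem_compl_iff, ← imp_iff_not_or]
    refine and_congr_left fun _ => forall_congr' fun k => ?_
    exact ⟨fun h l hk hl hkl => h hk l hl hkl, fun h hk l hl hkl => h l hk hl hkl⟩
  rw [this]
  have h1 : ∀ k : ℕ, MeasurableSet {p : ℕ × (ℕ → Ω × (Fin M → Fin υ → ℝ)) | k < p.1} := fun k =>
    measurable_fst (MeasurableSet.of_discrete (s := {n : ℕ | k < n}))
  refine MeasurableSet.inter (.iInter fun k => .iInter fun l => ?_) (.iInter fun k => ?_)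
  · refine (h1 k).compl.union ((h1 l).compl.union ((MeasurableSet.const _).compl.union
      (MeasurableSet.compl ?_)))
    exact measurableSet_eq_fun (by fun_prop) (by fun_prop)
  · refine (h1 k).compl.union (MeasurableSet.compl ?_)
    exact measurableSet_eq_fun (by fun_prop) (by fun_prop)

variable [MeasurableSingletonClass Ω] {p : ℕ × (ℕ → Ω × (Fin M → Fin υ → ℝ))}

open Classical in
theorem featureValues_finiteProcess (ω : Ω) : featureValues (finiteProcess p) ω
    = ∑ k ∈ Finset.range p.1, if (p.2 k).1 = ω then (p.2 k).2 else 0 := by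
  ext i j
  rw [featureValues, finiteProcess, signedMeasure_finsetSum_apply, Finset.sum_apply,
    Finset.sum_apply]
  refine Finset.sum_congr rfl fun k _ => ?_
  rw [_root_.smul_apply, Measure.toSignedMeasure_apply_measurable
    (measurableSet_singleton ω), measureReal_def, Measure.dirac_apply' _
    (measurableSet_singleton ω)]
  by_cases h : (p.2 k).1 = ω <;> simp [h]

/-- Since the locations are distinct, the mass at one of them comes from a single point: no values
are added up or cancelled. -/
theorem IsProper.featureValues_eq (hp : IsProper p) {k : ℕ} (hk : k < p.1) :
    featureValues (finiteProcess p) (p.2 k).1 = (p.2 k).2 := by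
  rw [featureValues_finiteProcess, Finset.sum_eq_single k]
  · simp
  · intro l hl hlk
    rw [if_neg (hp.1 l (Finset.mem_range.1 hl) k hk hlk)]
  · simp [hk]

theorem IsProper.mem_features_iff (hp : IsProper p) {ω : Ω} :
    ω ∈ features (finiteProcess p) ↔ ∃ k < p.1, (p.2 k).1 = ω := by
  classical
  have key : {ω : Ω | ∃ i j, finiteProcess p i j {ω} ≠ 0}
      = ((Finset.range p.1).image fun k => (p.2 k).1 : Finset Ω) := by
    ext ω
    have h1 : (∃ i j, finiteProcess p i j {ω} ≠ 0) ↔ featureValues (finiteProcess p) ω ≠ 0 := by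
      rw [Function.ne_iff]
      refine exists_congr fun i => ?_
      rw [Function.ne_iff]
      rfl
    rw [Set.mem_ofPred_eq, h1]
    simp only [Finset.coe_image, Finset.coe_range, Set.mem_image, Set.mem_Iio]
    constructor
    · intro h
      by_contra h0
      push Not at h0
      refine h ?_
      rw [featureValues_finiteProcess]
      exact Finset.sum_eq_zero fun k hk => if_neg (h0 k (Finset.mem_range.1 hk))
    · rintro ⟨k, hk, rfl⟩
      rw [hp.featureValues_eq hk]
      exact hp.2 k hk
  -- Finiteness selects the intended branch in the definition of `features`.
  have hfin : {ω : Ω | ∃ i j, finiteProcess p i j {ω} ≠ 0}.Finite := by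
    rw [key]; exact Finset.finite_toSet _
  have e : features (finiteProcess p) = hfin.toFinset := dif_pos hfin
  rw [e, Set.Finite.mem_toFinset, key]
  simp

end Atoms

/-! ### Conditional laws. -/

section CondLaw

variable {Ξ 𝒳 𝒳' 𝒴 : Type*} [MeasurableSpace Ξ] [MeasurableSpace 𝒳] [MeasurableSpace 𝒳']
  [MeasurableSpace 𝒴]

/-- The map `y ↦ Λ y C` is not assumed measurable; it suffices that along `Y` it agrees almost
surely with a measurable `g` having the right integrals over the events of `σ(Y)`. -/
theorem isCondLaw_of_forall_setLIntegral {P : Measure Ξ} [IsProbabilityMeasure P] {Y : Ξ → 𝒴}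
    {X : Ξ → 𝒳} {Λ : 𝒴 → Measure 𝒳} (hY : Measurable Y) (hX : Measurable X)
    (h : ∀ C : Set 𝒳, MeasurableSet C → ∃ g : 𝒴 → ℝ≥0∞, Measurable g ∧
      (∀ᵐ ξ ∂P, Λ (Y ξ) C = g (Y ξ)) ∧
      ∀ D : Set 𝒴, MeasurableSet D → ∫⁻ ξ in Y ⁻¹' D, g (Y ξ) ∂P = P (X ⁻¹' C ∩ Y ⁻¹' D)) :
    IsCondLaw P Y X Λ := by
  refine ⟨hY, hX, fun C hC => ?_⟩
  obtain ⟨g, hg, hgΛ, hgD⟩ := h C hC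
  have hle : MeasurableSpace.comap Y inferInstance ≤ (inferInstance : MeasurableSpace Ξ) :=
    hY.comap_le
  have hgY : Measurable fun ξ => g (Y ξ) := hg.comp hY
  -- The case where `D` is the whole space.
  have hfin : ∫⁻ ξ, g (Y ξ) ∂P ≠ ∞ := by
    have := hgD Set.univ .univ
    rw [Set.preimage_univ, setLIntegral_univ] at this
    rw [this]
    exact measure_ne_top _ _
  have hlt : ∀ᵐ ξ ∂P, g (Y ξ) < ∞ := ae_lt_top hgY hfin
  have hint : Integrable (fun ξ => (g (Y ξ)).toReal) P := integrable_toReal_of_lintegral_ne_top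
    hgY.aemeasurable hfin
  have h1 : (fun ξ => (g (Y ξ)).toReal) =ᵐ[P] P[(X ⁻¹' C).indicator (fun _ => (1 : ℝ)) |
      MeasurableSpace.comap Y inferInstance] := by
    refine ae_eq_condExp_of_forall_setIntegral_eq hle
      ((integrable_const 1).indicator (hX hC)) (fun s _ _ => hint.integrableOn) ?_ ?_
    · rintro _ ⟨D, hD, rfl⟩ _
      rw [integral_toReal hgY.aemeasurable.restrict (ae_restrict_of_ae hlt), hgD D hD,
        integral_indicator (hX hC), setIntegral_const, smul_eq_mul, mul_one, measureReal_def,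
        Measure.restrict_apply (hX hC)]
    · refine Measurable.aestronglyMeasurable ?_
      exact (hg.comp (comap_measurable Y)).ennreal_toReal
  refine h1.symm.trans ?_
  filter_upwards [hgΛ] with ξ hξ
  rw [measureReal_def, hξ]

/-- Conditional laws are pushed forward along measurable maps. -/
theorem IsCondLaw.map {P : Measure Ξ} {Y : Ξ → 𝒴} {X : Ξ → 𝒳} {Λ : 𝒴 → Measure 𝒳}
    (h : IsCondLaw P Y X Λ) {f : 𝒳 → 𝒳'} (hf : Measurable f) {X' : Ξ → 𝒳'} (hX' : Measurable X')
    (hXX' : ∀ᵐ ξ ∂P, X' ξ = f (X ξ)) {Λ' : 𝒴 → Measure 𝒳'}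
    (hΛ : ∀ y, Λ' y = (Λ y).map f) : IsCondLaw P Y X' Λ' := by
  refine ⟨h.1, hX', fun C hC => ?_⟩
  have h1 : (X' ⁻¹' C).indicator (fun _ => (1 : ℝ))
      =ᵐ[P] (X ⁻¹' (f ⁻¹' C)).indicator (fun _ => (1 : ℝ)) := by
    classical
    filter_upwards [hXX'] with ξ hξ
    simp only [Set.indicator_apply, Set.mem_preimage, hξ]
  refine (condExp_congr_ae h1).trans ((h.2.2 (f ⁻¹' C) (hf hC)).trans ?_)
  refine ae_of_all _ fun ξ => ?_
  simp only [hΛ, measureReal_def, Measure.map_apply hf hC]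

end CondLaw

/-! ### Simplicity of the observed points. -/

section Simple

variable {Ω T : Type*} [MeasurableSpace Ω] [MeasurableSpace T] {M υ : ℕ}

/-- Two independent points share a location with probability zero by Fubini, as the law of the
location is diffuse; countably many pairs are involved. -/
theorem ae_isProper_poissonSample [StandardBorelSpace Ω] (r : ℝ≥0)
    (m : Measure (Ω × (Fin M → Fin υ → ℝ))) [IsProbabilityMeasure m]
    (hdiff : ∀ ω, (r • m) {y | y.1 = ω} = 0) (hzero : (r • m) {y | y.2 = 0} = 0) :
    ∀ᵐ p ∂(poissonSample r m), IsProper p := by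
  -- For `r = 0` the hypotheses say nothing about `m`, but then there are almost surely no points.
  rcases eq_or_ne r 0 with rfl | hr
  · have h0 : ∀ᵐ n ∂(poissonMeasure 0), n = 0 := by
      rw [ae_iff]
      have : {n : ℕ | ¬ n = 0} = {0}ᶜ := rfl
      rw [this, prob_compl_eq_zero_iff (measurableSet_singleton _), poissonMeasure_singleton]
      simp
    have h1 : ∀ᵐ p ∂(poissonSample 0 m), p.1 = 0 := Measure.quasiMeasurePreserving_fst.ae h0
    filter_upwards [h1] with p hp
    exact ⟨fun k hk => by omega, fun k hk => by omega⟩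
  · have hnull : ∀ s, (r • m) s = 0 → m s = 0 := fun s hs => by
      have : (r • m) s = (r : ℝ≥0∞) * m s := rfl
      rw [this] at hs
      exact (mul_eq_zero.1 hs).resolve_left (by exact_mod_cast hr)
    have h1 : ∀ᵐ y ∂(Measure.infinitePi fun _ : ℕ => m), ∀ k, (y k).2 ≠ 0 := by
      refine ae_all_iff.2 fun k => ?_
      have : ∀ᵐ y ∂m, y.2 ≠ 0 := by
        rw [ae_iff]
        simpa using hnull _ hzero
      exact (measurePreserving_eval_infinitePi (fun _ : ℕ => m) k).quasiMeasurePreserving.ae this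
    have h2 : ∀ᵐ y ∂(Measure.infinitePi fun _ : ℕ => m), ∀ k l, k ≠ l → (y k).1 ≠ (y l).1 := by
      refine ae_all_iff.2 fun k => ae_all_iff.2 fun l => ?_
      by_cases hkl : k = l
      · exact ae_of_all _ fun y h => (h hkl).elim
      have hind : iIndepFun (fun (i : ℕ) (y : ℕ → Ω × (Fin M → Fin υ → ℝ)) => y i)
          (Measure.infinitePi fun _ : ℕ => m) :=
        iIndepFun_infinitePi (P := fun _ : ℕ => m) (X := fun _ y => y) fun _ => measurable_id
      have hmap := (indepFun_iff_map_prod_eq_prod_map_map (measurable_pi_apply k).aemeasurable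
        (measurable_pi_apply l).aemeasurable).1 (hind.indepFun hkl)
      rw [Measure.infinitePi_map_eval, Measure.infinitePi_map_eval] at hmap
      have hS : MeasurableSet {w : (Ω × (Fin M → Fin υ → ℝ)) × (Ω × (Fin M → Fin υ → ℝ)) |
          w.1.1 = w.2.1} := measurableSet_eq_fun (by fun_prop) (by fun_prop)
      have hnz : ∀ᵐ w ∂(m.prod m), w.1.1 ≠ w.2.1 := by
        rw [ae_iff]
        simp only [ne_eq, not_not]
        rw [Measure.prod_apply hS, lintegral_eq_zero_iff (measurable_measure_prodMk_left hS)]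
        refine ae_of_all _ fun y => ?_
        have : (Prod.mk y ⁻¹' {w : (Ω × (Fin M → Fin υ → ℝ)) × (Ω × (Fin M → Fin υ → ℝ)) |
          w.1.1 = w.2.1}) = {y' | y'.1 = y.1} := by ext; simp [eq_comm]
        exact (congrArg m this).trans (hnull _ (hdiff _))
      rw [← hmap] at hnz
      have := ae_of_ae_map (by fun_prop) hnz
      filter_upwards [this] with y hy _ using hy
    have h3 : ∀ᵐ y ∂(Measure.infinitePi fun _ : ℕ => m),
        (∀ k, (y k).2 ≠ 0) ∧ ∀ k l, k ≠ l → (y k).1 ≠ (y l).1 := h1.and h2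
    have h4 := (Measure.quasiMeasurePreserving_snd (μ := poissonMeasure r)
      (ν := Measure.infinitePi fun _ : ℕ => m)).ae h3
    filter_upwards [h4] with p hp
    exact ⟨fun k _ l _ => hp.2 k l, fun k _ => hp.1 k⟩

/-- The set of the points `((ω, a), t)` with `a ≠ 0` whose location has the code `v`. -/
def codeCell (b : Ω → ℕ → Bool) (n : ℕ) (v : Fin n → Bool) :
    Set ((Ω × (Fin M → Fin υ → ℝ)) × T) := {x | x.1.2 ≠ 0 ∧ ∀ i : Fin n, b x.1.1 i = v i}

theorem measurableSet_codeCell {b : Ω → ℕ → Bool} (hb : Measurable b) (n : ℕ) (v : Fin n → Bool) :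
    MeasurableSet (codeCell b n v : Set ((Ω × (Fin M → Fin υ → ℝ)) × T)) := by
  have e : (codeCell b n v : Set ((Ω × (Fin M → Fin υ → ℝ)) × T))
      = {x | x.1.2 = 0}ᶜ ∩ ⋂ i : Fin n, {x | b x.1.1 i = v i} := by
    ext x; simp [codeCell]
  rw [e]
  refine (measurableSet_eq_fun (by fun_prop) (by fun_prop)).compl.inter (.iInter fun i => ?_)
  exact measurableSet_eq_fun (by fun_prop) (by fun_prop)

/-- The measures with mass at most one on the cells of some level. -/
def codeSimple (b : Ω → ℕ → Bool) : Set (Measure ((Ω × (Fin M → Fin υ → ℝ)) × T)) :=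
  {N | ∃ n, ∀ v : Fin n → Bool, N (codeCell b n v) ≤ 1}

theorem measurableSet_codeSimple {b : Ω → ℕ → Bool} (hb : Measurable b) :
    MeasurableSet (codeSimple b : Set (Measure ((Ω × (Fin M → Fin υ → ℝ)) × T))) := by
  have e : (codeSimple b : Set (Measure ((Ω × (Fin M → Fin υ → ℝ)) × T)))
      = ⋃ n, ⋂ v : Fin n → Bool, {N | N (codeCell b n v) ≤ 1} := by
    ext x; simp [codeSimple]
  rw [e]
  exact .iUnion fun n => .iInter fun v => measurableSet_le
    (Measure.measurable_coe (measurableSet_codeCell hb n v)) measurable_const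

/-- Finitely many distinct locations are told apart by finitely many bits of their codes. Put this
way, distinctness is a measurable property of the point measure, so it can be transferred between
spaces. -/
theorem mem_codeSimple_of_isProper {b : Ω → ℕ → Bool} (hb : Measurable b)
    (hinj : Function.Injective b) {p : ℕ × (ℕ → Ω × (Fin M → Fin υ → ℝ))} (hp : IsProper p)
    (t : ℕ → T) {N₀ : Measure ((Ω × (Fin M → Fin υ → ℝ)) × T)} (hN₀ : N₀ {x | x.1.2 ≠ 0} = 0) :
    N₀ + ∑ k ∈ Finset.range p.1, Measure.dirac (p.2 k, t k) ∈ codeSimple b := by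
  classical
  have hsep : ∀ k l, ∃ i, k < p.1 → l < p.1 → k ≠ l → b (p.2 k).1 i ≠ b (p.2 l).1 i := by
    intro k l
    by_cases h : k < p.1 ∧ l < p.1 ∧ k ≠ l
    · obtain ⟨i, hi⟩ := Function.ne_iff.1 (hinj.ne (hp.1 k h.1 l h.2.1 h.2.2))
      exact ⟨i, fun _ _ _ => hi⟩
    · exact ⟨0, fun h1 h2 h3 => (h ⟨h1, h2, h3⟩).elim⟩
  choose f hf using hsep
  -- The level must exceed every separating index, hence the `+ 1`.
  let n := (Finset.range p.1 ×ˢ Finset.range p.1).sup (fun w => f w.1 w.2) + 1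
  have hn : ∀ k < p.1, ∀ l < p.1, f k l < n := fun k hk l hl =>
    Nat.lt_succ_of_le (Finset.le_sup (f := fun w : ℕ × ℕ => f w.1 w.2) (b := (k, l)) (by simp [hk, hl]))
  refine ⟨n, fun v => ?_⟩
  have hcell := measurableSet_codeCell (M := M) (υ := υ) (T := T) hb n v
  have h0 : N₀ (codeCell b n v) = 0 := measure_mono_null (fun x hx => hx.1) hN₀
  rw [Measure.add_apply, h0, zero_add, Measure.finsetSum_apply]
  simp_rw [Measure.dirac_apply' _ hcell]
  by_cases hex : ∃ k ∈ Finset.range p.1, (p.2 k, t k) ∈ codeCell b n v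
  · obtain ⟨k, hk, hkc⟩ := hex
    rw [Finset.sum_eq_single k]
    · exact Set.indicator_le (g := fun _ => 1) (fun _ _ => le_rfl) _
    · intro l hl hlk
      refine Set.indicator_of_notMem (fun hlc => ?_) _
      have hk' := Finset.mem_range.1 hk
      have hl' := Finset.mem_range.1 hl
      refine hf l k hl' hk' hlk ?_
      exact (hlc.2 ⟨f l k, hn l hl' k hk'⟩).trans (hkc.2 ⟨f l k, hn l hl' k hk'⟩).symm
    · exact fun h => (h hk).elim
  · push Not at hex
    rw [Finset.sum_eq_zero fun k hk => Set.indicator_of_notMem (hex k hk) _]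
    exact zero_le

/-- Two active entries at one location have the same code, so at every level their common cell would
have mass at least `2`. -/
theorem injOn_of_mem_codeSimple {b : Ω → ℕ → Bool} (hb : Measurable b)
    {x : ℕ → Bool × ((Ω × (Fin M → Fin υ → ℝ)) × T)} (hx : seqMeasure x ∈ codeSimple b) :
    Set.InjOn (fun k => (x k).2.1.1) {k | (x k).1 = true ∧ (x k).2.1.2 ≠ 0} := by
  classical
  intro k hk l hl hkl
  by_contra hne
  obtain ⟨n, hn⟩ := hx
  have h := hn fun i => b (x k).2.1.1 i
  rw [seqMeasure_apply _ (measurableSet_codeCell hb _ _)] at h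
  have h2 := (ENNReal.sum_le_tsum {k, l}).trans h
  have hkc : (x k).2 ∈ codeCell b n fun i : Fin n => b (x k).2.1.1 i := ⟨hk.2, fun i => rfl⟩
  have hlc : (x l).2 ∈ codeCell b n fun i : Fin n => b (x k).2.1.1 i :=
    ⟨hl.2, fun i => by simp only at hkl; rw [hkl]⟩
  rw [Finset.sum_pair hne, if_pos hk.1, if_pos hl.1, Set.indicator_of_mem hkc,
    Set.indicator_of_mem hlc] at h2
  norm_num at h2

/-- The vector of processes determined by a sequence of points `((ω, a), t)`. -/
def processSeq (x : ℕ → Bool × ((Ω × (Fin M → Fin υ → ℝ)) × T)) :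
    Fin M → Fin υ → SignedMeasure Ω := fun i j => signedSeq (fun y => y.1.1) (fun y => y.1.2 i j) x

theorem measurable_processSeq :
    Measurable (processSeq : (ℕ → Bool × ((Ω × (Fin M → Fin υ → ℝ)) × T)) → _) :=
  measurable_pi_lambda _ fun i => measurable_pi_lambda _ fun j =>
    measurable_signedSeq (by fun_prop) (by fun_prop)

omit [MeasurableSpace T] in
theorem exists_isProper_eq {x : ℕ → Bool × ((Ω × (Fin M → Fin υ → ℝ)) × T)}
    (hfin : {k | (x k).1 = true ∧ (x k).2.1.2 ≠ 0}.Finite)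
    (hinj : Set.InjOn (fun k => (x k).2.1.1) {k | (x k).1 = true ∧ (x k).2.1.2 ≠ 0}) :
    ∃ p : ℕ × (ℕ → Ω × (Fin M → Fin υ → ℝ)), IsProper p ∧ processSeq x = finiteProcess p ∧
      ∀ k < p.1, ∃ l, (x l).1 = true ∧ (x l).2.1 = p.2 k := by
  classical
  let s := hfin.toFinset
  have hs : ∀ k, k ∈ s ↔ (x k).1 = true ∧ (x k).2.1.2 ≠ 0 := fun k => by simp [s]
  let e := s.equivFin.symm
  -- Enumerates the active entries; the value beyond their number is an irrelevant default.
  let y : ℕ → Ω × (Fin M → Fin υ → ℝ) := fun k =>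
    if h : k < s.card then (x (e ⟨k, h⟩)).2.1 else (x 0).2.1
  have hy : ∀ k (h : k < s.card), y k = (x (e ⟨k, h⟩)).2.1 := fun k h => dif_pos h
  have hes : ∀ i, (x (e i)).1 = true ∧ (x (e i)).2.1.2 ≠ 0 := fun i => (hs _).1 (e i).2
  refine ⟨(s.card, y), ⟨fun k hk l hl hkl h => ?_, fun k hk => ?_⟩, ?_, fun k hk => ?_⟩
  · simp only [hy k hk, hy l hl] at h
    have := hinj (hes _) (hes _) h
    exact hkl (by simpa using e.injective (Subtype.ext this))
  · simp only [hy k hk]; exact (hes _).2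
  · ext1 i; ext1 j
    rw [processSeq, signedSeq_eq_sum (s := s)
      (fun k hk hk' => (hs k).2 ⟨hk, fun h0 => hk' (by simp [h0])⟩) (fun k hk => ((hs k).1 hk).1),
      finiteProcess, Finset.sum_range, ← Finset.sum_coe_sort, ← Equiv.sum_comp e]
    refine Finset.sum_congr rfl fun k _ => ?_
    simp only [hy k k.2]
  · exact ⟨e ⟨k, hk⟩, (hes _).1, (hy k hk).symm⟩

end Simple

/-! ### The explicit model and the abstract posterior theorem. -/

section Main

variable {Ω T : Type*} [MeasurableSpace Ω] [MeasurableSpace T] {M υ : ℕ}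

/-- The point `(ω, t)` with the value `a = 0`. -/
def zeroValue (x : Ω × T) : (Ω × (Fin M → Fin υ → ℝ)) × T := ((x.1, 0), x.2)

/-- The point `((ω, a), t)` without the value `a`. -/
def dropValue (x : (Ω × (Fin M → Fin υ → ℝ)) × T) : Ω × T := (x.1.1, x.2)

@[fun_prop]
theorem measurable_zeroValue :
    Measurable (zeroValue : Ω × T → (Ω × (Fin M → Fin υ → ℝ)) × T) := by
  unfold zeroValue; fun_prop

@[fun_prop]
theorem measurable_dropValue :
    Measurable (dropValue : (Ω × (Fin M → Fin υ → ℝ)) × T → Ω × T) := by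
  unfold dropValue; fun_prop

theorem measurableSet_value_ne_zero :
    MeasurableSet {x : (Ω × (Fin M → Fin υ → ℝ)) × T | x.1.2 ≠ 0} :=
  (measurableSet_eq_fun (by fun_prop) (by fun_prop)).compl

/-- The vector of processes determined by a measure on the points `((ω, a), t)`. -/
def processOf (N : Measure ((Ω × (Fin M → Fin υ → ℝ)) × T)) : Fin M → Fin υ → SignedMeasure Ω :=
  fun i j => signedOf (fun y => y.1.1) (fun y => y.1.2 i j) N

theorem measurable_processOf :
    Measurable (processOf : Measure ((Ω × (Fin M → Fin υ → ℝ)) × T) → _) :=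
  measurable_pi_lambda _ fun i => measurable_pi_lambda _ fun j =>
    measurable_signedOf (by fun_prop) (by fun_prop)

theorem processOf_seqMeasure {x : ℕ → Bool × ((Ω × (Fin M → Fin υ → ℝ)) × T)}
    (hfin : {k | (x k).1 = true ∧ (x k).2.1.2 ≠ 0}.Finite) :
    processOf (seqMeasure x) = processSeq x := by
  ext1 i; ext1 j
  refine signedOf_seqMeasure (by fun_prop) (by fun_prop) (hfin.subset fun k hk => ⟨hk.1, fun h0 => ?_⟩)
  exact hk.2 (by simp [h0])

variable {𝒰 : Type*} [MeasurableSpace 𝒰]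

/-- The point measure `N₀ + ∑ₖ δ_(yₖ, φ (yₖ, uₖ))`, where the points of `N₀` have value `0`. -/
def modelPoints (φ : Ω × (Fin M → Fin υ → ℝ) → 𝒰 → T) (p : ℕ × (ℕ → Ω × (Fin M → Fin υ → ℝ)))
    (w : Measure (Ω × T) × (ℕ → 𝒰)) : Measure ((Ω × (Fin M → Fin υ → ℝ)) × T) :=
  w.1.map zeroValue + seqMeasure (markedSeq φ (truncSeq p.1 p.2) w.2)

omit [MeasurableSpace 𝒰] in
theorem seqMeasure_markedSeq_truncSeq (φ : Ω × (Fin M → Fin υ → ℝ) → 𝒰 → T)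
    (p : ℕ × (ℕ → Ω × (Fin M → Fin υ → ℝ))) (u : ℕ → 𝒰) :
    seqMeasure (markedSeq φ (truncSeq p.1 p.2) u)
      = ∑ k ∈ Finset.range p.1, Measure.dirac (p.2 k, φ (p.2 k) (u k)) :=
  seqMeasure_truncSeq p.1 fun k => (p.2 k, φ (p.2 k) (u k))

theorem measurable_modelPoints {φ : Ω × (Fin M → Fin υ → ℝ) → 𝒰 → T}
    (hφ : Measurable (Function.uncurry φ)) :
    Measurable fun w : (ℕ × (ℕ → Ω × (Fin M → Fin υ → ℝ))) × (Measure (Ω × T) × (ℕ → 𝒰)) =>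
      modelPoints φ w.1 w.2 := by
  have h1 : Measurable fun w : (ℕ × (ℕ → Ω × (Fin M → Fin υ → ℝ))) × (Measure (Ω × T) × (ℕ → 𝒰)) =>
      w.2.1.map (zeroValue : Ω × T → (Ω × (Fin M → Fin υ → ℝ)) × T) :=
    (Measure.measurable_map _ measurable_zeroValue).comp (by fun_prop)
  have h2 : Measurable fun w : (ℕ × (ℕ → Ω × (Fin M → Fin υ → ℝ))) × (Measure (Ω × T) × (ℕ → 𝒰)) =>
      seqMeasure (markedSeq φ (truncSeq w.1.1 w.1.2) w.2.2) :=
    measurable_seqMeasure.comp ((measurable_markedSeq hφ).comp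
      ((measurable_truncSeq.comp measurable_fst).prodMk (by fun_prop)))
  refine Measure.measurable_of_measurable_coe _ fun s hs => ?_
  simp only [modelPoints, Measure.add_apply]
  exact ((Measure.measurable_coe hs).comp h1).add ((Measure.measurable_coe hs).comp h2)

-- The points of `N₀` carry the value `0`, so even infinitely many of them leave the integrand zero
-- almost everywhere. The processes thus depend on the finite sample only.
omit [MeasurableSpace 𝒰] in
theorem processOf_modelPoints (φ : Ω × (Fin M → Fin υ → ℝ) → 𝒰 → T)
    (p : ℕ × (ℕ → Ω × (Fin M → Fin υ → ℝ))) (w : Measure (Ω × T) × (ℕ → 𝒰)) :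
    processOf (modelPoints φ p w) = finiteProcess p := by
  ext1 i; ext1 j
  have hg : Measurable fun y : (Ω × (Fin M → Fin υ → ℝ)) × T => y.1.1 := by fun_prop
  have ha : Measurable fun y : (Ω × (Fin M → Fin υ → ℝ)) × T => y.1.2 i j := by fun_prop
  have h0 : (fun y : (Ω × (Fin M → Fin υ → ℝ)) × T => y.1.2 i j)
      =ᵐ[w.1.map zeroValue] fun _ => 0 := by
    refine (ae_map_iff measurable_zeroValue.aemeasurable
      (measurableSet_eq_fun ha measurable_const)).2 (ae_of_all _ fun x => rfl)
  have hint : Integrable (fun y : (Ω × (Fin M → Fin υ → ℝ)) × T => y.1.2 i j)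
      (w.1.map zeroValue) := (integrable_zero _ _ _).congr h0.symm
  rw [processOf, modelPoints, seqMeasure_markedSeq_truncSeq, signedOf_add hg hint
    (integrable_finsetSum_dirac ha _ _), signedOf_finsetSum_dirac hg ha]
  have hz : signedOf (fun y : (Ω × (Fin M → Fin υ → ℝ)) × T => y.1.1) (fun y => y.1.2 i j)
      (w.1.map zeroValue) = 0 := by
    ext B hB
    rw [signedOf_apply hg hint hB, integral_congr_ae (ae_restrict_of_ae h0)]
    simp
  rw [hz, zero_add]
  rfl

theorem lintegral_prod_prod_mul {X Y Z : Type*} [MeasurableSpace X] [MeasurableSpace Y]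
    [MeasurableSpace Z] {a : Measure X} {b : Measure Y} {c : Measure Z} [SFinite a] [SFinite b]
    [SFinite c] {f : Y → ℝ≥0∞} {g : X × Z → ℝ≥0∞} (hf : Measurable f) (hg : Measurable g) :
    ∫⁻ w, f w.2.1 * g (w.1, w.2.2) ∂(a.prod (b.prod c)) = (∫⁻ y, f y ∂b) * ∫⁻ w, g w ∂(a.prod c) := by
  rw [lintegral_prod _ (by fun_prop), lintegral_prod _ (by fun_prop),
    ← lintegral_const_mul _ hg.lintegral_prod_right']
  refine lintegral_congr fun p => ?_
  exact lintegral_prod_mul (f := f) (g := fun z => g (p, z)) hf.aemeasurable (by fun_prop)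

/-- Superposition: `N₀` and the marked Poisson sample are independent, so their Laplace functionals
multiply and the mean measures add. -/
theorem hasPoissonLaplace_modelPoints {θ₀ : Measure (Ω × T)} {Q₀ : Measure (Measure (Ω × T))}
    (hQ₀ : HasPoissonLaplace θ₀ Q₀) (r : ℝ≥0) (m : Measure (Ω × (Fin M → Fin υ → ℝ)))
    [IsProbabilityMeasure m] (κ : Kernel (Ω × (Fin M → Fin υ → ℝ)) T) [IsMarkovKernel κ]
    (τ : Measure 𝒰) [IsProbabilityMeasure τ] {φ : Ω × (Fin M → Fin υ → ℝ) → 𝒰 → T}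
    (hφ : Measurable (Function.uncurry φ)) (hφκ : ∀ y, τ.map (φ y) = κ y) :
    HasPoissonLaplace (θ₀.map zeroValue + (r • m) ⊗ₘ κ)
      (((poissonSample r m).prod (Q₀.prod (Measure.infinitePi fun _ => τ))).map
        fun w => modelPoints φ w.1 w.2) := by
  have := hQ₀.isProb
  have hm := measurable_modelPoints hφ
  have htr : Measurable fun p : ℕ × (ℕ → Ω × (Fin M → Fin υ → ℝ)) => truncSeq p.1 p.2 :=
    measurable_truncSeq
  have : IsProbabilityMeasure ((poissonSample r m).map fun p => truncSeq p.1 p.2) :=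
    Measure.isProbabilityMeasure_map htr.aemeasurable
  refine ⟨Measure.isProbabilityMeasure_map hm.aemeasurable, fun f hf => ?_⟩
  have hmark := ((hasPoissonLaplace_poissonSample r m).marking κ τ φ hφ hφκ).laplace f hf
  have hmk : Measurable fun p : (ℕ → Bool × (Ω × (Fin M → Fin υ → ℝ))) × (ℕ → 𝒰) =>
      seqMeasure (markedSeq φ p.1 p.2) := measurable_seqMeasure.comp (measurable_markedSeq hφ)
  have hz := Measure.measurable_map _ (measurable_zeroValue (Ω := Ω) (T := T) (M := M) (υ := υ))
  have hn := measurable_negexp_lintegral hf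
  have h1 := (hQ₀.map (measurable_zeroValue (M := M) (υ := υ))).laplace f hf
  have hpm := Measure.map_prod_map (poissonSample r m) (Measure.infinitePi fun _ : ℕ => τ) htr
    measurable_id
  rw [Measure.map_id] at hpm
  have hid := htr.prodMap (measurable_id (α := ℕ → 𝒰))
  rw [hpm, Measure.map_map hmk hid, lintegral_map hn (hmk.comp hid)] at hmark
  rw [lintegral_map hn hz] at h1
  rw [lintegral_map hn hm, lintegral_add_measure, negexp_add, ← h1, ← hmark]
  refine Eq.trans (lintegral_congr fun w => ?_)
    (lintegral_prod_prod_mul (hn.comp hz) (hn.comp (hmk.comp hid)))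
  rw [modelPoints, lintegral_add_measure, negexp_add]
  rfl

/-- The law of `N₀ + ∑ δ_(ω, t_ω)`, the sum running over the features `ω` of `z`, where the `t_ω`
are independent with laws `κ(· | ω, a(ω))`. -/
def posteriorLaw (Q₀ : Measure (Measure (Ω × T))) (κ : Kernel (Ω × (Fin M → Fin υ → ℝ)) T)
    (z : Fin M → Fin υ → SignedMeasure Ω) : Measure (Measure (Ω × T)) :=
  (Q₀.prod (Measure.pi fun ω : features z => κ (ω, featureValues z ω))).map fun p =>
    p.1 + ∑ ω : features z, Measure.dirac ((ω : Ω), p.2 ω)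

theorem measurable_add_sum_dirac {ι : Type*} [Fintype ι] (ω : ι → Ω) :
    Measurable fun p : Measure (Ω × T) × (ι → T) =>
      p.1 + ∑ i, Measure.dirac (ω i, p.2 i) := by
  refine Measure.measurable_of_measurable_coe _ fun s hs => ?_
  simp only [Measure.add_apply, Measure.finsetSum_apply]
  refine ((Measure.measurable_coe hs).comp measurable_fst).add
    (Finset.measurable_sum _ fun i _ => ?_)
  exact (Measure.measurable_coe hs).comp (Measure.measurable_dirac.comp (by fun_prop))

omit [MeasurableSpace 𝒰] in
theorem dropValue_modelPoints (φ : Ω × (Fin M → Fin υ → ℝ) → 𝒰 → T)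
    (p : ℕ × (ℕ → Ω × (Fin M → Fin υ → ℝ))) (w : Measure (Ω × T) × (ℕ → 𝒰)) :
    (modelPoints φ p w).map dropValue
      = w.1 + ∑ k ∈ Finset.range p.1, Measure.dirac ((p.2 k).1, φ (p.2 k) (w.2 k)) := by
  rw [modelPoints, Measure.map_add _ _ measurable_dropValue,
    Measure.map_map measurable_dropValue measurable_zeroValue,
    map_seqMeasure _ measurable_dropValue]
  congr 1
  · exact Measure.map_id
  · exact seqMeasure_truncSeq p.1 fun k => ((p.2 k).1, φ (p.2 k) (w.2 k))

/-- For a proper sample the features of the processes correspond bijectively to the indices of the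
sample, so the sum over features is a reordering of the sum over indices. The law of the points
given the sample therefore depends only on the processes. -/
theorem posteriorLaw_finiteProcess [MeasurableSingletonClass Ω] {Q₀ : Measure (Measure (Ω × T))}
    [IsProbabilityMeasure Q₀] (κ : Kernel (Ω × (Fin M → Fin υ → ℝ)) T) [IsMarkovKernel κ]
    (τ : Measure 𝒰) [IsProbabilityMeasure τ] {φ : Ω × (Fin M → Fin υ → ℝ) → 𝒰 → T}
    (hφ : Measurable (Function.uncurry φ)) (hφκ : ∀ y, τ.map (φ y) = κ y)
    {p : ℕ × (ℕ → Ω × (Fin M → Fin υ → ℝ))} (hp : IsProper p) :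
    posteriorLaw Q₀ κ (finiteProcess p)
      = (Q₀.prod (Measure.infinitePi fun _ => τ)).map
        fun w => (modelPoints φ p w).map dropValue := by
  classical
  have hφm : ∀ y, Measurable (φ y) := fun y => hφ.comp (measurable_const.prodMk measurable_id)
  have hmem := fun ω => hp.mem_features_iff (ω := ω)
  -- `e` sends a feature to its index in the sample.
  choose e he using fun ω : features (finiteProcess p) => (hmem ω).1 ω.2
  have hinj : Function.Injective e := fun ω ω' h => Subtype.ext (by rw [← (he ω).2, h, (he ω').2])
  have hval : ∀ ω : features (finiteProcess p),
      ((ω : Ω), featureValues (finiteProcess p) ω) = p.2 (e ω) := fun ω => by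
    conv_lhs => rw [← (he ω).2, hp.featureValues_eq (he ω).1]
  have hH : Measurable fun (u : ℕ → 𝒰) (ω : features (finiteProcess p)) => φ (p.2 (e ω)) (u (e ω)) :=
    measurable_pi_lambda _ fun ω => (hφm _).comp (measurable_pi_apply _)
  -- The jump at a feature uses the randomization with the index of that feature; `e` is injective,
  -- so these jumps are independent.
  have hpi : (Measure.pi fun ω : features (finiteProcess p) =>
      κ ((ω : Ω), featureValues (finiteProcess p) ω))
      = (Measure.infinitePi fun _ : ℕ => τ).map fun u ω => φ (p.2 (e ω)) (u (e ω)) := by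
    have hind : iIndepFun (fun k (u : ℕ → 𝒰) => φ (p.2 k) (u k))
        (Measure.infinitePi fun _ : ℕ => τ) := iIndepFun_infinitePi fun k => hφm (p.2 k)
    have hind' := hind.precomp hinj
    rw [iIndepFun_iff_map_fun_eq_infinitePi_map
      fun ω => measurable_pi_iff.1 hH ω] at hind'
    have hlaw : ∀ k, (Measure.infinitePi fun _ : ℕ => τ).map (fun u => φ (p.2 k) (u k))
        = κ (p.2 k) := fun k => by
      have h := Measure.map_map (μ := Measure.infinitePi fun _ : ℕ => τ) (hφm (p.2 k))
        (measurable_pi_apply k)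
      rw [Measure.infinitePi_map_eval, hφκ] at h
      exact h.symm
    have hpr : ∀ ω : features (finiteProcess p), IsProbabilityMeasure
        ((Measure.infinitePi fun _ : ℕ => τ).map fun u => φ (p.2 (e ω)) (u (e ω))) := fun ω => by
      rw [hlaw]; infer_instance
    have h3 := hind'.trans (Measure.infinitePi_eq_pi (μ := fun ω : features (finiteProcess p) =>
      (Measure.infinitePi fun _ : ℕ => τ).map fun u => φ (p.2 (e ω)) (u (e ω))))
    refine Eq.symm (h3.trans ?_)
    congr 1
    ext1 ω
    rw [hlaw, hval]
  rw [posteriorLaw, hpi]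
  have h4 := Measure.map_prod_map Q₀ (Measure.infinitePi fun _ : ℕ => τ) measurable_id hH
  rw [Measure.map_id] at h4
  rw [h4, Measure.map_map (measurable_add_sum_dirac _) (measurable_id.prodMap hH)]
  congr 1
  ext1 w
  rw [dropValue_modelPoints]
  simp only [Function.comp_apply, Prod.map, id]
  congr 1
  refine Finset.sum_bij (fun ω _ => e ω) (fun ω _ => Finset.mem_range.2 (he ω).1)
    (fun ω _ ω' _ h => hinj h) (fun k hk => ?_) (fun ω _ => by rw [(he ω).2])
  have hk := Finset.mem_range.1 hk
  refine ⟨⟨(p.2 k).1, (hmem _).2 ⟨k, hk, rfl⟩⟩, Finset.mem_univ _, ?_⟩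
  by_contra hne
  exact hp.1 _ (he _).1 k hk hne (he ⟨(p.2 k).1, (hmem _).2 ⟨k, hk, rfl⟩⟩).2

variable [StandardBorelSpace Ω] [StandardBorelSpace T]

omit [StandardBorelSpace T] in
/-- The posterior law is a measurable function of the observed finite processes. -/
theorem exists_measurable_posteriorLaw_eq {Q₀ : Measure (Measure (Ω × T))}
    [IsProbabilityMeasure Q₀] (κ : Kernel (Ω × (Fin M → Fin υ → ℝ)) T) [IsMarkovKernel κ]
    (τ : Measure 𝒰) [IsProbabilityMeasure τ] {φ : Ω × (Fin M → Fin υ → ℝ) → 𝒰 → T}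
    (hφ : Measurable (Function.uncurry φ)) (hφκ : ∀ y, τ.map (φ y) = κ y)
    {C : Set (Measure (Ω × T))} (hC : MeasurableSet C) :
    ∃ g : (Fin M → Fin υ → SignedMeasure Ω) → ℝ≥0∞, Measurable g ∧
      ∀ p, IsProper p → g (finiteProcess p) = posteriorLaw Q₀ κ (finiteProcess p) C := by
  have : StandardBorelSpace (Ω × (Fin M → Fin υ → ℝ)) := inferInstance
  have : StandardBorelSpace {p : ℕ × (ℕ → Ω × (Fin M → Fin υ → ℝ)) // IsProper p} :=
    measurableSet_isProper.standardBorel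
  let f : {p : ℕ × (ℕ → Ω × (Fin M → Fin υ → ℝ)) // IsProper p} →
    (Fin M → Fin υ → SignedMeasure Ω) := fun p => finiteProcess p.1
  have hf : Measurable f := measurable_finiteProcess.comp measurable_subtype_coe
  have hsep := countablySeparated_pi_signedMeasure (Ω := Ω) (ι := Fin M) (ι' := Fin υ)
  have : MeasurableSpace.CountablySeparated (Set.range f) :=
    MeasurableSpace.Subtype.countablySeparated
  let g₀ : (Fin M → Fin υ → SignedMeasure Ω) → ℝ≥0∞ := fun z => posteriorLaw Q₀ κ z C
  have hset : MeasurableSet {w : (ℕ × (ℕ → Ω × (Fin M → Fin υ → ℝ))) × (Measure (Ω × T) × (ℕ → 𝒰)) |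
      (modelPoints φ w.1 w.2).map dropValue ∈ C} :=
    ((Measure.measurable_map _ measurable_dropValue).comp (measurable_modelPoints hφ)) hC
  -- Along proper samples the posterior probability is a section of one fixed measurable set, hence
  -- measurable in the sample.
  have hcomp : Measurable (g₀ ∘ f) := by
    have e : g₀ ∘ f = (fun p => (Q₀.prod (Measure.infinitePi fun _ => τ)) (Prod.mk p ⁻¹'
        {w : (ℕ × (ℕ → Ω × (Fin M → Fin υ → ℝ))) × (Measure (Ω × T) × (ℕ → 𝒰)) |
          (modelPoints φ w.1 w.2).map dropValue ∈ C})) ∘ Subtype.val := by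
      ext p
      simp only [Function.comp_apply, g₀, f]
      rw [posteriorLaw_finiteProcess κ τ hφ hφκ p.2]
      exact Measure.map_apply (((Measure.measurable_map _ measurable_dropValue).comp
        (measurable_modelPoints hφ)).comp measurable_prodMk_left) hC
    rw [e]
    exact (measurable_measure_prodMk_left hset).comp measurable_subtype_coe
  -- The source of `f` is standard Borel and its range is countably separated, so a function on the
  -- range is measurable as soon as its composition with `f` is. It then extends to a measurable
  -- function of all processes.
  obtain ⟨g, hg, hgg⟩ := Measurable.exists_eq_measurable_comp
    ((hf.measurable_comp_iff_restrict (g := g₀)).1 hcomp)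
  exact ⟨g, hg, fun p hp => (congrFun hgg ⟨finiteProcess p, ⟨⟨p, hp⟩, rfl⟩⟩).symm⟩

section Posterior

variable {Ξ : Type*} [MeasurableSpace Ξ] {P : Measure Ξ} [IsProbabilityMeasure P]
  {θ₀ : Measure (Ω × T)} {Q₀ : Measure (Measure (Ω × T))} (hQ₀ : HasPoissonLaplace θ₀ Q₀)
  {m : Measure (Ω × (Fin M → Fin υ → ℝ))} [IsFiniteMeasure m]
  (hm_diffuse : ∀ ω, m {y | y.1 = ω} = 0) (hm_zero : m {y | y.2 = 0} = 0)
  {κ : Kernel (Ω × (Fin M → Fin υ → ℝ)) T} [IsMarkovKernel κ]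
  {x : Ξ → ℕ → Bool × ((Ω × (Fin M → Fin υ → ℝ)) × T)} (hx : Measurable x)
  (hlaw : HasPoissonLaplace (θ₀.map zeroValue + m ⊗ₘ κ) (P.map fun ξ => seqMeasure (x ξ)))

include hx hlaw

-- The mean number of points with `a ≠ 0` is the total mass of `m`, as the other part of the mean
-- measure lives on `a = 0`.
omit [StandardBorelSpace Ω] [StandardBorelSpace T] [IsProbabilityMeasure P] in
theorem ae_finite_nonzero : ∀ᵐ ξ ∂P, {k | (x ξ k).1 = true ∧ (x ξ k).2.1.2 ≠ 0}.Finite := by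
  have hE := measurableSet_value_ne_zero (Ω := Ω) (T := T) (M := M) (υ := υ)
  have hfin : (θ₀.map zeroValue + m ⊗ₘ κ : Measure _) {x : (Ω × (Fin M → Fin υ → ℝ)) × T | x.1.2 ≠ 0} ≠ ∞ := by
    rw [Measure.add_apply, Measure.map_apply measurable_zeroValue hE]
    have : (zeroValue : Ω × T → (Ω × (Fin M → Fin υ → ℝ)) × T) ⁻¹' {x | x.1.2 ≠ 0} = ∅ := by
      ext x; simp [zeroValue]
    rw [this, measure_empty, zero_add]
    exact measure_ne_top _ _
  have h1 := hlaw.ae_lt_top hE hfin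
  have h2 := ae_of_ae_map (measurable_seqMeasure.comp hx).aemeasurable h1
  filter_upwards [h2] with ξ hξ
  exact finite_of_seqMeasure_lt_top hE hξ

include hQ₀ hm_diffuse hm_zero

theorem ae_exists_isProper : ∀ᵐ ξ ∂P, ∃ p : ℕ × (ℕ → Ω × (Fin M → Fin υ → ℝ)), IsProper p ∧
    processSeq (x ξ) = finiteProcess p ∧ ∀ k < p.1, ∃ l, (x ξ l).1 = true ∧
      (x ξ l).2.1 = p.2 k := by
  obtain ⟨ξ₀⟩ : Nonempty Ξ := nonempty_of_isProbabilityMeasure P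
  have : Nonempty (Ω × (Fin M → Fin υ → ℝ)) := ⟨(x ξ₀ 0).2.1⟩
  have : Nonempty T := ⟨(x ξ₀ 0).2.2⟩
  have := hQ₀.isProb
  obtain ⟨b, hb, hbinj⟩ := MeasurableSpace.measurable_injection_nat_bool_of_countablySeparated Ω
  obtain ⟨r, m', hm', rfl⟩ := exists_eq_smul_isProbabilityMeasure m
  obtain ⟨φ, hφ, hφκ⟩ := κ.exists_measurable_map_eq_unitInterval
  have hmodel := hasPoissonLaplace_modelPoints hQ₀ r m' κ volume hφ hφκ
  -- `codeSimple` is an event of the point measure, whose law is that of the model, where it holds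
  -- almost surely.
  have hsimple : ∀ᵐ N ∂(P.map fun ξ => seqMeasure (x ξ)), N ∈ codeSimple b := by
    rw [hlaw.unique hmodel]
    refine (ae_map_iff (p := fun N => N ∈ codeSimple b) (measurable_modelPoints hφ).aemeasurable
      (measurableSet_codeSimple hb)).2 ?_
    have hp := Measure.quasiMeasurePreserving_fst (μ := poissonSample r m')
      (ν := Q₀.prod (Measure.infinitePi fun _ : ℕ => (volume : Measure unitInterval))) |>.ae
      (ae_isProper_poissonSample r m' hm_diffuse hm_zero)
    filter_upwards [hp] with w hw
    rw [modelPoints, seqMeasure_markedSeq_truncSeq]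
    refine mem_codeSimple_of_isProper hb hbinj hw _ ?_
    rw [Measure.map_apply measurable_zeroValue measurableSet_value_ne_zero]
    have : (zeroValue : Ω × T → (Ω × (Fin M → Fin υ → ℝ)) × T) ⁻¹' {x | x.1.2 ≠ 0} = ∅ := by
      ext x; simp [zeroValue]
    rw [this, measure_empty]
  filter_upwards [ae_of_ae_map (measurable_seqMeasure.comp hx).aemeasurable hsimple,
    ae_finite_nonzero hx hlaw] with ξ h1 h2
  exact exists_isProper_eq h2 (injOn_of_mem_codeSimple hb h1)

/-- A property that holds for almost all pairs `(ω, a)` holds for all the observed features. -/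
theorem ae_forall_features {q : Ω × (Fin M → Fin υ → ℝ) → Prop} (hq : ∀ᵐ y ∂m, q y) :
    ∀ᵐ ξ ∂P, ∀ ω ∈ features (processSeq (x ξ)), q (ω, featureValues (processSeq (x ξ)) ω) := by
  obtain ⟨S, hS, hSm, hSnull⟩ := exists_measurable_superset_of_null (ae_iff.1 hq)
  -- An exceptional observed feature would be a point of `E`, a set of mean measure zero.
  let E : Set ((Ω × (Fin M → Fin υ → ℝ)) × T) := {x | x.1 ∈ S ∧ x.1.2 ≠ 0}
  have hE : MeasurableSet E := (measurable_fst hSm).inter measurableSet_value_ne_zero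
  have hnull : (θ₀.map zeroValue + m ⊗ₘ κ : Measure _) E = 0 := by
    rw [Measure.add_apply, Measure.map_apply measurable_zeroValue hE]
    have : (zeroValue : Ω × T → (Ω × (Fin M → Fin υ → ℝ)) × T) ⁻¹' E = ∅ := by
      ext x; simp [zeroValue, E]
    rw [this, measure_empty, zero_add]
    refine measure_mono_null (t := S ×ˢ Set.univ) (fun x hx => ⟨hx.1, trivial⟩) ?_
    rw [Measure.compProd_apply_prod hSm .univ]
    simpa using hSnull
  have h1 := ae_of_ae_map (measurable_seqMeasure.comp hx).aemeasurable (hlaw.ae_eq_zero hE hnull)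
  filter_upwards [h1, ae_exists_isProper hQ₀ hm_diffuse hm_zero hx hlaw] with ξ h1 h2 ω hω
  obtain ⟨p, hp, hz, hl⟩ := h2
  rw [hz] at hω ⊢
  obtain ⟨k, hk, rfl⟩ := hp.mem_features_iff.1 hω
  rw [hp.featureValues_eq hk]
  obtain ⟨l, hl1, hl2⟩ := hl k hk
  by_contra hn
  have hmem : (x ξ l).2 ∈ E := by
    refine ⟨?_, ?_⟩
    · rw [hl2]; exact hS hn
    · rw [hl2]; exact hp.2 k hk
  have h3 : seqMeasure (x ξ) E = 0 := h1
  rw [seqMeasure_apply _ hE, ENNReal.tsum_eq_zero] at h3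
  have h4 := h3 l
  rw [if_pos hl1, Set.indicator_of_mem hmem] at h4
  exact one_ne_zero h4

/-- The posterior law of a Poisson random measure of points `(ω, t)`, given the processes that are
determined by its points with value `a ≠ 0`. -/
theorem isCondLaw_posteriorLaw : IsCondLaw P (fun ξ => processSeq (x ξ))
    (fun ξ => (seqMeasure (x ξ)).map dropValue) (posteriorLaw Q₀ κ) := by
  obtain ⟨ξ₀⟩ : Nonempty Ξ := nonempty_of_isProbabilityMeasure P
  have : Nonempty (Ω × (Fin M → Fin υ → ℝ)) := ⟨(x ξ₀ 0).2.1⟩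
  have : Nonempty T := ⟨(x ξ₀ 0).2.2⟩
  have := hQ₀.isProb
  have hproper := ae_exists_isProper hQ₀ hm_diffuse hm_zero hx hlaw
  have hfinite := ae_finite_nonzero hx hlaw
  obtain ⟨r, m', hm', rfl⟩ := exists_eq_smul_isProbabilityMeasure m
  obtain ⟨φ, hφ, hφκ⟩ := κ.exists_measurable_map_eq_unitInterval
  let τ : Measure (ℕ → unitInterval) := Measure.infinitePi fun _ => volume
  let W := (poissonSample r m').prod (Q₀.prod τ)
  -- Equal Laplace functionals: any event of the point measure may be evaluated in the model.
  have hW : P.map (fun ξ => seqMeasure (x ξ)) = W.map fun w => modelPoints φ w.1 w.2 :=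
    hlaw.unique (hasPoissonLaplace_modelPoints hQ₀ r m' κ volume hφ hφκ)
  have hxm : Measurable fun ξ => seqMeasure (x ξ) := measurable_seqMeasure.comp hx
  have hz : Measurable fun ξ => processSeq (x ξ) := measurable_processSeq.comp hx
  have hmm := measurable_modelPoints (υ := υ) (M := M) hφ
  have hdrop := Measure.measurable_map _ (measurable_dropValue (Ω := Ω) (T := T) (M := M) (υ := υ))
  have hprocess : ∀ᵐ ξ ∂P, processSeq (x ξ) = processOf (seqMeasure (x ξ)) := by
    filter_upwards [hfinite] with ξ hξ using (processOf_seqMeasure hξ).symm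
  have hp : ∀ᵐ p ∂(poissonSample r m'), IsProper p :=
    ae_isProper_poissonSample r m' hm_diffuse hm_zero
  refine isCondLaw_of_forall_setLIntegral (measurable_processSeq.comp hx) (hdrop.comp hxm)
    fun C hC => ?_
  obtain ⟨g, hg, hgp⟩ := exists_measurable_posteriorLaw_eq (Q₀ := Q₀) κ volume hφ hφκ hC
  refine ⟨g, hg, ?_, fun D hD => ?_⟩
  · filter_upwards [hproper] with ξ hξ
    obtain ⟨p, hp, hz, -⟩ := hξ
    rw [hz, hgp p hp]
  · have hgD : Measurable (D.indicator g) := hg.indicator hD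
    -- Both sides of the required identity are moved to the model, where the processes are a
    -- function of the sample `p` only.
    have hL : ∫⁻ ξ in (fun ξ => processSeq (x ξ)) ⁻¹' D, g (processSeq (x ξ)) ∂P
        = ∫⁻ p, D.indicator g (finiteProcess p) ∂(poissonSample r m') := by
      rw [← lintegral_indicator (hz hD)]
      calc _ = ∫⁻ ξ, D.indicator g (processOf (seqMeasure (x ξ))) ∂P := by
            refine lintegral_congr_ae ?_
            filter_upwards [hprocess] with ξ hξ
            rw [← hξ]; rfl
        _ = ∫⁻ N, D.indicator g (processOf N) ∂(P.map fun ξ => seqMeasure (x ξ)) :=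
            (lintegral_map (hgD.comp measurable_processOf) hxm).symm
        _ = ∫⁻ w, D.indicator g (finiteProcess w.1) ∂W := by
            rw [hW]
            refine (lintegral_map (hgD.comp measurable_processOf) hmm).trans ?_
            simp only [Function.comp_apply, processOf_modelPoints]
        _ = _ := by
            refine (lintegral_prod _
              ((hgD.comp measurable_finiteProcess).comp measurable_fst).aemeasurable).trans ?_
            simp
    have hset : MeasurableSet {N : Measure ((Ω × (Fin M → Fin υ → ℝ)) × T) |
        N.map dropValue ∈ C ∧ processOf N ∈ D} := (hdrop hC).inter (measurable_processOf hD)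
    have hR : P ((fun ξ => (seqMeasure (x ξ)).map dropValue) ⁻¹' C
          ∩ (fun ξ => processSeq (x ξ)) ⁻¹' D)
        = W {w | (modelPoints φ w.1 w.2).map dropValue ∈ C ∧ finiteProcess w.1 ∈ D} := by
      calc _ = P ((fun ξ => seqMeasure (x ξ)) ⁻¹' {N | N.map dropValue ∈ C ∧ processOf N ∈ D}) := by
            refine measure_congr ?_
            filter_upwards [hprocess] with ξ hξ
            refine propext ?_
            change (_ ∧ processSeq (x ξ) ∈ D) ↔ (_ ∧ processOf (seqMeasure (x ξ)) ∈ D)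
            rw [hξ]
            rfl
        _ = _ := by
            rw [← Measure.map_apply hxm hset, hW, Measure.map_apply hmm hset]
            congr 1
            ext w
            simp only [Set.mem_preimage, Set.mem_ofPred_eq, processOf_modelPoints]
    have hset' : MeasurableSet {w : (ℕ × (ℕ → Ω × (Fin M → Fin υ → ℝ))) ×
        (Measure (Ω × T) × (ℕ → unitInterval)) |
        (modelPoints φ w.1 w.2).map dropValue ∈ C ∧ finiteProcess w.1 ∈ D} :=
      ((hdrop.comp hmm) hC).inter ((measurable_finiteProcess.comp measurable_fst) hD)
    rw [hL, hR, Measure.prod_apply hset']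
    -- After Fubini it remains to identify, for each proper sample, the section probability with the
    -- posterior probability; off `D` both vanish.
    refine lintegral_congr_ae ?_
    filter_upwards [hp] with p hp
    by_cases hpD : finiteProcess p ∈ D
    · rw [Set.indicator_of_mem hpD, hgp p hp, posteriorLaw_finiteProcess κ volume hφ hφκ hp,
        show (Q₀.prod τ).map (fun w => (modelPoints φ p w).map dropValue) C = _ from
          Measure.map_apply ((hdrop.comp hmm).comp measurable_prodMk_left) hC]
      congr 1
      ext w
      simp [hpD]
    · rw [Set.indicator_of_notMem hpD]
      symm
      convert measure_empty (μ := Q₀.prod τ)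
      ext w
      simp [hpD]

end Posterior

end Main

/-! ### Several independent marks as one mark. -/

section PiKernel

variable {Y E ι : Type*} [MeasurableSpace Y] [MeasurableSpace E] [Fintype ι]

/-- The law of independent variables, indexed by `ι`, with law `H y`. -/
def piKernel (ι : Type*) [Fintype ι] (H : Kernel Y E) [IsMarkovKernel H] : Kernel Y (ι → E) where
  toFun y := Measure.pi fun _ => H y
  measurable' := by
    refine Measurable.measure_of_isPiSystem_of_isProbabilityMeasure
      (S := Set.univ.pi '' Set.univ.pi fun _ : ι => {s : Set E | MeasurableSet s})
      generateFrom_pi.symm isPiSystem_pi ?_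
    rintro _ ⟨B, hB, rfl⟩
    simp only [Measure.pi_pi]
    exact Finset.measurable_fun_prod _ fun i _ => H.measurable_coe (hB i trivial)

theorem piKernel_apply (H : Kernel Y E) [IsMarkovKernel H] (y : Y) :
    piKernel ι H y = Measure.pi fun _ => H y := rfl

instance (H : Kernel Y E) [IsMarkovKernel H] : IsMarkovKernel (piKernel ι H) :=
  ⟨fun y => by rw [piKernel_apply]; infer_instance⟩

theorem HasPoissonLaplace.pi_marking [StandardBorelSpace E] [Nonempty E] {Ξ : Type*}
    [MeasurableSpace Ξ] {P : Measure Ξ}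
    [IsProbabilityMeasure P] {ν : Measure Y} [SFinite ν] {c : Ξ → ℕ → Bool × Y}
    (hc : Measurable c) {A : ι → Ξ → ℕ → E} (hA : ∀ i, Measurable (A i)) (H : Kernel Y E)
    [IsMarkovKernel H] (hν : HasPoissonLaplace ν (P.map fun ξ => seqMeasure (c ξ)))
    (hmarks : ∀ D : Set (ℕ → Bool × Y), MeasurableSet D → ∀ (F : Finset (ι × ℕ))
      (B : ι × ℕ → Set E), (∀ p, MeasurableSet (B p)) →
      P {ξ | c ξ ∈ D ∧ ∀ p ∈ F, A p.1 ξ p.2 ∈ B p}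
        = ∫⁻ ξ in c ⁻¹' D, ∏ p ∈ F, H (c ξ p.2).2 (B p) ∂P) :
    HasPoissonLaplace (ν ⊗ₘ piKernel ι H)
      (P.map fun ξ => seqMeasure fun k => ((c ξ k).1, ((c ξ k).2, fun i => A i ξ k))) := by
  obtain ⟨φ, hφ, hφH⟩ := H.exists_measurable_map_eq_unitInterval
  have key := map_marks_eq hc hA H hmarks volume φ hφ hφH
  -- The marks at one point, one for each index in `ι`, are produced together from a vector of
  -- uniform variables, so that the marking theorem applies once.
  let φ' : Y → (ι → unitInterval) → ι → E := fun y u i => φ y (u i)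
  have hφ' : Measurable (Function.uncurry φ') := measurable_pi_lambda _ fun i =>
    hφ.comp (measurable_fst.prodMk ((measurable_pi_apply i).comp measurable_snd))
  have hφ'H : ∀ y, (Measure.infinitePi fun _ : ι => (volume : Measure unitInterval)).map (φ' y)
      = piKernel ι H y := fun y => by
    have hφy : Measurable (φ y) := hφ.comp measurable_prodMk_left
    rw [Measure.infinitePi_eq_pi, piKernel_apply]
    have : IsProbabilityMeasure ((volume : Measure unitInterval).map (φ y)) := by
      rw [hφH]; infer_instance
    have h := Measure.pi_map_pi (μ := fun _ : ι => (volume : Measure unitInterval))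
      (f := fun _ => φ y) fun _ => hφy.aemeasurable
    simp only [hφH] at h
    exact h
  have hPc : IsProbabilityMeasure (P.map c) := Measure.isProbabilityMeasure_map hc.aemeasurable
  have hν' : HasPoissonLaplace ν ((P.map c).map seqMeasure) := by
    rw [Measure.map_map measurable_seqMeasure hc]; exact hν
  have h := hν'.marking (piKernel ι H) _ φ' hφ' hφ'H
  have hs : Measurable fun p : (ℕ → Bool × Y) × (ℕ → ι → E) =>
      seqMeasure fun k => ((p.1 k).1, ((p.1 k).2, p.2 k)) :=
    measurable_seqMeasure.comp (measurable_pi_lambda _ fun k => by fun_prop)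
  have hcA : Measurable fun ξ => (c ξ, fun k i => A i ξ k) :=
    hc.prodMk (measurable_pi_lambda _ fun k => measurable_pi_lambda _ fun i =>
      (measurable_pi_apply k).comp (hA i))
  have hφm : Measurable fun p : (ℕ → Bool × Y) × (ℕ → ι → unitInterval) =>
      (p.1, fun k i => φ (p.1 k).2 (p.2 k i)) :=
    measurable_fst.prodMk (measurable_pi_lambda _ fun k => measurable_pi_lambda _ fun i => by
      have h : Measurable fun p : (ℕ → Bool × Y) × (ℕ → ι → unitInterval) =>
        ((p.1 k).2, p.2 k i) := by fun_prop
      exact hφ.comp h)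
  have e : P.map (fun ξ => seqMeasure fun k => ((c ξ k).1, ((c ξ k).2, fun i => A i ξ k)))
      = (P.map fun ξ => (c ξ, fun k i => A i ξ k)).map
        fun p => seqMeasure fun k => ((p.1 k).1, ((p.1 k).2, p.2 k)) :=
    (Measure.map_map hs hcA).symm
  rw [e, key, Measure.map_map hs hφm]
  exact h

end PiKernel

/-! ### σ-finiteness of the mean measure. -/

section SigmaFinite

/-- `ν` has the finite density `1 / F` with respect to the finite measure `F ν`. -/
theorem sigmaFinite_of_lintegral_ne_top {X : Type*} [MeasurableSpace X] {ν : Measure X}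
    {F : X → ℝ≥0∞} (hF : Measurable F) (hF0 : ∀ᵐ x ∂ν, F x ≠ 0) (hFtop : ∀ᵐ x ∂ν, F x ≠ ∞)
    (hint : ∫⁻ x, F x ∂ν ≠ ∞) : SigmaFinite ν := by
  have : IsFiniteMeasure (ν.withDensity F) := isFiniteMeasure_withDensity hint
  have h := withDensity_inv_same hF hF0 hFtop
  rw [← h]
  refine SigmaFinite.withDensity_of_ne_top ?_
  have : ∀ᵐ x ∂ν, F⁻¹ x ≠ ∞ := by
    filter_upwards [hF0] with x hx using ENNReal.inv_ne_top.2 hx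
  exact (withDensity_absolutelyContinuous ν F).ae_le this

theorem sigmaFinite_compProd_of_lintegral {X S : Type*} [MeasurableSpace X] [MeasurableSpace S]
    (μ : Measure X) [SigmaFinite μ] (ρ : Kernel X S) [IsSFiniteKernel ρ] {f : S → ℝ≥0∞}
    (hf : Measurable f) (hf0 : ∀ x, ∀ᵐ s ∂(ρ x), f s ≠ 0) (hftop : ∀ s, f s ≠ ∞)
    (hint : ∀ x, ∫⁻ s, f s ∂(ρ x) < ∞) : SigmaFinite (μ ⊗ₘ ρ) := by
  obtain ⟨g, hg0, hg, hgint⟩ := exists_pos_lintegral_lt_of_sigmaFinite μ one_ne_zero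
  let h : X → ℝ≥0∞ := fun x => ∫⁻ s, f s ∂(ρ x)
  have hh : Measurable h := hf.lintegral_kernel
  have hh1 : ∀ x, 1 + h x ≠ ∞ := fun x => ENNReal.add_ne_top.2 ⟨ENNReal.one_ne_top, (hint x).ne⟩
  -- A positive integrable weight: `g` handles `μ`, and the factor `1 / (1 + h)` makes the inner
  -- integral at most `g`. Adding `1` avoids division by zero.
  have hF : Measurable fun p : X × S => (g p.1 : ℝ≥0∞) * (1 + h p.1)⁻¹ * f p.2 := by fun_prop
  refine sigmaFinite_of_lintegral_ne_top hF ?_ (ae_of_all _ fun p => ?_) ?_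
  · refine Measure.ae_compProd_of_ae_ae ((measurableSet_eq_fun hF measurable_const).compl)
      (ae_of_all _ fun x => ?_)
    filter_upwards [hf0 x] with s hs
    refine mul_ne_zero (mul_ne_zero ?_ (ENNReal.inv_ne_zero.2 (hh1 x))) hs
    simpa using (hg0 x).ne'
  · exact ENNReal.mul_ne_top (ENNReal.mul_ne_top ENNReal.coe_ne_top
      (ENNReal.inv_ne_top.2 (by simp))) (hftop _)
  · rw [Measure.lintegral_compProd hF]
    have : ∀ x, ∫⁻ s, (g x : ℝ≥0∞) * (1 + h x)⁻¹ * f s ∂(ρ x) ≤ g x := fun x => by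
      rw [lintegral_const_mul _ hf, mul_assoc]
      refine mul_le_of_le_one_right' ?_
      change (1 + h x)⁻¹ * h x ≤ 1
      rw [mul_comm, ← div_eq_mul_inv]
      exact ENNReal.div_le_of_le_mul (by simp)
    exact ((lintegral_mono this).trans_lt (hgint.trans ENNReal.one_lt_top)).ne

end SigmaFinite

/-! ### Splitting the mean measure into unseen and observed points. -/

section JumpLaw

variable {Ω : Type*} [MeasurableSpace Ω] {q υ M : ℕ}
  {G : Kernel (Fin q → ℝ≥0) (Fin υ → ℝ)} [IsMarkovKernel G]

theorem measurable_zeroMass (G : Kernel (Fin q → ℝ≥0) (Fin υ → ℝ)) : Measurable (zeroMass G) :=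
  G.measurable_coe (measurableSet_singleton 0)

theorem zeroMass_le_one (s : Fin q → ℝ≥0) : zeroMass G s ≤ 1 := prob_le_one

theorem isFiniteMeasure_hMeasure {s : Fin q → ℝ≥0} (hs : 0 < G s {0}) :
    IsFiniteMeasure (hMeasure G s) := by
  have := Measure.smul_finite ((G s).restrict {0}ᶜ) (ENNReal.inv_ne_top.2 hs.ne')
  unfold hMeasure zeroMass
  infer_instance

theorem zeroMass_mul_hMeasure {s : Fin q → ℝ≥0} (hs : 0 < G s {0}) {B : Set (Fin υ → ℝ)}
    (hB : MeasurableSet B) : zeroMass G s * hMeasure G s B = G s B := by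
  have hz : zeroMass G s * (zeroMass G s)⁻¹ = 1 :=
    ENNReal.mul_inv_cancel hs.ne' (measure_ne_top _ _)
  rw [hMeasure, Measure.add_apply, Measure.smul_apply, smul_eq_mul, mul_add, ← mul_assoc, hz,
    one_mul, Measure.restrict_apply hB,
    Measure.dirac_apply' _ hB, ← measure_inter_add_sdiff B (measurableSet_singleton 0),
    Set.sdiff_eq]
  congr 1
  by_cases h : (0 : Fin υ → ℝ) ∈ B
  · rw [Set.indicator_of_mem h, Set.inter_eq_right.2 (Set.singleton_subset_iff.2 h)]
    simp [zeroMass]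
  · rw [Set.indicator_of_notMem h, Set.inter_singleton_eq_empty.2 h]
    simp

/-- One factor `1 - π(s)` for each mark cancels the denominator on `a ≠ 0` and restores the atom at
`0`. The unnormalized jump measure is thus just the law of `M` independent marks. -/
theorem zeroMass_pow_smul_pi_hMeasure {s : Fin q → ℝ≥0} (hs : 0 < G s {0}) :
    zeroMass G s ^ M • (Measure.pi fun _ : Fin M => hMeasure G s) = piKernel (Fin M) G s := by
  have := isFiniteMeasure_hMeasure hs
  refine (Measure.pi_eq fun B hB => ?_).symm
  rw [Measure.smul_apply, Measure.pi_pi, smul_eq_mul]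
  simp_rw [← zeroMass_mul_hMeasure hs (hB _)]
  rw [Finset.prod_mul_distrib]
  simp

theorem measurableSet_ne_zero : MeasurableSet {a : Fin M → Fin υ → ℝ | a ≠ 0} :=
  (measurableSet_singleton 0).compl

/-- The mean measure of the points `((ω, a), s)`. -/
def jointIntensity (B₀ : Measure Ω) (ρ : Kernel Ω (Fin q → ℝ≥0))
    (G : Kernel (Fin q → ℝ≥0) (Fin υ → ℝ)) [IsMarkovKernel G] (M : ℕ) :
    Measure ((Ω × (Fin M → Fin υ → ℝ)) × (Fin q → ℝ≥0)) :=
  ((B₀ ⊗ₘ ρ) ⊗ₘ (piKernel (Fin M) G).prodMkLeft Ω).map fun x => ((x.1.1, x.2), x.1.2)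

variable {B₀ : Measure Ω} {ρ : Kernel Ω (Fin q → ℝ≥0)} [SFinite B₀] [IsSFiniteKernel ρ]

theorem lintegral_jointIntensity {f : (Ω × (Fin M → Fin υ → ℝ)) × (Fin q → ℝ≥0) → ℝ≥0∞}
    (hf : Measurable f) : ∫⁻ x, f x ∂(jointIntensity B₀ ρ G M)
      = ∫⁻ ω, ∫⁻ s, ∫⁻ a, f ((ω, a), s) ∂(piKernel (Fin M) G s) ∂(ρ ω) ∂B₀ := by
  rw [jointIntensity, lintegral_map hf (by fun_prop), Measure.lintegral_compProd (by fun_prop),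
    Measure.lintegral_compProd]
  · rfl
  · exact Measurable.lintegral_kernel_prod_right' (κ := (piKernel (Fin M) G).prodMkLeft Ω)
      (f := fun x => f ((x.1.1, x.2), x.1.2)) (by fun_prop)

/-- The mean measure of the points `((ω, a), s)` with `a ≠ 0`. -/
def nonzeroIntensity (B₀ : Measure Ω) (ρ : Kernel Ω (Fin q → ℝ≥0))
    (G : Kernel (Fin q → ℝ≥0) (Fin υ → ℝ)) [IsMarkovKernel G] (M : ℕ) :
    Measure ((Ω × (Fin M → Fin υ → ℝ)) × (Fin q → ℝ≥0)) :=
  (jointIntensity B₀ ρ G M).restrict {x | x.1.2 ≠ 0}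

theorem lintegral_nonzeroIntensity {f : (Ω × (Fin M → Fin υ → ℝ)) × (Fin q → ℝ≥0) → ℝ≥0∞}
    (hf : Measurable f) : ∫⁻ x, f x ∂(nonzeroIntensity B₀ ρ G M)
      = ∫⁻ ω, ∫⁻ s, ∫⁻ a in {a | a ≠ 0}, f ((ω, a), s) ∂(piKernel (Fin M) G s) ∂(ρ ω) ∂B₀ := by
  rw [nonzeroIntensity, ← lintegral_indicator measurableSet_value_ne_zero,
    lintegral_jointIntensity (hf.indicator measurableSet_value_ne_zero)]
  refine lintegral_congr fun ω => lintegral_congr fun s => ?_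
  rw [← lintegral_indicator measurableSet_ne_zero]
  rfl

/-- A union bound: some mark must be nonzero. -/
theorem piKernel_ne_zero_le (s : Fin q → ℝ≥0) :
    piKernel (Fin M) G s {a | a ≠ 0} ≤ M * G s {0}ᶜ := by
  have h : {a : Fin M → Fin υ → ℝ | a ≠ 0} ⊆ ⋃ i ∈ Finset.univ, Function.eval i ⁻¹' {0}ᶜ := by
    intro a ha
    by_contra hn
    simp only [Finset.mem_univ, Set.iUnion_true, Set.mem_iUnion, not_exists] at hn
    exact ha (funext fun i => by simpa using hn i)
  refine (measure_mono h).trans ((measure_biUnion_finset_le _ _).trans ?_)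
  have : ∀ i : Fin M, piKernel (Fin M) G s (Function.eval i ⁻¹' {0}ᶜ) = G s {0}ᶜ := fun i =>
    (measurePreserving_eval (fun _ : Fin M => G s) i).measure_preimage
      (measurableSet_singleton 0).compl.nullMeasurableSet
  simp only [this, Finset.sum_const, Finset.card_univ, Fintype.card_fin, nsmul_eq_mul, le_refl]

theorem isFiniteMeasure_nonzeroIntensity (hG_fin : ∫⁻ x, G x.2 {0}ᶜ ∂(B₀ ⊗ₘ ρ) < ∞) :
    IsFiniteMeasure (nonzeroIntensity B₀ ρ G M) := by
  have hGm : Measurable fun s => G s {0}ᶜ := G.measurable_coe (measurableSet_singleton 0).compl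
  refine ⟨?_⟩
  rw [← lintegral_one, lintegral_nonzeroIntensity measurable_const]
  have hGm' : Measurable fun x : Ω × (Fin q → ℝ≥0) => G x.2 {0}ᶜ := hGm.comp measurable_snd
  rw [Measure.lintegral_compProd hGm'] at hG_fin
  refine lt_of_le_of_lt (lintegral_mono fun ω => lintegral_mono fun s => ?_)
    (b := ∫⁻ ω, ∫⁻ s, M * G s {0}ᶜ ∂(ρ ω) ∂B₀) ?_
  · rw [lintegral_one, Measure.restrict_apply_univ]
    exact piKernel_ne_zero_le s
  · simp_rw [lintegral_const_mul _ hGm]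
    rw [lintegral_const_mul _ hGm.lintegral_kernel]
    exact ENNReal.mul_lt_top (ENNReal.natCast_lt_top M) hG_fin

theorem nonzeroIntensity_fst_diffuse [NullSingletonClass B₀] [MeasurableSingletonClass Ω] (ω : Ω) :
    (nonzeroIntensity B₀ ρ G M).fst {y | y.1 = ω} = 0 := by
  have hset : MeasurableSet {x : (Ω × (Fin M → Fin υ → ℝ)) × (Fin q → ℝ≥0) | x.1.1 = ω} :=
    (measurable_fst.comp measurable_fst) (measurableSet_singleton ω)
  refine (Measure.fst_apply (measurable_fst (measurableSet_singleton ω))).trans ?_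
  change nonzeroIntensity B₀ ρ G M {x | x.1.1 = ω} = 0
  rw [← lintegral_indicator_one hset,
    lintegral_nonzeroIntensity (measurable_one.indicator hset)]
  have h0 : B₀ {ω} = 0 := measure_singleton ω
  have : ∀ᵐ ω' ∂B₀, ω' ≠ ω := by
    rw [ae_iff]; simp [h0]
  rw [lintegral_eq_zero_of_ae_eq_zero]
  filter_upwards [this] with ω' h'
  simp [Set.indicator, h']

omit [SFinite B₀] [IsSFiniteKernel ρ] in
theorem nonzeroIntensity_fst_zero :
    (nonzeroIntensity B₀ ρ G M).fst {y | y.2 = 0} = 0 := by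
  have h : MeasurableSet {y : Ω × (Fin M → Fin υ → ℝ) | y.2 = 0} :=
    measurable_snd (measurableSet_singleton 0)
  rw [Measure.fst_apply h, nonzeroIntensity, Measure.restrict_apply (measurable_fst h)]
  convert measure_empty (μ := jointIntensity B₀ ρ G M)
  ext x
  simp

/-- Independence of the marks gives `a = 0` the probability `(1 - π(s))^M`, the density of
`updatedIntensity`. -/
theorem jointIntensity_eq :
    jointIntensity B₀ ρ G M
      = (updatedIntensity B₀ ρ G M).map zeroValue + nonzeroIntensity B₀ ρ G M := by
  have hE := measurableSet_value_ne_zero (Ω := Ω) (T := Fin q → ℝ≥0) (M := M) (υ := υ)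
  have hzm := measurable_zeroMass G
  have hz : Measurable fun x : Ω × (Fin q → ℝ≥0) => zeroMass G x.2 ^ M := by fun_prop
  rw [← Measure.restrict_add_restrict_compl (μ := jointIntensity B₀ ρ G M) hE, add_comm]
  refine congrArg₂ _ ?_ rfl
  refine Measure.ext_of_lintegral _ fun f hf => ?_
  have hfz : Measurable fun x : Ω × (Fin q → ℝ≥0) =>
    f ((zeroValue x : (Ω × (Fin M → Fin υ → ℝ)) × (Fin q → ℝ≥0))) := hf.comp measurable_zeroValue
  rw [← lintegral_indicator hE.compl, lintegral_jointIntensity (hf.indicator hE.compl),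
    lintegral_map hf measurable_zeroValue, updatedIntensity,
    lintegral_withDensity_eq_lintegral_mul _ hz hfz, Measure.lintegral_compProd (hz.mul hfz)]
  refine lintegral_congr fun ω => lintegral_congr fun s => ?_
  have : ∀ a : Fin M → Fin υ → ℝ, {x : (Ω × (Fin M → Fin υ → ℝ)) × (Fin q → ℝ≥0) |
      x.1.2 ≠ 0}ᶜ.indicator f ((ω, a), s)
      = ({0} : Set (Fin M → Fin υ → ℝ)).indicator (fun _ => f ((ω, 0), s)) a := fun a => by
    classical
    by_cases h : a = 0 <;> simp [Set.indicator, h]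
  simp_rw [this]
  rw [lintegral_indicator_const (measurableSet_singleton 0), piKernel_apply,
    ← Set.univ_pi_singleton, Measure.pi_pi, mul_comm]
  simp [zeroMass, zeroValue]

variable {κ : Kernel (Ω × (Fin M → Fin υ → ℝ)) (Fin q → ℝ≥0)} [IsMarkovKernel κ]

/-- The two sides of the definition are the masses of `D ×ˢ C` under the two measures, and
rectangles determine finite measures on a product. -/
theorem isJumpLaw_iff (hG_zero : ∀ s, 0 < G s {0})
    (hG_fin : ∫⁻ x, G x.2 {0}ᶜ ∂(B₀ ⊗ₘ ρ) < ∞) :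
    IsJumpLaw B₀ ρ G κ ↔
      nonzeroIntensity B₀ ρ G M = (nonzeroIntensity B₀ ρ G M).fst ⊗ₘ κ := by
  have := isFiniteMeasure_nonzeroIntensity (M := M) hG_fin
  rw [Measure.ext_prod_iff, IsJumpLaw]
  refine forall_congr' fun D => forall_congr' fun C => forall_congr' fun hD =>
    forall_congr' fun hC => ?_
  have hset : ∀ ω, MeasurableSet {a : Fin M → Fin υ → ℝ | a ≠ 0 ∧ (ω, a) ∈ D} := fun ω =>
    measurableSet_ne_zero.inter (measurable_prodMk_left hD)
  have hκm : Measurable fun x : (Ω × (Fin M → Fin υ → ℝ)) × (Fin q → ℝ≥0) =>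
      D.indicator (fun y => κ y C) x.1 :=
    ((κ.measurable_coe hC).indicator hD).comp measurable_fst
  refine Eq.congr ?_ ?_
  · have hDC := hD.prod hC
    rw [← lintegral_indicator_one hDC, lintegral_nonzeroIntensity (measurable_one.indicator hDC)]
    refine lintegral_congr fun ω => ?_
    rw [← lintegral_indicator hC]
    refine lintegral_congr fun s => ?_
    by_cases hs : s ∈ C
    · rw [Set.indicator_of_mem hs, ← smul_eq_mul, ← Measure.smul_apply,
        zeroMass_pow_smul_pi_hMeasure (hG_zero s), ← lintegral_indicator
          measurableSet_ne_zero, ← lintegral_indicator_one (hset ω)]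
      refine lintegral_congr fun a => ?_
      classical
      simp [Set.indicator, hs, ite_and]
    · rw [Set.indicator_of_notMem hs]
      simp [Set.indicator, hs]
  · rw [Measure.compProd_apply_prod hD hC, ← lintegral_indicator hD, Measure.fst,
      lintegral_map ((κ.measurable_coe hC).indicator hD) measurable_fst,
      lintegral_nonzeroIntensity hκm]
    refine lintegral_congr fun ω => lintegral_congr fun s => ?_
    rw [← smul_eq_mul, ← lintegral_smul_measure, ← Measure.restrict_smul,
      zeroMass_pow_smul_pi_hMeasure (hG_zero s), ← lintegral_indicator (hset ω),
      ← lintegral_indicator measurableSet_ne_zero]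
    refine lintegral_congr fun a => ?_
    classical
    simp [Set.indicator, ite_and]

theorem exists_isJumpLaw [Nonempty (Fin q → ℝ≥0)] (hG_zero : ∀ s, 0 < G s {0})
    (hG_fin : ∫⁻ x, G x.2 {0}ᶜ ∂(B₀ ⊗ₘ ρ) < ∞) :
    ∃ κ : Kernel (Ω × (Fin M → Fin υ → ℝ)) (Fin q → ℝ≥0), IsMarkovKernel κ ∧
      IsJumpLaw B₀ ρ G κ := by
  have := isFiniteMeasure_nonzeroIntensity (M := M) hG_fin
  refine ⟨(nonzeroIntensity B₀ ρ G M).condKernel, inferInstance, ?_⟩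
  rw [isJumpLaw_iff hG_zero hG_fin]
  exact ((nonzeroIntensity B₀ ρ G M).disintegrate _).symm

end JumpLaw

/-! ### Bayes' formula for the jumps. -/

section Density

theorem lintegral_pi_prod {E : Type*} [MeasurableSpace E] (μ : Measure E) [SigmaFinite μ] :
    ∀ {n : ℕ} {f : Fin n → E → ℝ≥0∞}, (∀ i, Measurable (f i)) →
      ∫⁻ a, ∏ i, f i (a i) ∂(Measure.pi fun _ : Fin n => μ) = ∏ i, ∫⁻ x, f i x ∂μ
  | 0, f, _ => by simp
  | n + 1, f, hf => by
    have h := (measurePreserving_piFinSuccAbove (fun _ : Fin (n + 1) => μ) 0).symm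
    rw [← h.lintegral_comp (f := fun a => ∏ i, f i (a i))
      (Finset.measurable_fun_prod _ fun i _ => (hf i).comp (measurable_pi_apply i)),
      Fin.prod_univ_succ, ← lintegral_pi_prod μ (f := fun i => f i.succ) fun i => hf i.succ,
      ← lintegral_prod_mul (hf 0).aemeasurable
        (Finset.measurable_fun_prod _ fun i _ => (hf i.succ).comp (measurable_pi_apply i)).aemeasurable]
    refine lintegral_congr fun p => ?_
    simp [Fin.prod_univ_succ, MeasurableEquiv.piFinSuccAbove, Fin.insertNthEquiv]

theorem pi_withDensity_prod {E : Type*} [MeasurableSpace E] (μ : Measure E) [SigmaFinite μ] (n : ℕ)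
    {f : E → ℝ≥0∞} (hf : Measurable f) [SigmaFinite (μ.withDensity f)] :
    (Measure.pi fun _ : Fin n => μ.withDensity f)
      = (Measure.pi fun _ : Fin n => μ).withDensity fun a => ∏ i, f (a i) := by
  refine Measure.pi_eq fun B hB => ?_
  have hBm := MeasurableSet.univ_pi hB
  rw [withDensity_apply _ hBm, ← lintegral_indicator hBm]
  simp_rw [withDensity_apply _ (hB _), ← lintegral_indicator (hB _)]
  rw [← lintegral_pi_prod μ fun i => hf.indicator (hB i)]
  refine lintegral_congr fun a => ?_
  classical
  by_cases h : a ∈ Set.univ.pi B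
  · rw [Set.indicator_of_mem h]
    exact Finset.prod_congr rfl fun i _ => (Set.indicator_of_mem (h i trivial) _).symm
  · rw [Set.indicator_of_notMem h]
    obtain ⟨i, hi⟩ := not_forall.1 fun h' => h fun i _ => h' i
    exact (Finset.prod_eq_zero (Finset.mem_univ i) (Set.indicator_of_notMem hi _)).symm

/-- Two families of finite measures that agree almost everywhere on each set agree almost
everywhere. -/
theorem ae_eq_of_forall_ae_apply_eq {X S : Type*} [MeasurableSpace X] [MeasurableSpace S]
    [MeasurableSpace.CountablyGenerated S] {μ : Measure X} {κ η : X → Measure S}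
    (hfin : ∀ᵐ x ∂μ, κ x Set.univ ≠ ∞)
    (h : ∀ C, MeasurableSet C → ∀ᵐ x ∂μ, κ x C = η x C) : ∀ᵐ x ∂μ, κ x = η x := by
  let 𝒮 := generateSetAlgebra (MeasurableSpace.countableGeneratingSet S)
  have hcount : 𝒮.Countable :=
    countable_generateSetAlgebra (MeasurableSpace.countable_countableGeneratingSet)
  have hgen : ‹MeasurableSpace S› = MeasurableSpace.generateFrom 𝒮 := by
    rw [generateFrom_generateSetAlgebra_eq, MeasurableSpace.generateFrom_countableGeneratingSet]
  have halg : IsSetAlgebra 𝒮 := isSetAlgebra_generateSetAlgebra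
  have hm : ∀ s ∈ 𝒮, MeasurableSet s := fun s hs => by
    rw [hgen]; exact MeasurableSpace.measurableSet_generateFrom hs
  have hall : ∀ᵐ x ∂μ, ∀ s ∈ 𝒮, κ x s = η x s :=
    (ae_ball_iff hcount).2 fun s hs => h s (hm s hs)
  filter_upwards [hall, hfin] with x hx hx'
  have : IsFiniteMeasure (κ x) := ⟨hx'.lt_top⟩
  exact ext_of_generate_finite 𝒮 hgen (fun s hs t ht _ => halg.inter_mem hs ht)
    (fun s hs => hx s hs) (hx _ halg.univ_mem)

variable {Ω : Type*} [MeasurableSpace Ω] {q υ M : ℕ}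
  {G : Kernel (Fin q → ℝ≥0) (Fin υ → ℝ)} [IsMarkovKernel G]

open Classical in
/-- The density of `G(· | s)` with respect to the sum of a unit mass at `0` and a measure `lam` on
the complement of `0`, when `G(· | s)` has the density `g s` with respect to `lam` there. -/
def zeroDensity (G : Kernel (Fin q → ℝ≥0) (Fin υ → ℝ)) (g : (Fin q → ℝ≥0) → (Fin υ → ℝ) → ℝ≥0∞)
    (s : Fin q → ℝ≥0) (a : Fin υ → ℝ) : ℝ≥0∞ := if a = 0 then zeroMass G s else g s a

variable {g : (Fin q → ℝ≥0) → (Fin υ → ℝ) → ℝ≥0∞}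

omit [IsMarkovKernel G] in
theorem measurable_zeroDensity (hg : Measurable (Function.uncurry g)) :
    Measurable (Function.uncurry (zeroDensity G g)) := by
  have h : MeasurableSet {p : (Fin q → ℝ≥0) × (Fin υ → ℝ) | p.2 = 0} :=
    measurable_snd (measurableSet_singleton 0)
  exact Measurable.ite h ((measurable_zeroMass G).comp measurable_fst) hg

/-- Each mark takes one of the `M` factors `1 - π(s)`: it cancels the denominator for a nonzero mark
and is the mass of the atom for a zero mark. -/
theorem jumpDensity_eq_prod (hG_zero : ∀ s, 0 < G s {0}) (a : Fin M → Fin υ → ℝ)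
    (s : Fin q → ℝ≥0) : jumpDensity G g a s = ∏ i, zeroDensity G g s (a i) := by
  classical
  have h : zeroMass G s ^ M = ∏ _i : Fin M, zeroMass G s := by simp
  rw [jumpDensity, h, ← Finset.prod_mul_distrib]
  refine Finset.prod_congr rfl fun i _ => ?_
  by_cases ha : a i = 0
  · simp [zeroDensity, ha]
  · simp only [zeroDensity, ha, if_false]
    exact ENNReal.mul_div_cancel (hG_zero s).ne' (measure_ne_top _ _)

theorem measurable_jumpDensity (hG_zero : ∀ s, 0 < G s {0})
    (hg : Measurable (Function.uncurry g)) :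
    Measurable fun p : (Fin M → Fin υ → ℝ) × (Fin q → ℝ≥0) => jumpDensity G g p.1 p.2 := by
  simp_rw [jumpDensity_eq_prod hG_zero]
  refine Finset.measurable_fun_prod _ fun i _ => ?_
  have h : Measurable fun p : (Fin M → Fin υ → ℝ) × (Fin q → ℝ≥0) => (p.2, p.1 i) := by fun_prop
  exact (measurable_zeroDensity hg).comp h

variable {lam : Measure (Fin υ → ℝ)}

omit [IsMarkovKernel G] in
theorem eq_withDensity_zeroDensity (hg : Measurable (Function.uncurry g)) (s : Fin q → ℝ≥0)
    (hGg : (G s).restrict {0}ᶜ = (lam.restrict {0}ᶜ).withDensity (g s)) :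
    G s = (Measure.dirac 0 + lam.restrict {0}ᶜ).withDensity (zeroDensity G g s) := by
  have hz : Measurable (zeroDensity G g s) := (measurable_zeroDensity hg).comp measurable_prodMk_left
  have h0 := measurableSet_singleton (0 : Fin υ → ℝ)
  rw [withDensity_add_measure, ← Measure.restrict_add_restrict_compl (μ := G s) h0, hGg,
    Measure.restrict_singleton]
  congr 1
  · ext B hB
    rw [withDensity_apply _ hB, ← lintegral_indicator hB, lintegral_dirac' _ (hz.indicator hB),
      Measure.smul_apply, Measure.dirac_apply' _ hB]
    classical
    simp [Set.indicator, zeroDensity, zeroMass]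
  · refine withDensity_congr_ae ?_
    filter_upwards [ae_restrict_mem h0.compl] with a ha
    exact (if_neg (by simpa using ha)).symm

theorem piKernel_eq_withDensity [SigmaFinite lam] (hG_zero : ∀ s, 0 < G s {0})
    (hg : Measurable (Function.uncurry g)) (s : Fin q → ℝ≥0)
    (hGg : (G s).restrict {0}ᶜ = (lam.restrict {0}ᶜ).withDensity (g s)) :
    piKernel (Fin M) G s = (Measure.pi fun _ : Fin M => Measure.dirac 0 + lam.restrict {0}ᶜ).withDensity
      fun a => jumpDensity G g a s := by
  have hz : Measurable (zeroDensity G g s) := (measurable_zeroDensity hg).comp measurable_prodMk_left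
  have h := eq_withDensity_zeroDensity hg s hGg
  have : SigmaFinite ((Measure.dirac 0 + lam.restrict {0}ᶜ).withDensity (zeroDensity G g s)) := by
    rw [← h]; infer_instance
  simp_rw [jumpDensity_eq_prod hG_zero]
  rw [← pi_withDensity_prod _ _ hz, ← h, piKernel_apply]

variable {B₀ : Measure Ω} {ρ : Kernel Ω (Fin q → ℝ≥0)} [SigmaFinite B₀] [IsSFiniteKernel ρ]
  {κ : Kernel (Ω × (Fin M → Fin υ → ℝ)) (Fin q → ℝ≥0)} [IsMarkovKernel κ]

theorem lintegral_nonzeroIntensity_of_density {lam : Measure (Fin M → Fin υ → ℝ)} [SFinite lam]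
    {J : (Fin M → Fin υ → ℝ) × (Fin q → ℝ≥0) → ℝ≥0∞} (hJ : Measurable J)
    (hGJ : ∀ s, piKernel (Fin M) G s = lam.withDensity fun a => J (a, s))
    {f : (Ω × (Fin M → Fin υ → ℝ)) × (Fin q → ℝ≥0) → ℝ≥0∞} (hf : Measurable f) :
    ∫⁻ x, f x ∂(nonzeroIntensity B₀ ρ G M)
      = ∫⁻ y in {y | y.2 ≠ 0}, ∫⁻ s, J (y.2, s) * f (y, s) ∂(ρ y.1) ∂(B₀.prod lam) := by
  have hset : MeasurableSet {y : Ω × (Fin M → Fin υ → ℝ) | y.2 ≠ 0} :=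
    measurable_snd measurableSet_ne_zero
  have hF : Measurable fun x : (Ω × (Fin M → Fin υ → ℝ)) × (Fin q → ℝ≥0) =>
      J (x.1.2, x.2) * f x := by fun_prop
  have hI : Measurable fun y : Ω × (Fin M → Fin υ → ℝ) =>
      ∫⁻ s, J (y.2, s) * f (y, s) ∂(ρ y.1) :=
    Measurable.lintegral_kernel_prod_right' (κ := ρ.prodMkRight (Fin M → Fin υ → ℝ)) hF
  rw [lintegral_nonzeroIntensity hf, ← lintegral_indicator hset,
    lintegral_prod _ (hI.indicator hset).aemeasurable]
  refine lintegral_congr fun ω => ?_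
  have h1 : Measurable fun p : (Fin q → ℝ≥0) × (Fin M → Fin υ → ℝ) =>
      J (p.2, p.1) * f ((ω, p.2), p.1) := by fun_prop
  have hω := h1.indicator (measurable_snd (measurableSet_ne_zero (M := M) (υ := υ)))
  calc _ = ∫⁻ s, ∫⁻ a, (Prod.snd ⁻¹' {a : Fin M → Fin υ → ℝ | a ≠ 0}).indicator
        (fun p : (Fin q → ℝ≥0) × (Fin M → Fin υ → ℝ) => J (p.2, p.1) * f ((ω, p.2), p.1)) (s, a)
          ∂lam ∂(ρ ω) := by
        refine lintegral_congr fun s => ?_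
        have hJs : Measurable fun a => J (a, s) := by fun_prop
        have hfs : Measurable fun a => f ((ω, a), s) := by fun_prop
        rw [hGJ s, setLIntegral_withDensity_eq_setLIntegral_mul _ hJs hfs measurableSet_ne_zero,
          ← lintegral_indicator measurableSet_ne_zero]
        rfl
    _ = _ := by
        refine (lintegral_lintegral_swap (f := fun s a =>
          (Prod.snd ⁻¹' {a : Fin M → Fin υ → ℝ | a ≠ 0}).indicator
            (fun p : (Fin q → ℝ≥0) × (Fin M → Fin υ → ℝ) => J (p.2, p.1) * f ((ω, p.2), p.1))
            (s, a)) hω.aemeasurable).trans ?_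
        refine lintegral_congr fun a => ?_
        classical
        by_cases ha : a = 0 <;> simp [Set.indicator, ha]

/-- Let `I C y` be the integral of `J` over `C` against `ρ`. The marginal in `(ω, a)` has density `I
univ` with respect to `base`, and computing the mass of `D ×ˢ C` in two ways gives `I univ * κ C = I
C` almost everywhere. As the σ-algebra of jumps is countably generated, one null set serves for all
`C`, and division by `I univ` is possible almost everywhere for the marginal. -/
theorem ae_jumpLaw_eq_of_density {lam : Measure (Fin M → Fin υ → ℝ)} [SFinite lam]
    {J : (Fin M → Fin υ → ℝ) × (Fin q → ℝ≥0) → ℝ≥0∞} (hJ : Measurable J)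
    (hGJ : ∀ s, piKernel (Fin M) G s = lam.withDensity fun a => J (a, s))
    (hG_fin : ∫⁻ x, G x.2 {0}ᶜ ∂(B₀ ⊗ₘ ρ) < ∞)
    (hκ : nonzeroIntensity B₀ ρ G M = (nonzeroIntensity B₀ ρ G M).fst ⊗ₘ κ) :
    ∀ᵐ y ∂(nonzeroIntensity B₀ ρ G M).fst,
      κ y = (∫⁻ s, J (y.2, s) ∂(ρ y.1))⁻¹ • (ρ y.1).withDensity fun s => J (y.2, s) := by
  have := isFiniteMeasure_nonzeroIntensity (M := M) hG_fin
  set base := (B₀.prod lam).restrict {y | y.2 ≠ 0} with hbase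
  have hlint := fun f hf => lintegral_nonzeroIntensity_of_density (B₀ := B₀) (ρ := ρ) hJ hGJ
    (f := f) hf
  rw [← hbase] at hlint
  let I : Set (Fin q → ℝ≥0) → Ω × (Fin M → Fin υ → ℝ) → ℝ≥0∞ := fun C y =>
    ∫⁻ s, J (y.2, s) * C.indicator 1 s ∂(ρ y.1)
  have hIeq : ∀ C, MeasurableSet C → ∀ y, I C y
      = (ρ y.1).withDensity (fun s => J (y.2, s)) C := fun C hC y => by
    rw [withDensity_apply _ hC, ← lintegral_indicator hC]
    refine lintegral_congr fun s => ?_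
    classical
    simp [Set.indicator]
  have hIm : ∀ C, MeasurableSet C → Measurable (I C) := fun C hC => by
    have hCm : Measurable (C.indicator (1 : (Fin q → ℝ≥0) → ℝ≥0∞)) := measurable_one.indicator hC
    have h : Measurable fun x : (Ω × (Fin M → Fin υ → ℝ)) × (Fin q → ℝ≥0) =>
        J (x.1.2, x.2) * C.indicator 1 x.2 := by fun_prop
    exact Measurable.lintegral_kernel_prod_right' (κ := ρ.prodMkRight (Fin M → Fin υ → ℝ)) h
  have hI1 : ∀ y, I Set.univ y = ∫⁻ s, J (y.2, s) ∂(ρ y.1) := fun y => by simp [I]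
  have hm : (nonzeroIntensity B₀ ρ G M).fst = base.withDensity (I Set.univ) := by
    refine Measure.ext_of_lintegral _ fun f hf => ?_
    have hf' : Measurable fun x : (Ω × (Fin M → Fin υ → ℝ)) × (Fin q → ℝ≥0) => f x.1 := by
      fun_prop
    rw [Measure.fst, lintegral_map hf measurable_fst, hlint _ hf',
      lintegral_withDensity_eq_lintegral_mul _ (hIm _ .univ) hf]
    refine lintegral_congr fun y => ?_
    have hJy : Measurable fun s => J (y.2, s) := by fun_prop
    rw [Pi.mul_apply, hI1]
    exact lintegral_mul_const (f y) hJy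
  have hIfin : ∫⁻ y, I Set.univ y ∂base ≠ ∞ := by
    rw [← setLIntegral_univ, ← withDensity_apply _ .univ, ← hm]
    exact measure_ne_top _ _
  have hkey : ∀ C, MeasurableSet C → ∀ᵐ y ∂base, (I Set.univ y • κ y) C
      = (ρ y.1).withDensity (fun s => J (y.2, s)) C := fun C hC => by
    have hκC := κ.measurable_coe hC
    have hle : ∀ y, I Set.univ y * κ y C ≤ I Set.univ y := fun y =>
      mul_le_of_le_one_right' prob_le_one
    have hle' : ∀ y, I C y ≤ I Set.univ y := fun y => by
      rw [hIeq C hC, hIeq _ .univ]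
      exact measure_mono (Set.subset_univ C)
    simp_rw [← hIeq C hC]
    -- Both functions are dominated by `I univ`, whose integral is finite.
    refine AEMeasurable.ae_eq_of_forall_setLIntegral_eq
      ((hIm _ .univ).mul hκC).aemeasurable (hIm C hC).aemeasurable
      ((lintegral_mono hle).trans_lt hIfin.lt_top).ne
      ((lintegral_mono hle').trans_lt hIfin.lt_top).ne fun D hD _ => ?_
    have h1 : (nonzeroIntensity B₀ ρ G M) (D ×ˢ C) = ∫⁻ y in D, I Set.univ y * κ y C ∂base := by
      rw [hκ, Measure.compProd_apply_prod hD hC, hm,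
        setLIntegral_withDensity_eq_setLIntegral_mul _ (hIm _ .univ) hκC hD]
      rfl
    have h2 : (nonzeroIntensity B₀ ρ G M) (D ×ˢ C) = ∫⁻ y in D, I C y ∂base := by
      rw [← lintegral_indicator_one (hD.prod hC), hlint _ (measurable_one.indicator (hD.prod hC)),
        ← lintegral_indicator hD]
      refine lintegral_congr fun y => ?_
      classical
      by_cases hy : y ∈ D
      · rw [Set.indicator_of_mem hy]
        refine lintegral_congr fun s => ?_
        simp [Set.indicator, hy]
      · rw [Set.indicator_of_notMem hy]
        simp [Set.indicator, hy]
    exact h1.symm.trans h2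
  have hfin : ∀ᵐ y ∂base, I Set.univ y < ∞ := ae_lt_top (hIm _ .univ) hIfin
  have hall : ∀ᵐ y ∂base, I Set.univ y • κ y = (ρ y.1).withDensity fun s => J (y.2, s) := by
    refine ae_eq_of_forall_ae_apply_eq ?_ hkey
    filter_upwards [hfin] with y hy
    rw [Measure.smul_apply, measure_univ, smul_eq_mul, mul_one]
    exact hy.ne
  -- The marginal does not charge the set where the normalizing integral vanishes.
  rw [hm, ae_withDensity_iff (hIm _ .univ)]
  filter_upwards [hall, hfin] with y hy hy' hy0
  rw [← hI1, ← hy, smul_smul, ENNReal.inv_mul_cancel hy0 hy'.ne, one_smul]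

end Density

/-! ### The marked points of the Indian buffet model. -/

section Model

variable {Ω Ξ : Type*} [MeasurableSpace Ω] [MeasurableSpace Ξ] {q υ M : ℕ}
  {G : Kernel (Fin q → ℝ≥0) (Fin υ → ℝ)} [IsMarkovKernel G]

theorem IsIBPModel.hasPoissonLaplace {ι : Type*} [Fintype ι] {P : Measure Ξ}
    [IsProbabilityMeasure P] {ν : Measure (Ω × (Fin q → ℝ≥0))} [SigmaFinite ν]
    {c : Ξ → Config Ω q} {A : ι → Ξ → ℕ → Fin υ → ℝ} (h : IsIBPModel P ν G c A) :
    HasPoissonLaplace (ν ⊗ₘ (piKernel ι G).prodMkLeft Ω)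
      (P.map fun ξ => seqMeasure fun k => ((c ξ k).1, ((c ξ k).2, fun i => A i ξ k))) :=
  HasPoissonLaplace.pi_marking h.measurable_points h.measurable_marks (G.prodMkLeft Ω)
    h.prm.hasPoissonLaplace h.marks

theorem IsIBPModel.hasPoissonLaplace_joint {P : Measure Ξ}
    [IsProbabilityMeasure P] {B₀ : Measure Ω} {ρ : Kernel Ω (Fin q → ℝ≥0)} [SigmaFinite (B₀ ⊗ₘ ρ)]
    {c : Ξ → Config Ω q} {A : Fin M → Ξ → ℕ → Fin υ → ℝ} (h : IsIBPModel P (B₀ ⊗ₘ ρ) G c A) :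
    HasPoissonLaplace (jointIntensity B₀ ρ G M)
      (P.map fun ξ => seqMeasure fun k =>
        ((c ξ k).1, (((c ξ k).2.1, fun i => A i ξ k), (c ξ k).2.2))) := by
  have hr : Measurable fun x : (Ω × (Fin q → ℝ≥0)) × (Fin M → Fin υ → ℝ) =>
    ((x.1.1, x.2), x.1.2) := by fun_prop
  have hx : Measurable fun ξ => seqMeasure fun k => ((c ξ k).1, ((c ξ k).2, fun i => A i ξ k)) :=
    measurable_seqMeasure.comp (measurable_pi_lambda _ fun k => by
      have := h.measurable_points; have := h.measurable_marks; fun_prop)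
  have key := h.hasPoissonLaplace.map hr
  rw [Measure.map_map (Measure.measurable_map _ hr) hx] at key
  simp only [Function.comp_def, map_seqMeasure _ hr] at key
  exact key

end Model

/-! ### The random measures `μ₀`. -/

section CRM

variable {Ω : Type*} [MeasurableSpace Ω] {q υ M : ℕ}

theorem crm_apply (N : Measure (Ω × (Fin q → ℝ≥0))) (j : Fin q) {B : Set Ω}
    (hB : MeasurableSet B) :
    crm N j B = ∫⁻ x, (Prod.fst ⁻¹' B).indicator
      (fun x : Ω × (Fin q → ℝ≥0) => (x.2 j : ℝ≥0∞)) x ∂N := by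
  rw [crm, Measure.map_apply measurable_fst hB, withDensity_apply _ (measurable_fst hB),
    lintegral_indicator (measurable_fst hB)]

theorem measurable_crm :
    Measurable (crm : Measure (Ω × (Fin q → ℝ≥0)) → Fin q → Measure Ω) := by
  refine measurable_pi_lambda _ fun j => Measure.measurable_of_measurable_coe _ fun B hB => ?_
  simp_rw [crm_apply _ j hB]
  have h : Measurable fun x : Ω × (Fin q → ℝ≥0) => (x.2 j : ℝ≥0∞) := by fun_prop
  exact Measure.measurable_lintegral (h.indicator (measurable_fst hB))

theorem crm_add_sum_dirac {ι : Type*} [Fintype ι] (N : Measure (Ω × (Fin q → ℝ≥0))) (ω : ι → Ω)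
    (s : ι → Fin q → ℝ≥0) (j : Fin q) :
    crm (N + ∑ i, Measure.dirac (ω i, s i)) j = crm N j + ∑ i, s i j • Measure.dirac (ω i) := by
  ext B hB
  have h : Measurable fun x : Ω × (Fin q → ℝ≥0) => (x.2 j : ℝ≥0∞) := by fun_prop
  have hi := h.indicator (measurable_fst (β := Fin q → ℝ≥0) hB)
  rw [Measure.add_apply, crm_apply _ j hB, crm_apply _ j hB, lintegral_add_measure,
    lintegral_finsetSum_measure, Measure.finsetSum_apply]
  congr 1
  refine Finset.sum_congr rfl fun i _ => ?_
  rw [lintegral_dirac' _ hi, Measure.smul_apply, Measure.dirac_apply' _ hB]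
  classical
  by_cases hω : ω i ∈ B <;> simp [Set.indicator, hω, ENNReal.smul_def]

theorem posteriorCRM_eq (Q : Measure (Measure (Ω × (Fin q → ℝ≥0)))) [SFinite Q]
    (κ : Kernel (Ω × (Fin M → Fin υ → ℝ)) (Fin q → ℝ≥0)) [IsMarkovKernel κ]
    (z : Fin M → Fin υ → SignedMeasure Ω) :
    posteriorCRM Q κ z = (posteriorPoints Q κ z).map crm := by
  have hadd : Measurable fun p : (Fin q → Measure Ω) × (features z → Fin q → ℝ≥0) =>
      fun j => p.1 j + ∑ ω : features z, p.2 ω j • Measure.dirac (ω : Ω) := by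
    refine measurable_pi_lambda _ fun j => Measure.measurable_of_measurable_coe _ fun B hB => ?_
    simp only [Measure.add_apply, Measure.finsetSum_apply, Measure.smul_apply, ENNReal.smul_def]
    have h1 : Measurable fun p : (Fin q → Measure Ω) × (features z → Fin q → ℝ≥0) => p.1 j B :=
      (Measure.measurable_coe hB).comp (by fun_prop)
    refine h1.add (Finset.measurable_sum _ fun ω _ => ?_)
    simp only [smul_eq_mul]
    fun_prop
  have : IsProbabilityMeasure (jumpsLaw κ z) := by unfold jumpsLaw; infer_instance
  have h := Measure.map_prod_map Q (jumpsLaw κ z) measurable_crm measurable_id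
  rw [Measure.map_id] at h
  rw [posteriorCRM, posteriorPoints, h, Measure.map_map hadd (measurable_crm.prodMap measurable_id),
    Measure.map_map measurable_crm (measurable_add_sum_dirac _)]
  congr 1
  ext1 p
  ext1 j
  exact (crm_add_sum_dirac p.1 (fun ω : features z => (ω : Ω)) p.2 j).symm

end CRM

/-! ### Existence of the Poisson and buffet laws. -/

section Existence

variable {Ω : Type*} [MeasurableSpace Ω] {q υ : ℕ}
  {G : Kernel (Fin q → ℝ≥0) (Fin υ → ℝ)} [IsMarkovKernel G]

theorem exists_isPRMLaw {X : Type*} [MeasurableSpace X] [Nonempty X] (ν : Measure X) [SFinite ν] :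
    ∃ Q, IsPRMLaw ν Q := by
  obtain ⟨μ, -, h⟩ := exists_hasPoissonLaplace_seqMeasure ν
  exact ⟨_, h.isPRMLaw⟩

theorem exists_isIBPLaw [Nonempty Ω] (ν : Measure (Ω × (Fin q → ℝ≥0))) [SFinite ν] :
    ∃ R, IsIBPLaw ν G R := by
  obtain ⟨μ, hμ, h⟩ := exists_hasPoissonLaplace_seqMeasure ν
  obtain ⟨φ, hφ, hφG⟩ := G.exists_measurable_map_eq_unitInterval
  let τ : Measure (Unit × ℕ → unitInterval) := Measure.infinitePi fun _ => volume
  -- The mark of the `k`-th entry is a function of its jump vector and of an independent uniform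
  -- variable.
  let F : Config Ω q × (Unit × ℕ → unitInterval) → Config Ω q × (ℕ → Fin υ → ℝ) :=
    fun p => (p.1, fun k => φ (p.1 k).2.2 (p.2 ((), k)))
  have hφk : ∀ k : Unit × ℕ, Measurable fun p : Config Ω q × (Unit × ℕ → unitInterval) =>
      φ (p.1 k.2).2.2 (p.2 k) := fun k => by
    have h : Measurable fun p : Config Ω q × (Unit × ℕ → unitInterval) =>
      ((p.1 k.2).2.2, p.2 k) := by fun_prop
    exact hφ.comp h
  have hF : Measurable F := measurable_fst.prodMk (measurable_pi_lambda _ fun k => hφk ((), k))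
  have hW : IsProbabilityMeasure ((μ.prod τ).map F) :=
    Measure.isProbabilityMeasure_map hF.aemeasurable
  have hfst : ((μ.prod τ).map F).map Prod.fst = μ := by
    rw [Measure.map_map measurable_fst hF]
    exact measurePreserving_fst.map_eq
  refine ⟨_, (μ.prod τ).map F, hW, ⟨measurable_fst, fun _ => measurable_snd, ?_, ?_⟩, rfl⟩
  · have e : ((μ.prod τ).map F).map (fun p => pointMeasure p.1) = μ.map seqMeasure := by
      conv_rhs => rw [← hfst]
      exact (Measure.map_map measurable_seqMeasure measurable_fst).symm
    rw [e]
    exact h.isPRMLaw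
  · intro D hD S B hB
    have hset : MeasurableSet {p : Config Ω q × (ℕ → Fin υ → ℝ) |
        p.1 ∈ D ∧ ∀ x ∈ S, p.2 x.2 ∈ B x} := by
      have e : {p : Config Ω q × (ℕ → Fin υ → ℝ) | p.1 ∈ D ∧ ∀ x ∈ S, p.2 x.2 ∈ B x}
          = Prod.fst ⁻¹' D ∩ ⋂ x ∈ S,
            (fun p : Config Ω q × (ℕ → Fin υ → ℝ) => p.2 x.2) ⁻¹' B x := by
        ext p; simp
      rw [e]
      exact (measurable_fst hD).inter (S.measurableSet_biInter fun x _ =>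
        (by fun_prop : Measurable fun p : Config Ω q × (ℕ → Fin υ → ℝ) => p.2 x.2) (hB x))
    have hprod : Measurable fun c : Config Ω q => ∏ x ∈ S, G (c x.2).2.2 (B x) :=
      Finset.measurable_fun_prod _ fun x _ => (G.measurable_coe (hB x)).comp (by fun_prop)
    have hR : ∫⁻ p in Prod.fst ⁻¹' D, ∏ x ∈ S, G (p.1 x.2).2.2 (B x) ∂((μ.prod τ).map F)
        = ∫⁻ c in D, ∏ x ∈ S, G (c x.2).2.2 (B x) ∂μ := by
      conv_rhs => rw [← hfst]
      rw [setLIntegral_map hD hprod measurable_fst]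
    rw [hR, Measure.map_apply hF hset, Measure.prod_apply (hF hset), ← lintegral_indicator hD]
    refine lintegral_congr fun c => ?_
    by_cases hc : c ∈ D
    · rw [Set.indicator_of_mem hc]
      have hφc : ∀ x : Unit × ℕ, Measurable (φ (c x.2).2.2) := fun x => hφ.comp measurable_prodMk_left
      have h1 := lintegral_prod_infinitePi (fun _ : Unit × ℕ => (volume : Measure unitInterval)) S
        (fun x u => (B x).indicator 1 (φ (c x.2).2.2 u))
        fun x => (measurable_one.indicator (hB x)).comp (hφc x)
      have h2 : ∀ x : Unit × ℕ, ∫⁻ u, (B x).indicator 1 (φ (c x.2).2.2 u)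
          ∂(volume : Measure unitInterval) = G (c x.2).2.2 (B x) := fun x => by
        rw [← hφG, ← lintegral_map (measurable_one.indicator (hB x)) (hφc x),
          lintegral_indicator_one (hB x)]
      simp_rw [h2] at h1
      rw [← h1, ← lintegral_indicator_one (measurable_prodMk_left (hF hset))]
      refine lintegral_congr fun u => ?_
      classical
      by_cases hu : ∀ x ∈ S, φ (c x.2).2.2 (u x) ∈ B x
      · rw [Finset.prod_congr rfl fun x hx => Set.indicator_of_mem (hu x hx) _]
        rw [Set.indicator_of_mem]
        · simp
        · exact ⟨hc, hu⟩
      · rw [Set.indicator_of_notMem fun hmem => hu hmem.2]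
        push Not at hu
        obtain ⟨x, hx, hxB⟩ := hu
        exact (Finset.prod_eq_zero hx (Set.indicator_of_notMem hxB _)).symm
    · rw [Set.indicator_of_notMem hc]
      convert measure_empty (μ := τ)
      ext u
      simp [F, hc]

end Existence

/-! ### The predictive law of a further process. -/

section Predictive

variable {Ω Ξ : Type*} [MeasurableSpace Ω] [MeasurableSpace Ξ] {q υ M : ℕ}
  {G : Kernel (Fin q → ℝ≥0) (Fin υ → ℝ)} [IsMarkovKernel G]

/-- The mean measure of the points `(ω, (s, a))` with a single mark `a`. -/
def markedIntensity (ν : Measure (Ω × (Fin q → ℝ≥0))) (G : Kernel (Fin q → ℝ≥0) (Fin υ → ℝ)) :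
    Measure (Ω × ((Fin q → ℝ≥0) × (Fin υ → ℝ))) :=
  (ν ⊗ₘ G.prodMkLeft Ω).map fun x => (x.1.1, (x.1.2, x.2))

theorem lintegral_markedIntensity {ν : Measure (Ω × (Fin q → ℝ≥0))} [SFinite ν]
    {f : Ω × ((Fin q → ℝ≥0) × (Fin υ → ℝ)) → ℝ≥0∞} (hf : Measurable f) :
    ∫⁻ x, f x ∂(markedIntensity ν G) = ∫⁻ x, ∫⁻ a, f (x.1, (x.2, a)) ∂(G x.2) ∂ν := by
  rw [markedIntensity, lintegral_map hf (by fun_prop), Measure.lintegral_compProd (by fun_prop)]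
  rfl

/-- The mean measure of the points `((ω, a), (s, t))` with marks `a` and a further mark `t`. -/
def predictiveIntensity (B₀ : Measure Ω) (ρ : Kernel Ω (Fin q → ℝ≥0))
    (G : Kernel (Fin q → ℝ≥0) (Fin υ → ℝ)) [IsMarkovKernel G] (M : ℕ) :
    Measure ((Ω × (Fin M → Fin υ → ℝ)) × ((Fin q → ℝ≥0) × (Fin υ → ℝ))) :=
  (jointIntensity B₀ ρ G M ⊗ₘ G.prodMkLeft _).map MeasurableEquiv.prodAssoc

theorem lintegral_piKernel_succ {s : Fin q → ℝ≥0}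
    {f : (Fin M → Fin υ → ℝ) × (Fin υ → ℝ) → ℝ≥0∞} (hf : Measurable f) :
    ∫⁻ a, f (fun i => a i.castSucc, a (Fin.last M)) ∂(piKernel (Fin (M + 1)) G s)
      = ∫⁻ a, ∫⁻ t, f (a, t) ∂(G s) ∂(piKernel (Fin M) G s) := by
  have h := measurePreserving_piFinSuccAbove (fun _ : Fin (M + 1) => G s) (Fin.last M)
  have h1 := h.lintegral_comp (f := fun p => f (p.2, p.1)) (by fun_prop)
  rw [lintegral_prod_symm _ (by fun_prop)] at h1
  rw [piKernel_apply, piKernel_apply, ← h1]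
  refine lintegral_congr fun a => ?_
  simp [MeasurableEquiv.piFinSuccAbove, Fin.insertNthEquiv, Fin.init_def]

section Intensity

variable {B₀ : Measure Ω} {ρ : Kernel Ω (Fin q → ℝ≥0)} [SFinite B₀] [IsSFiniteKernel ρ]

instance : SFinite (jointIntensity B₀ ρ G M) := by unfold jointIntensity; infer_instance

omit [SFinite B₀] [IsSFiniteKernel ρ] in
theorem lintegral_predictiveIntensity
    {f : (Ω × (Fin M → Fin υ → ℝ)) × ((Fin q → ℝ≥0) × (Fin υ → ℝ)) → ℝ≥0∞} (hf : Measurable f) :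
    ∫⁻ x, f x ∂(predictiveIntensity B₀ ρ G M)
      = ∫⁻ x, ∫⁻ t, f (x.1, (x.2, t)) ∂(G x.2) ∂(jointIntensity B₀ ρ G M) := by
  rw [predictiveIntensity, lintegral_map hf (MeasurableEquiv.measurable _)]
  exact Measure.lintegral_compProd (hf.comp (MeasurableEquiv.measurable _))

theorem map_piKernel_succ :
    ((B₀ ⊗ₘ ρ) ⊗ₘ (piKernel (Fin (M + 1)) G).prodMkLeft Ω).map
        (fun x => ((x.1.1, fun i : Fin M => x.2 i.castSucc), (x.1.2, x.2 (Fin.last M))))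
      = predictiveIntensity B₀ ρ G M := by
  refine Measure.ext_of_lintegral _ fun f hf => ?_
  have hG : Measurable fun x : (Ω × (Fin M → Fin υ → ℝ)) × (Fin q → ℝ≥0) =>
      ∫⁻ t, f (x.1, (x.2, t)) ∂(G x.2) :=
    Measurable.lintegral_kernel_prod_right' (κ := G.prodMkLeft (Ω × (Fin M → Fin υ → ℝ)))
      (f := fun p => f (p.1.1, (p.1.2, p.2))) (by fun_prop)
  have hm : Measurable fun x : (Ω × (Fin q → ℝ≥0)) × (Fin (M + 1) → Fin υ → ℝ) =>
      f ((x.1.1, fun i : Fin M => x.2 i.castSucc), (x.1.2, x.2 (Fin.last M))) :=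
    hf.comp (by fun_prop)
  rw [lintegral_predictiveIntensity hf, lintegral_jointIntensity hG, lintegral_map hf (by fun_prop),
    Measure.lintegral_compProd hm, Measure.lintegral_compProd]
  · refine lintegral_congr fun ω => lintegral_congr fun s => ?_
    exact lintegral_piKernel_succ (f := fun p => f ((ω, p.1), (s, p.2))) (by fun_prop)
  · exact Measurable.lintegral_kernel_prod_right'
      (κ := (piKernel (Fin (M + 1)) G).prodMkLeft Ω) hm

/-- The further mark is stored beside the jump, not among the observed values. The splitting then
has the shape required by the abstract posterior theorem, with pairs (jump, further mark) as jumps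
and `κ ⊗ₖ G` as their kernel. -/
theorem predictiveIntensity_eq
    {κ : Kernel (Ω × (Fin M → Fin υ → ℝ)) (Fin q → ℝ≥0)} [IsMarkovKernel κ]
    (hκ : nonzeroIntensity B₀ ρ G M = (nonzeroIntensity B₀ ρ G M).fst ⊗ₘ κ) :
    predictiveIntensity B₀ ρ G M
      = (markedIntensity (updatedIntensity B₀ ρ G M) G).map zeroValue
        + (nonzeroIntensity B₀ ρ G M).fst ⊗ₘ (κ ⊗ₖ G.prodMkLeft _) := by
  have h1 : SFinite (updatedIntensity B₀ ρ G M) := by unfold updatedIntensity; infer_instance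
  have h2 : SFinite (nonzeroIntensity B₀ ρ G M) := by unfold nonzeroIntensity; infer_instance
  have h3 : SFinite (nonzeroIntensity B₀ ρ G M).fst := by unfold Measure.fst; infer_instance
  rw [predictiveIntensity, jointIntensity_eq, Measure.compProd_add_left,
    Measure.map_add _ _ (MeasurableEquiv.measurable _)]
  congr 1
  · refine Measure.ext_of_lintegral _ fun f hf => ?_
    have hm : Measurable fun x : ((Ω × (Fin M → Fin υ → ℝ)) × (Fin q → ℝ≥0)) × (Fin υ → ℝ) =>
        f (MeasurableEquiv.prodAssoc x) := hf.comp (MeasurableEquiv.measurable _)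
    rw [lintegral_map hf (MeasurableEquiv.measurable _), Measure.lintegral_compProd hm,
      lintegral_map hm.lintegral_kernel_prod_right' measurable_zeroValue,
      lintegral_map hf measurable_zeroValue,
      lintegral_markedIntensity (f := fun x => f (zeroValue x)) (hf.comp measurable_zeroValue)]
    rfl
  · conv_lhs => rw [hκ]
    exact Measure.compProd_assoc'

theorem predictiveIntensity_mark_ne_zero (hG_fin : ∫⁻ x, G x.2 {0}ᶜ ∂(B₀ ⊗ₘ ρ) < ∞) :
    predictiveIntensity B₀ ρ G M {x | x.2.2 ≠ 0} ≠ ∞ := by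
  have hs : MeasurableSet {x : (Ω × (Fin M → Fin υ → ℝ)) × ((Fin q → ℝ≥0) × (Fin υ → ℝ)) |
      x.2.2 ≠ 0} := (measurable_snd.comp measurable_snd) (measurableSet_singleton 0).compl
  have hGm : Measurable fun s => G s {0}ᶜ := G.measurable_coe (measurableSet_singleton 0).compl
  rw [← lintegral_indicator_one hs, lintegral_predictiveIntensity (measurable_one.indicator hs)]
  have h : ∀ x : (Ω × (Fin M → Fin υ → ℝ)) × (Fin q → ℝ≥0), ∫⁻ t,
      {x : (Ω × (Fin M → Fin υ → ℝ)) × ((Fin q → ℝ≥0) × (Fin υ → ℝ)) |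
        x.2.2 ≠ 0}.indicator 1 (x.1, (x.2, t)) ∂(G x.2) = G x.2 {0}ᶜ := fun x => by
    rw [← lintegral_indicator_one (measurableSet_singleton 0).compl]
    rfl
  have hGm' : Measurable fun x : Ω × (Fin q → ℝ≥0) => G x.2 {0}ᶜ := hGm.comp measurable_snd
  have hGm'' : Measurable fun x : (Ω × (Fin M → Fin υ → ℝ)) × (Fin q → ℝ≥0) => G x.2 {0}ᶜ :=
    hGm.comp measurable_snd
  simp_rw [h]
  rw [lintegral_jointIntensity hGm'']
  rw [Measure.lintegral_compProd hGm'] at hG_fin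
  simpa using hG_fin.ne

omit [SFinite B₀] [IsSFiniteKernel ρ] in
theorem updatedIntensity_le : updatedIntensity B₀ ρ G M ≤ B₀ ⊗ₘ ρ := by
  conv_rhs => rw [← withDensity_one (μ := B₀ ⊗ₘ ρ)]
  exact withDensity_mono (ae_of_all _ fun x => pow_le_one₀ zero_le (zeroMass_le_one x.2))

omit [SFinite B₀] [IsSFiniteKernel ρ] in
theorem markedIntensity_mark_ne_zero (hG_fin : ∫⁻ x, G x.2 {0}ᶜ ∂(B₀ ⊗ₘ ρ) < ∞) :
    markedIntensity (updatedIntensity B₀ ρ G M) G {x | x.2.2 ≠ 0} ≠ ∞ := by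
  have hs : MeasurableSet {x : Ω × ((Fin q → ℝ≥0) × (Fin υ → ℝ)) |
      x.2.2 ≠ 0} := (measurable_snd.comp measurable_snd) (measurableSet_singleton 0).compl
  have h1 : SFinite (updatedIntensity B₀ ρ G M) := by unfold updatedIntensity; infer_instance
  rw [← lintegral_indicator_one hs, lintegral_markedIntensity (measurable_one.indicator hs)]
  have h : ∀ x : Ω × (Fin q → ℝ≥0), ∫⁻ t,
      {x : Ω × ((Fin q → ℝ≥0) × (Fin υ → ℝ)) | x.2.2 ≠ 0}.indicator 1 (x.1, (x.2, t)) ∂(G x.2)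
        = G x.2 {0}ᶜ := fun x => by
    rw [← lintegral_indicator_one (measurableSet_singleton 0).compl]
    rfl
  simp_rw [h]
  have hle : updatedIntensity B₀ ρ G M ≤ B₀ ⊗ₘ ρ := updatedIntensity_le
  exact ((lintegral_mono' hle le_rfl).trans_lt hG_fin).ne

end Intensity

/-- The process `∑ a δ_ω` of the points `(ω, (s, a))`. -/
def markProcess (N : Measure (Ω × ((Fin q → ℝ≥0) × (Fin υ → ℝ)))) : Fin υ → SignedMeasure Ω :=
  fun j => signedOf (fun y => y.1) (fun y => y.2.2 j) N

theorem measurable_markProcess :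
    Measurable (markProcess : Measure (Ω × ((Fin q → ℝ≥0) × (Fin υ → ℝ))) → _) :=
  measurable_pi_lambda _ fun j => measurable_signedOf (by fun_prop) (by fun_prop)

theorem markProcess_seqMeasure {c : Config Ω q} {a : ℕ → Fin υ → ℝ}
    (hfin : {k | (c k).1 = true ∧ a k ≠ 0}.Finite) :
    markProcess (seqMeasure fun k => ((c k).1, ((c k).2.1, ((c k).2.2, a k))))
      = featureProcess c a := by
  ext1 j
  refine signedOf_seqMeasure (by fun_prop) (by fun_prop) (hfin.subset fun k hk => ⟨hk.1, fun h0 => ?_⟩)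
  exact hk.2 (by simp [h0])

theorem measurable_markedPoints : Measurable fun p : Config Ω q × (ℕ → Fin υ → ℝ) =>
    seqMeasure fun k => ((p.1 k).1, ((p.1 k).2.1, ((p.1 k).2.2, p.2 k))) :=
  measurable_seqMeasure.comp (measurable_pi_lambda _ fun k => by fun_prop)

theorem measurable_featureProcess :
    Measurable fun p : Config Ω q × (ℕ → Fin υ → ℝ) => featureProcess p.1 p.2 := by
  refine measurable_pi_lambda _ fun j => ?_
  have h : Measurable fun p : Config Ω q × (ℕ → Fin υ → ℝ) =>
      fun k => ((p.1 k).1, ((p.1 k).2.1, ((p.1 k).2.2, p.2 k))) :=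
    measurable_pi_lambda _ fun k => by fun_prop
  exact (measurable_signedSeq (g := fun y : Ω × ((Fin q → ℝ≥0) × (Fin υ → ℝ)) => y.1)
    (a := fun y => y.2.2 j) (by fun_prop) (by fun_prop)).comp h

theorem integrable_mark_of_lt_top {N : Measure (Ω × ((Fin q → ℝ≥0) × (Fin υ → ℝ)))}
    {c : Config Ω q} {a : ℕ → Fin υ → ℝ}
    (hfin : {k | (c k).1 = true ∧ a k ≠ 0}.Finite) (j : Fin υ)
    (hN : N = seqMeasure fun k => ((c k).1, ((c k).2.1, ((c k).2.2, a k)))) :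
    Integrable (fun y => y.2.2 j) N := by
  rw [hN]
  refine integrable_seqMeasure (by fun_prop) (hfin.subset fun k hk => ⟨hk.1, fun h0 => ?_⟩)
  exact hk.2 (by simp [h0])

/-- A single process is a function of a Poisson random measure of points `(ω, (s, a))`. -/
theorem IsIBPLaw.exists_hasPoissonLaplace {ν : Measure (Ω × (Fin q → ℝ≥0))} [SigmaFinite ν]
    {R : Measure (Fin υ → SignedMeasure Ω)} (hR : IsIBPLaw ν G R)
    (hν : markedIntensity ν G {x | x.2.2 ≠ 0} ≠ ∞) :
    ∃ Q₀, HasPoissonLaplace (markedIntensity ν G) Q₀ ∧ R = Q₀.map markProcess ∧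
      ∀ᵐ N ∂Q₀, ∀ j, Integrable (fun y => y.2.2 j) N := by
  obtain ⟨W, hW, hmodel, rfl⟩ := hR
  have hs : MeasurableSet {x : Ω × ((Fin q → ℝ≥0) × (Fin υ → ℝ)) |
      x.2.2 ≠ 0} := (measurable_snd.comp measurable_snd) (measurableSet_singleton 0).compl
  have hr : Measurable fun x : (Ω × (Fin q → ℝ≥0)) × (Unit → Fin υ → ℝ) =>
    (x.1.1, (x.1.2, x.2 ())) := by fun_prop
  have hx : Measurable fun p : Config Ω q × (ℕ → Fin υ → ℝ) =>
      seqMeasure fun k => ((p.1 k).1, ((p.1 k).2, fun _ : Unit => p.2 k)) :=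
    measurable_seqMeasure.comp (measurable_pi_lambda _ fun k => by fun_prop)
  have key := hmodel.hasPoissonLaplace.map hr
  rw [Measure.map_map (Measure.measurable_map _ hr) hx] at key
  simp only [Function.comp_def, map_seqMeasure _ hr] at key
  have e : (ν ⊗ₘ (piKernel Unit G).prodMkLeft Ω).map (fun x => (x.1.1, (x.1.2, x.2 ())))
      = markedIntensity ν G := by
    refine Measure.ext_of_lintegral _ fun f hf => ?_
    rw [lintegral_markedIntensity hf, lintegral_map hf hr]
    refine (Measure.lintegral_compProd (hf.comp hr)).trans (lintegral_congr fun x => ?_)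
    exact (measurePreserving_eval (fun _ : Unit => G x.2) ()).lintegral_comp
      (f := fun a => f (x.1, (x.2, a))) (by fun_prop)
  rw [e] at key
  have hfin : ∀ᵐ p ∂W, {k | (p.1 k).1 = true ∧ p.2 k ≠ 0}.Finite := by
    filter_upwards [ae_of_ae_map measurable_markedPoints.aemeasurable (key.ae_lt_top hs hν)]
      with p hp
    exact finite_of_seqMeasure_lt_top hs hp
  refine ⟨_, key, ?_, ?_⟩
  · rw [Measure.map_map measurable_markProcess measurable_markedPoints]
    refine Measure.map_congr ?_
    filter_upwards [hfin] with p hp using (markProcess_seqMeasure hp).symm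
  · have hmeas : MeasurableSet {N : Measure (Ω × ((Fin q → ℝ≥0) × (Fin υ → ℝ))) |
        ∀ j, Integrable (fun y => y.2.2 j) N} := by
      simp only [Set.ofPred_forall]
      exact MeasurableSet.iInter fun j => measurableSet_setOf_integrable (by fun_prop)
    refine (ae_map_iff measurable_markedPoints.aemeasurable hmeas).2 ?_
    filter_upwards [hfin] with p hp j using integrable_mark_of_lt_top hp j rfl

/-- The marginal of `κ ⊗ₖ G` in the mark is the mixture of `G` over the law of the jump, and
`markProcess` is additive. Additivity needs integrability, since `signedOf` is `0` on measures for
which the mark is not integrable. -/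
theorem predictiveLaw_eq {Q₀ : Measure (Measure (Ω × ((Fin q → ℝ≥0) × (Fin υ → ℝ))))} [SFinite Q₀]
    (hint : ∀ᵐ N ∂Q₀, ∀ j, Integrable (fun y => y.2.2 j) N)
    (κ : Kernel (Ω × (Fin M → Fin υ → ℝ)) (Fin q → ℝ≥0)) [IsMarkovKernel κ]
    (z : Fin M → Fin υ → SignedMeasure Ω) :
    predictiveLaw (Q₀.map markProcess) G κ z
      = (posteriorLaw Q₀ (κ ⊗ₖ G.prodMkLeft _) z).map markProcess := by
  have hsnd : Measurable fun (v : features z → (Fin q → ℝ≥0) × (Fin υ → ℝ)) ω => (v ω).2 := by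
    fun_prop
  have hpi : (Measure.pi fun ω : features z => (κ (ω, featureValues z ω)).bind G)
      = (Measure.pi fun ω : features z => (κ ⊗ₖ G.prodMkLeft _) (ω, featureValues z ω)).map
        fun v ω => (v ω).2 := by
    have h0 : ∀ y, ((κ ⊗ₖ G.prodMkLeft _) y).map Prod.snd = (κ y).bind G := fun y => by
      rw [← Kernel.comp_apply, ← Kernel.snd_compProd_prodMkLeft, Kernel.snd_apply]
    have hprob : ∀ y, IsProbabilityMeasure (((κ ⊗ₖ G.prodMkLeft _) y).map Prod.snd) := fun y =>
      Measure.isProbabilityMeasure_map measurable_snd.aemeasurable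
    have h := Measure.pi_map_pi
      (hμ := fun ω : features z => inferInstanceAs (SigmaFinite
        (((κ ⊗ₖ G.prodMkLeft _) ((ω : Ω), featureValues z ω)).map Prod.snd)))
      (μ := fun ω : features z => (κ ⊗ₖ G.prodMkLeft _) ((ω : Ω), featureValues z ω))
      (f := fun _ => Prod.snd) fun _ => measurable_snd.aemeasurable
    simp only [h0] at h
    exact h.symm
  have hadd : Measurable fun p : (Fin υ → SignedMeasure Ω) × (features z → Fin υ → ℝ) =>
      fun j => p.1 j + ∑ ω : features z, p.2 ω j • (Measure.dirac (ω : Ω)).toSignedMeasure := by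
    refine measurable_pi_lambda _ fun j => SignedMeasure.measurable_of_eval fun B hB => ?_
    simp only [_root_.add_apply, signedMeasure_finsetSum_apply, _root_.smul_apply, smul_eq_mul]
    have h1 : Measurable fun p : (Fin υ → SignedMeasure Ω) × (features z → Fin υ → ℝ) => p.1 j B :=
      (SignedMeasure.measurable_eval hB).comp (by fun_prop)
    fun_prop
  have hprod := Measure.map_prod_map Q₀
    (Measure.pi fun ω : features z => (κ ⊗ₖ G.prodMkLeft _) ((ω : Ω), featureValues z ω))
    measurable_markProcess hsnd
  rw [predictiveLaw, posteriorLaw, hpi, hprod,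
    Measure.map_map hadd (measurable_markProcess.prodMap hsnd),
    Measure.map_map measurable_markProcess (measurable_add_sum_dirac _)]
  refine Measure.map_congr ?_
  have hint' := Measure.quasiMeasurePreserving_fst (μ := Q₀) (ν := Measure.pi
    fun ω : features z => (κ ⊗ₖ G.prodMkLeft _) ((ω : Ω), featureValues z ω)) |>.ae hint
  filter_upwards [hint'] with p hp
  ext1 j
  simp only [Function.comp_apply, Prod.map, markProcess]
  rw [signedOf_add (by fun_prop) (hp j) (integrable_finsetSum_dirac (by fun_prop) _ _),
    signedOf_finsetSum_dirac (by fun_prop) (by fun_prop)]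

end Predictive

/-- The integrand `min (∑ sⱼ) 1` vanishes only at `s = 0`, which `ρ` does not charge. -/
theorem sigmaFinite_intensity {Ω : Type*} [MeasurableSpace Ω] {q : ℕ} (B₀ : Measure Ω)
    [SigmaFinite B₀] (ρ : Kernel Ω (Fin q → ℝ≥0)) [IsSFiniteKernel ρ]
    (hρ_zero : ∀ ω, ρ ω {0} = 0)
    (hρ_levy : ∀ ω, ∫⁻ s, min (∑ j, (s j : ℝ≥0∞)) 1 ∂(ρ ω) < ∞) : SigmaFinite (B₀ ⊗ₘ ρ) := by
  refine sigmaFinite_compProd_of_lintegral B₀ ρ (f := fun s => min (∑ j, (s j : ℝ≥0∞)) 1)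
    (by fun_prop) (fun ω => ?_) (fun s => ?_) hρ_levy
  · have h : ∀ᵐ s ∂(ρ ω), s ≠ 0 := by
      rw [ae_iff]; simpa using hρ_zero ω
    filter_upwards [h] with s hs h0
    refine hs (funext fun j => ?_)
    rcases min_eq_bot.1 h0 with h1 | h1
    · simpa using (Finset.sum_eq_zero_iff.1 h1) j (Finset.mem_univ j)
    · exact absurd h1 one_ne_zero
  · exact ((min_le_right _ _).trans_lt ENNReal.one_lt_top).ne

/-! ### The proposition. -/

theorem proposition5p2 {Ω Ξ : Type*} [MeasurableSpace Ω] [StandardBorelSpace Ω]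
    [MeasurableSpace Ξ] {q υ M : ℕ}
    (P : Measure Ξ) [IsProbabilityMeasure P]
    (B₀ : Measure Ω) [SigmaFinite B₀] [NullSingletonClass B₀]
    (ρ : Kernel Ω (Fin q → ℝ≥0)) [IsSFiniteKernel ρ]
    (hρ_zero : ∀ ω, ρ ω {0} = 0)
    (hρ_levy : ∀ ω, ∫⁻ s, min (∑ j, (s j : ℝ≥0∞)) 1 ∂(ρ ω) < ∞)
    (G : Kernel (Fin q → ℝ≥0) (Fin υ → ℝ)) [IsMarkovKernel G]
    (hG_zero : ∀ s, 0 < G s {0})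
    (hG_fin : ∫⁻ x, G x.2 {0}ᶜ ∂(B₀ ⊗ₘ ρ) < ∞)
    (c : Ξ → Config Ω q) (A : Fin M → Ξ → ℕ → Fin υ → ℝ)
    (hmodel : IsIBPModel P (B₀ ⊗ₘ ρ) G c A)
    (Z : Ξ → Fin M → Fin υ → SignedMeasure Ω)
    (hZ : ∀ ξ i, Z ξ i = featureProcess (c ξ) (A i ξ)) :
    (∃ κ : Kernel (Ω × (Fin M → Fin υ → ℝ)) (Fin q → ℝ≥0),
      IsMarkovKernel κ ∧ IsJumpLaw B₀ ρ G κ) ∧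
    (∃ Q, IsPRMLaw (updatedIntensity B₀ ρ G M) Q) ∧
    (∃ R, IsIBPLaw (updatedIntensity B₀ ρ G M) G R) ∧
    ∀ (κ : Kernel (Ω × (Fin M → Fin υ → ℝ)) (Fin q → ℝ≥0)), IsMarkovKernel κ →
      IsJumpLaw B₀ ρ G κ →
    ∀ Q, IsPRMLaw (updatedIntensity B₀ ρ G M) Q →
    ∀ R, IsIBPLaw (updatedIntensity B₀ ρ G M) G R →
      -- the posterior law of `N`, and the form of the density of the jumps
      IsCondLaw P Z (fun ξ => pointMeasure (c ξ)) (posteriorPoints Q κ) ∧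
      (∀ (lam : Measure (Fin υ → ℝ)) (g : (Fin q → ℝ≥0) → (Fin υ → ℝ) → ℝ≥0∞),
        SigmaFinite lam → Measurable (Function.uncurry g) →
        (∀ s, (G s).restrict {0}ᶜ = (lam.restrict {0}ᶜ).withDensity (g s)) →
        ∀ᵐ ξ ∂P, ∀ ω ∈ features (Z ξ),
          κ (ω, featureValues (Z ξ) ω) =
            (∫⁻ s, jumpDensity G g (featureValues (Z ξ) ω) s ∂(ρ ω))⁻¹ •
              (ρ ω).withDensity (jumpDensity G g (featureValues (Z ξ) ω))) ∧
      -- the posterior law of `μ₀`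
      IsCondLaw P Z (fun ξ => crm (pointMeasure (c ξ))) (posteriorCRM Q κ) ∧
      -- the predictive law of a further process
      (∀ A' : Ξ → ℕ → Fin υ → ℝ,
        IsIBPModel P (B₀ ⊗ₘ ρ) G c (Fin.snoc (α := fun _ => Ξ → ℕ → Fin υ → ℝ) A A') →
        IsCondLaw P Z (fun ξ => featureProcess (c ξ) (A' ξ)) (predictiveLaw R G κ)) := by
  have hσ := sigmaFinite_intensity B₀ ρ hρ_zero hρ_levy
  have hσ' : SigmaFinite (updatedIntensity B₀ ρ G M) := Measure.sigmaFinite_of_le _ updatedIntensity_le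
  obtain ⟨ξ₀⟩ : Nonempty Ξ := nonempty_of_isProbabilityMeasure P
  have : Nonempty Ω := ⟨(c ξ₀ 0).2.1⟩
  refine ⟨exists_isJumpLaw hG_zero hG_fin, exists_isPRMLaw _, exists_isIBPLaw _,
    fun κ _ hκ Q hQ R hR => ?_⟩
  rw [isJumpLaw_iff hG_zero hG_fin] at hκ
  have hfinite := isFiniteMeasure_nonzeroIntensity (M := M) hG_fin
  have hdiff := nonzeroIntensity_fst_diffuse (B₀ := B₀) (ρ := ρ) (G := G) (M := M)
  have hzero := nonzeroIntensity_fst_zero (B₀ := B₀) (ρ := ρ) (G := G) (M := M)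
  have hcm := hmodel.measurable_points
  have hAm := hmodel.measurable_marks
  let x : Ξ → ℕ → Bool × ((Ω × (Fin M → Fin υ → ℝ)) × (Fin q → ℝ≥0)) := fun ξ k =>
    ((c ξ k).1, (((c ξ k).2.1, fun i => A i ξ k), (c ξ k).2.2))
  have hx : Measurable x := measurable_pi_lambda _ fun k => by fun_prop
  have hZx : Z = fun ξ => processSeq (x ξ) := by
    funext ξ i
    exact hZ ξ i
  have hlaw : HasPoissonLaplace ((updatedIntensity B₀ ρ G M).map zeroValue
      + (nonzeroIntensity B₀ ρ G M).fst ⊗ₘ κ) (P.map fun ξ => seqMeasure (x ξ)) := by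
    rw [← hκ, ← jointIntensity_eq]
    exact hmodel.hasPoissonLaplace_joint
  have hpoints : ∀ ξ, (seqMeasure (x ξ)).map dropValue = pointMeasure (c ξ) := fun ξ =>
    map_seqMeasure _ measurable_dropValue
  have hposterior : IsCondLaw P Z (fun ξ => pointMeasure (c ξ)) (posteriorPoints Q κ) := by
    have h := isCondLaw_posteriorLaw hQ.hasPoissonLaplace hdiff hzero hx hlaw
    simp only [hpoints] at h
    rw [hZx]
    exact h
  refine ⟨hposterior, fun lam g _ hg hGg => ?_, ?_, fun A' hmodel' => ?_⟩
  · have h := ae_jumpLaw_eq_of_density (measurable_jumpDensity (M := M) hG_zero hg)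
      (fun s => piKernel_eq_withDensity hG_zero hg s (hGg s)) hG_fin hκ
    rw [hZx]
    exact ae_forall_features hQ.hasPoissonLaplace hdiff hzero hx hlaw h
  · have := hQ.isProb
    exact hposterior.map measurable_crm (measurable_crm.comp hposterior.2.1) (ae_of_all _ fun _ => rfl)
      (posteriorCRM_eq Q κ)
  · obtain ⟨Q₀, hQ₀, rfl, hint⟩ := hR.exists_hasPoissonLaplace (markedIntensity_mark_ne_zero hG_fin)
    have := hQ₀.isProb
    have hA'm : Measurable A' := by
      simpa using hmodel'.measurable_marks (Fin.last M)
    -- The same observed points, with the mark of the further process stored in the jump coordinate.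
    let x' : Ξ → ℕ → Bool × ((Ω × (Fin M → Fin υ → ℝ)) × ((Fin q → ℝ≥0) × (Fin υ → ℝ))) :=
      fun ξ k => ((c ξ k).1, (((c ξ k).2.1, fun i => A i ξ k), ((c ξ k).2.2, A' ξ k)))
    have hx' : Measurable x' := measurable_pi_lambda _ fun k => by fun_prop
    have hsnoc := hmodel'.measurable_marks
    have hr : Measurable fun y : (Ω × (Fin q → ℝ≥0)) × (Fin (M + 1) → Fin υ → ℝ) =>
      ((y.1.1, fun i : Fin M => y.2 i.castSucc), (y.1.2, y.2 (Fin.last M))) := by fun_prop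
    have hxs : Measurable fun ξ => seqMeasure fun k => ((c ξ k).1, ((c ξ k).2,
        fun i => Fin.snoc (α := fun _ => Ξ → ℕ → Fin υ → ℝ) A A' i ξ k)) :=
      measurable_seqMeasure.comp (measurable_pi_lambda _ fun k => by fun_prop)
    have hlaw' : HasPoissonLaplace (predictiveIntensity B₀ ρ G M)
        (P.map fun ξ => seqMeasure (x' ξ)) := by
      have key := hmodel'.hasPoissonLaplace.map hr
      rw [Measure.map_map (Measure.measurable_map _ hr) hxs, map_piKernel_succ] at key
      simp only [Function.comp_def, map_seqMeasure _ hr, Fin.snoc_castSucc, Fin.snoc_last] at key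
      exact key
    -- Only finitely many marks of the further process are nonzero, so it is the image of the point
    -- measure under `markProcess`.
    have hactive : ∀ᵐ ξ ∂P, {k | (c ξ k).1 = true ∧ A' ξ k ≠ 0}.Finite := by
      have hs : MeasurableSet {x : (Ω × (Fin M → Fin υ → ℝ)) × ((Fin q → ℝ≥0) × (Fin υ → ℝ)) |
          x.2.2 ≠ 0} := (measurable_snd.comp measurable_snd) (measurableSet_singleton 0).compl
      filter_upwards [ae_of_ae_map (measurable_seqMeasure.comp hx').aemeasurable
        (hlaw'.ae_lt_top hs (predictiveIntensity_mark_ne_zero hG_fin))] with ξ hξ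
      exact finite_of_seqMeasure_lt_top hs hξ
    rw [predictiveIntensity_eq hκ] at hlaw'
    have h := isCondLaw_posteriorLaw hQ₀ hdiff hzero hx' hlaw'
    -- `processSeq` ignores the jump coordinate, so `x` and `x'` give the same processes.
    have hZx' : Z = fun ξ => processSeq (x' ξ) := hZx
    rw [hZx']
    refine h.map measurable_markProcess (measurable_featureProcess.comp (hcm.prodMk hA'm)) ?_
      (predictiveLaw_eq hint κ)
    filter_upwards [hactive] with ξ hξ
    rw [map_seqMeasure _ measurable_dropValue]
    exact (markProcess_seqMeasure hξ).symm

end
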